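/- Let $X$ be a compact complex manifold of dimension $n$ with a Kähler form $\omega$ (a smooth closed positive real $(1,1)$-form). Put $d=\partial+\bar\partial$, $d^c=\frac{1}{2\pi i}(\partial-\bar\partial)$, $\omega_u=\omega+dd^cu$ and $MA(u)=\omega_u^n/V$ for smooth $u:X\to\mathbb R$, where $V=\int_X\omega^n$, and let $\mathcal H=\{u\in C^\infty(X,\mathbb R):\omega_u>0\}$ be the space of Kähler potentials. A path in $\mathcal H$ is a smooth function $\varphi$ on $[0,1]\times X$ with $\varphi_t=\varphi(t,\cdot)\in\mathcal H$ for all $t$; dots denote $t$-derivatives. The generalized Landau–Hall functional of a path is $$LH(\varphi)=\frac12\int_0^1\!\int_X\dot\varphi_t^{\,2}\,MA(\varphi_t)\,dt+\int_0^1\!\int_X\dot\varphi_t\,MA(\dot\varphi_t)\,dt .$$ A magnetic geodesic between $\varphi_0,\varphi_1\in\mathcal H$ is a path $\varphi$ in $\mathcal H$ from $\varphi_0$ to $\varphi_1$ that is an extremal of $LH$ with fixed endpoints: $\frac{d}{ds}\big|_{s=0}LH(\phi_{s,\cdot})$ exists and equals $0$ for every smooth family $\phi_{s,t}\in\mathcal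 H$ ($|s|<\varepsilon$, $0\le t\le1$) with $\phi_{0,t}=\varphi_t$, $\phi_{s,0}=\varphi_0$, $\phi_{s,1}=\varphi_1$. **Theorem.** A path $\varphi$ in $\mathcal H$ from $\varphi_0$ to $\varphi_1$ is a magnetic geodesic between $\varphi_0$ and $\varphi_1$ if and only if, for every $t\in[0,1]$, it satisfies on $X$ the equation of $2n$-forms $$\ddot\varphi\,MA(\varphi)=\frac nV\Big[d\dot\varphi\wedge d^c\dot\varphi\wedge\omega_\varphi^{n-1}-2\,dd^c\ddot\varphi\wedge\omega_{\dot\varphi}^{n-1}-(n-1)\,dd^c\dot\varphi\wedge dd^c\ddot\varphi\wedge\omega_{\dot\varphi}^{n-2}\Big].$$ (Terms on the right whose coefficient vanishes are read as $0$: the last one if $n=1$, the whole right-hand side if $n=0$.) -/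

import Mathlib

open scoped Manifold ContDiff Topology

noncomputable section

namespace KaehlerPotentials

/-! ### Complex manifolds, differential forms, exterior derivative

A complex manifold of dimension `n` is a charted space over `ℂⁿ` with holomorphic transition maps.
Its real tangent spaces are those of the model `𝓘(ℝ, ℂⁿ)`. -/

/-- The complex model space `ℂⁿ`. -/
abbrev Cn (n : ℕ) : Type := EuclideanSpace ℂ (Fin n)

/-- The real tangent space `T_x X` (of real dimension `2n`). -/
abbrev Tang (n : ℕ) {X : Type*} [TopologicalSpace X] [ChartedSpace (Cn n) X] (x : X) : Type :=
  TangentSpace 𝓘(ℝ, Cn n) x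

/-- A complex manifold is a smooth real manifold for the same charts. -/
instance realManifold (n : ℕ) (X : Type*) [TopologicalSpace X] [ChartedSpace (Cn n) X]
    [h : IsManifold 𝓘(ℂ, Cn n) ω X] : IsManifold 𝓘(ℝ, Cn n) ∞ X := by
  refine isManifold_of_contDiffOn _ _ _ fun e e' he he' => ?_
  have h1 := (contDiffGroupoid ω 𝓘(ℂ, Cn n)).compatible he he'
  have h2 : ContDiffOn ℂ ω (e.symm ≫ₕ e') (e.symm ≫ₕ e').source := by
    rw [contDiffGroupoid, mem_groupoid_of_pregroupoid] at h1
    simpa [contDiffPregroupoid] using h1.1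
  simpa using (h2.restrict_scalars ℝ).of_le le_top

variable {n : ℕ} {X : Type*} [TopologicalSpace X] [ChartedSpace (Cn n) X]

/-- The complex structure `J : T_x X → T_x X`, multiplication by `i`
(independent of the chart, since the transition maps are holomorphic). -/
def J (x : X) : Tang n x →L[ℝ] Tang n x :=
  (Complex.I • ContinuousLinearMap.id ℝ (Cn n) : Cn n →L[ℝ] Cn n)

variable (n X) in
/-- Differential forms on `X`, with the arguments of a form labelled by `ι`
(`ι = Fin k` for a `k`-form, `ι = Fin n × Fin 2` for a form of top degree `2n`). -/
abbrev DForm (ι : Type) : Type _ := ∀ x : X, Tang n x [⋀^ι]→L[ℝ] ℝ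

variable (n X) in
/-- Fields of (real) covectors. -/
abbrev CovectorField : Type _ := ∀ x : X, Tang n x →L[ℝ] ℝ

/-- The coordinate expression of a form in a chart `e`: its pullback under `e.symm`. -/
def inChart {ι : Type} (e : OpenPartialHomeomorph X (Cn n)) (α : DForm n X ι) (y : Cn n) :
    Cn n [⋀^ι]→L[ℝ] ℝ :=
  (α (e.symm y)).compContinuousLinearMap (mfderiv 𝓘(ℝ, Cn n) 𝓘(ℝ, Cn n) e.symm y)

/-- A form is smooth if all its coordinate expressions are. -/
def IsSmoothForm {ι : Type} [Fintype ι] (α : DForm n X ι) : Prop :=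
  ∀ e ∈ atlas (Cn n) X, ContDiffOn ℝ ∞ (inChart e α) e.target

/-- The exterior derivative, computed at `x` in the preferred chart at `x`
(in which `T_x X` is identified with `ℂⁿ`). -/
def extd {k : ℕ} (α : DForm n X (Fin k)) : DForm n X (Fin (k + 1)) := fun x =>
  (extDeriv (inChart (chartAt (Cn n) x) α) (chartAt (Cn n) x x) : Cn n [⋀^Fin (k + 1)]→L[ℝ] ℝ)

/-- A field of covectors, as a `1`-form. -/
def toOneForm (a : CovectorField n X) : DForm n X (Fin 1) := fun x =>
  ContinuousAlternatingMap.ofSubsingleton ℝ (Tang n x) ℝ (0 : Fin 1) (a x)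

/-! ### The operators `d`, `∂`, `∂̄`, `dᶜ` and `ddᶜ` on real functions -/

/-- The differential `du`. -/
def d (u : X → ℝ) : CovectorField n X := fun x =>
  (mfderiv 𝓘(ℝ, Cn n) 𝓘(ℝ, ℝ) u x : Tang n x →L[ℝ] ℝ)

/-- `∂u`, the `ℂ`-linear part of `du`. -/
def del (u : X → ℝ) (x : X) (v : Tang n x) : ℂ := (d u x v - Complex.I * d u x (J x v)) / 2

/-- `∂̄u`, the `ℂ`-antilinear part of `du`. -/
def delbar (u : X → ℝ) (x : X) (v : Tang n x) : ℂ := (d u x v + Complex.I * d u x (J x v)) / 2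

/-- `dᶜu = (1 / 2πi) (∂u - ∂̄u)`, that is `dᶜu(v) = -(1 / 2π) du(Jv)`; see `dc_eq`. -/
def dc (u : X → ℝ) : CovectorField n X := fun x =>
  (-(1 / (2 * Real.pi))) • (d u x).comp (J x)

theorem dc_eq (u : X → ℝ) (x : X) (v : Tang n x) :
    ((dc u x v : ℝ) : ℂ) = 1 / (2 * Real.pi * Complex.I) * (del u x v - delbar u x v) := by
  have : (Real.pi : ℂ) ≠ 0 := by exact_mod_cast Real.pi_ne_zero
  simp only [dc, del, delbar, smul_apply, ContinuousLinearMap.comp_apply,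
    smul_eq_mul]
  push_cast
  field_simp
  ring

/-- `ddᶜu`. -/
def ddc (u : X → ℝ) : DForm n X (Fin 2) := extd (toOneForm (dc u))

/-! ### Wedge products -/

/-- `a ∧ b` for two `1`-forms: `(a ∧ b)(v, w) = a(v) b(w) - a(w) b(v)`. -/
def wedgeOne (a b : CovectorField n X) : DForm n X (Fin 2) := fun x =>
  ((ContinuousMultilinearMap.mkPiAlgebra ℝ (Fin 2) ℝ).compContinuousLinearMap
    ![a x, b x]).alternatization

theorem wedgeOne_apply (a b : CovectorField n X) (x : X) (v w : Tang n x) :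
    wedgeOne a b x ![v, w] = a x v * b x w - a x w * b x v := by
  have h : (Finset.univ : Finset (Equiv.Perm (Fin 2))) = {1, Equiv.swap 0 1} := by decide
  rw [wedgeOne, ContinuousMultilinearMap.alternatization_apply_apply, h,
    Finset.sum_pair (by decide)]
  simp [Fin.prod_univ_two, Units.smul_def, sub_eq_add_neg]

theorem tensorTwo_row_self {V : Type*} [DecidableEq (Fin n × Fin 2)] (v : Fin n × Fin 2 → V)
    (k : Fin n) (l : Fin 2) (a : V) :
    (fun j => Function.update v (k, l) a (k, j)) = Function.update (fun j => v (k, j)) l a := by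
  funext j
  by_cases h : j = l
  · subst h; simp
  · simp [h]

theorem tensorTwo_row_ne {V : Type*} [DecidableEq (Fin n × Fin 2)] (v : Fin n × Fin 2 → V)
    {i k : Fin n} (h : i ≠ k) (l : Fin 2) (a : V) :
    (fun j => Function.update v (k, l) a (i, j)) = fun j => v (i, j) := by
  funext j
  simp [h]

/-- The multilinear map `v ↦ ∏ i, α i (v (i, 0), v (i, 1))`. -/
def tensorTwo {V : Type*} [AddCommGroup V] [Module ℝ V] [TopologicalSpace V]
    (α : Fin n → V [⋀^Fin 2]→L[ℝ] ℝ) :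
    ContinuousMultilinearMap ℝ (fun _ : Fin n × Fin 2 => V) ℝ where
  toFun v := ∏ i, α i fun j => v (i, j)
  map_update_add' v p a b := by
    obtain ⟨k, l⟩ := p
    simp only [← Finset.mul_prod_erase Finset.univ _ (Finset.mem_univ k), tensorTwo_row_self,
      ContinuousAlternatingMap.map_update_add, add_mul]
    congr 2 <;> refine Finset.prod_congr rfl fun i hi => ?_ <;>
      simp [tensorTwo_row_ne v (Finset.ne_of_mem_erase hi)]
  map_update_smul' v p c a := by
    obtain ⟨k, l⟩ := p
    simp only [← Finset.mul_prod_erase Finset.univ _ (Finset.mem_univ k), tensorTwo_row_self,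
      ContinuousAlternatingMap.map_update_smul, smul_eq_mul, mul_assoc]
    congr 2
    refine Finset.prod_congr rfl fun i hi => ?_
    simp [tensorTwo_row_ne v (Finset.ne_of_mem_erase hi)]
  cont := by
    refine continuous_finsetProd _ fun i _ => (α i).cont.comp ?_
    exact continuous_pi fun j => continuous_apply (i, j)

/-- The top degree form `α₁ ∧ ⋯ ∧ αₙ` for `n` two-forms `αᵢ`:
`(α₁ ∧ ⋯ ∧ αₙ)(v) = 2⁻ⁿ ∑_σ sign σ ∏ᵢ αᵢ(v_{σ(i,0)}, v_{σ(i,1)})`, where the `2n` arguments are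
labelled `(1,0), (1,1), …, (n,0), (n,1)`. -/
def wedgeProd (α : Fin n → DForm n X (Fin 2)) : DForm n X (Fin n × Fin 2) := fun x =>
  ((1 / 2 : ℝ) ^ n) • (tensorTwo fun i => α i x).alternatization

/-- `αⁿ`. -/
def wedgePow (α : DForm n X (Fin 2)) : DForm n X (Fin n × Fin 2) :=
  wedgeProd fun _ => α

/-- `η ∧ αⁿ⁻¹` (meaningful for `n ≥ 1`). -/
def wedgePowOne (η α : DForm n X (Fin 2)) : DForm n X (Fin n × Fin 2) :=
  wedgeProd fun i => if (i : ℕ) = 0 then η else α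

/-- `η ∧ θ ∧ αⁿ⁻²` (meaningful for `n ≥ 2`). -/
def wedgePowTwo (η θ α : DForm n X (Fin 2)) : DForm n X (Fin n × Fin 2) :=
  wedgeProd fun i => if (i : ℕ) = 0 then η else if (i : ℕ) = 1 then θ else α

/-! ### Integration of top degree forms over a compact complex manifold -/

/-- The positively oriented real frame `∂/∂x₁, ∂/∂y₁, …, ∂/∂xₙ, ∂/∂yₙ` of `ℂⁿ`. -/
def stdFrame (n : ℕ) (p : Fin n × Fin 2) : Cn n :=
  EuclideanSpace.single p.1 (if p.2 = 0 then 1 else Complex.I)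

variable (n X) in
/-- A smooth partition of unity subordinate to the domains of the preferred charts. -/
def chartPartition [IsManifold 𝓘(ℂ, Cn n) ω X] [T2Space X] [SigmaCompactSpace X] :
    SmoothPartitionOfUnity X 𝓘(ℝ, Cn n) X Set.univ :=
  (SmoothPartitionOfUnity.exists_isSubordinate_chartAt_source 𝓘(ℝ, Cn n) X).choose

/-- `∫_X η`, for the orientation of `X` given by its complex structure: the sum over a partition of
unity of the Lebesgue integrals of the coordinate expressions. -/
def integral [IsManifold 𝓘(ℂ, Cn n) ω X] [T2Space X] [SigmaCompactSpace X]
    (η : DForm n X (Fin n × Fin 2)) : ℝ :=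
  ∑ᶠ i : X, ∫ y in (chartAt (Cn n) i).target,
    chartPartition n X i ((chartAt (Cn n) i).symm y) *
      inChart (chartAt (Cn n) i) η y (stdFrame n)

/-! ### Kähler forms, Kähler potentials, the Monge–Ampère operator -/

/-- Positivity of a real `(1,1)`-form: `α(v, Jv) > 0` for all `v ≠ 0`. -/
def IsPositive (α : DForm n X (Fin 2)) : Prop :=
  ∀ (x : X) (v : Tang n x), v ≠ 0 → 0 < α x ![v, J x v]

variable (n X) in
/-- A Kähler form: a smooth, closed, positive real form of type `(1,1)`. -/
structure KaehlerForm where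
  form : DForm n X (Fin 2)
  smooth : IsSmoothForm form
  closed : extd form = 0
  type_one_one : ∀ (x : X) (v w : Tang n x), form x ![J x v, J x w] = form x ![v, w]
  positive : IsPositive form

/-- `ω_u = ω + ddᶜu` (for any function `u`). -/
def KaehlerForm.add (κ : KaehlerForm n X) (u : X → ℝ) : DForm n X (Fin 2) := κ.form + ddc u

/-- The space `𝓗` of Kähler potentials. -/
def KaehlerForm.potentials (κ : KaehlerForm n X) : Set (X → ℝ) :=
  {u | ContMDiff 𝓘(ℝ, Cn n) 𝓘(ℝ, ℝ) ∞ u ∧ IsPositive (κ.add u)}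

section Functional

variable [IsManifold 𝓘(ℂ, Cn n) ω X] [T2Space X] [CompactSpace X]

/-- The volume `V = ∫_X ωⁿ`. -/
def KaehlerForm.vol (κ : KaehlerForm n X) : ℝ := integral (wedgePow κ.form)

/-- `MA(u) = ω_uⁿ / V` (for any smooth function `u`). -/
def KaehlerForm.MA (κ : KaehlerForm n X) (u : X → ℝ) : DForm n X (Fin n × Fin 2) :=
  κ.vol⁻¹ • wedgePow (κ.add u)

/-- The time derivative `φ̇` of a path of functions defined for times in `[0,1]`
(one-sided at `0` and `1`). -/
def dot (φ : ℝ → X → ℝ) : ℝ → X → ℝ := fun t x =>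
  derivWithin (fun τ => φ τ x) (Set.Icc 0 1) t

/-- A path in `𝓗`: a function, smooth on `[0,1] × X`, whose time slices are Kähler potentials. -/
def KaehlerForm.IsPath (κ : KaehlerForm n X) (φ : ℝ → X → ℝ) : Prop :=
  ContMDiffOn (𝓘(ℝ, ℝ).prod 𝓘(ℝ, Cn n)) 𝓘(ℝ, ℝ) ∞ (fun p : ℝ × X => φ p.1 p.2)
    (Set.Icc 0 1 ×ˢ Set.univ) ∧
  ∀ t ∈ Set.Icc (0 : ℝ) 1, φ t ∈ κ.potentials

/-- The generalized Landau–Hall functional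
`LH(φ) = ½ ∫₀¹ ∫_X φ̇² MA(φ) dt + ∫₀¹ ∫_X φ̇ MA(φ̇) dt`. -/
def KaehlerForm.LH (κ : KaehlerForm n X) (φ : ℝ → X → ℝ) : ℝ :=
  1 / 2 * (∫ t in (0 : ℝ)..1, integral fun x => (dot φ t x) ^ 2 • κ.MA (φ t) x) +
    ∫ t in (0 : ℝ)..1, integral fun x => dot φ t x • κ.MA (dot φ t) x

/-- A smooth variation `φ_{s,t}`, `|s| < ε`, of `φ` through paths in `𝓗`, with fixed endpoints. -/
structure KaehlerForm.IsVariation (κ : KaehlerForm n X) (φ : ℝ → X → ℝ) (ε : ℝ)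
    (Φ : ℝ → ℝ → X → ℝ) : Prop where
  smooth : ContMDiffOn (𝓘(ℝ, ℝ).prod (𝓘(ℝ, ℝ).prod 𝓘(ℝ, Cn n))) 𝓘(ℝ, ℝ) ∞
    (fun p : ℝ × ℝ × X => Φ p.1 p.2.1 p.2.2) (Set.Ioo (-ε) ε ×ˢ Set.Icc 0 1 ×ˢ Set.univ)
  mem : ∀ s ∈ Set.Ioo (-ε) ε, ∀ t ∈ Set.Icc (0 : ℝ) 1, Φ s t ∈ κ.potentials
  center : ∀ t ∈ Set.Icc (0 : ℝ) 1, Φ 0 t = φ t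
  left : ∀ s ∈ Set.Ioo (-ε) ε, Φ s 0 = φ 0
  right : ∀ s ∈ Set.Ioo (-ε) ε, Φ s 1 = φ 1

/-- A magnetic geodesic between `φ₀` and `φ₁`: a path in `𝓗` from `φ₀` to `φ₁` that is an extremal
of the generalized Landau–Hall functional among paths with the same endpoints. -/
structure KaehlerForm.IsMagneticGeodesic (κ : KaehlerForm n X) (φ₀ φ₁ : X → ℝ)
    (φ : ℝ → X → ℝ) : Prop where
  isPath : κ.IsPath φ
  source : φ 0 = φ₀
  target : φ 1 = φ₁
  extremal : ∀ ε > 0, ∀ Φ : ℝ → ℝ → X → ℝ, κ.IsVariation φ ε Φ →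
    HasDerivAt (fun s => κ.LH (Φ s)) 0 0

end Functional

end KaehlerPotentials

end

/-!
The functional is computed in the preferred charts. A two-form on `ℂⁿ` is replaced by the matrix of
its coefficients in the real frame `∂/∂xᵢ, ∂/∂yᵢ`, and a product `α₁ ∧ ⋯ ∧ αₙ` by the polarised
Pfaffian `pf`, a symmetric multilinear function of these matrices (`pfPow`, `pfOne`, `pfTwo` for
`αⁿ`, `η ∧ αⁿ⁻¹`, `η ∧ θ ∧ αⁿ⁻²`). A function `f` enters through the coefficients `hess f` of
`ddᶜf`. Then `LH φ` is `V⁻¹` times the integral over space-time of a polynomial `lag` in the jet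
`(φ̇, ω_φ, ω_φ̇)` (`LH_eq_stInt`).

The first variation in a direction `η` that vanishes at both ends (`stInt_dLag`) is the integral of
`φ̇ η̇ ω_φⁿ + ½ n φ̇² ddᶜη ∧ ω_φⁿ⁻¹ + η̇ ω_φ̇ⁿ + n φ̇ ddᶜη̇ ∧ ω_φ̇ⁿ⁻¹`. Green's formula moves `ddᶜ` from
`η` to `½ φ̇²`, which gives `φ̇ ddᶜφ̇ + dφ̇ ∧ dᶜφ̇`, and from `η̇` to `φ̇`; the time derivative is then
moved from `η̇` to the other factors. The terms with `φ̇ ddᶜφ̇ ∧ ω_φⁿ⁻¹` cancel, and there remains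
the integral of `η` against the difference of the two sides of the equation of magnetic geodesics
(`eulerForm`).

Green's formula (`setIntegral_green`, `integral_greenForm`) says that
`u ddᶜv ∧ αⁿ⁻¹ - v ddᶜu ∧ αⁿ⁻¹` has integral zero for `α` closed and of type `(1, 1)`. By a
partition of unity `v` may be supported in one chart, and there this form is
`d((u dᶜv - v dᶜu) ∧ αⁿ⁻¹)`: the additional term `(du ∧ dᶜv - dv ∧ dᶜu) ∧ αⁿ⁻¹` vanishes because
its first factor changes sign under `J` and `α` does not (`pfOne_eq_zero_of_anti`). That the
integral can be computed in any chart containing the support uses that the transition maps, being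
holomorphic, preserve the orientation (`integral_eq_setIntegral_chart`).

If the equation holds, the first variation vanishes for all variations; the remainder is quadratic
in `s`, uniformly on space-time (`exists_LH_expansion`). Conversely, if `φ` is an extremal, the
variations `φ_t + s χ(t) u` are admissible for small `s`, since positivity is an open condition and
`[0, 1] × X` is compact (`isVariation_add`). The fundamental lemma of the calculus of variations,
in time with `χ` and then in space with `u`, shows that `eulerForm` vanishes.
The volume `V` occurs only through the common factor `V⁻¹` on both sides.
-/

noncomputable section

namespace KaehlerPotentials

section

open Equiv Finset

/-! ### Wedge products of two-forms in coordinates -/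

/-- The labels of the real coordinates of `ℂⁿ`: `(i, 0)` for `xᵢ` and `(i, 1)` for `yᵢ`. -/
abbrev Idx (n : ℕ) : Type := Fin n × Fin 2

/-- The coefficients of a two-form on `ℂⁿ` in the standard real frame. -/
abbrev CMat (n : ℕ) : Type := Idx n → Idx n → ℝ

/-- The coefficient of `α₁ ∧ ⋯ ∧ αₙ` in the standard frame, as a multilinear function of the
coefficients of the two-forms `αᵢ` (the polarised Pfaffian). -/
def pf (n : ℕ) : ContinuousMultilinearMap ℝ (fun _ : Fin n => CMat n) ℝ :=
  ((1 / 2 : ℝ) ^ n) • ∑ σ : Perm (Idx n), ((Perm.sign σ : ℤ) : ℝ) •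
    (ContinuousMultilinearMap.mkPiAlgebra ℝ (Fin n) ℝ).compContinuousLinearMap fun i =>
      (ContinuousLinearMap.proj (R := ℝ) (φ := fun _ : Idx n => ℝ) (σ (i, 1))).comp
        (ContinuousLinearMap.proj (R := ℝ) (φ := fun _ : Idx n => Idx n → ℝ) (σ (i, 0)))

variable {n : ℕ}

theorem pf_apply (A : Fin n → CMat n) :
    pf n A = (1 / 2) ^ n * ∑ σ : Perm (Idx n), ((Perm.sign σ : ℤ) : ℝ) *
      ∏ i, A i (σ (i, 0)) (σ (i, 1)) := by
  simp [pf]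

/-- Coefficient of `αⁿ`. -/
def pfPow (A : CMat n) : ℝ := pf n fun _ => A

/-- Coefficients of the factors of `η ∧ αⁿ⁻¹`. -/
def rowOne (B A : CMat n) (i : Fin n) : CMat n := if (i : ℕ) = 0 then B else A

/-- Coefficient of `η ∧ αⁿ⁻¹`. -/
def pfOne (B A : CMat n) : ℝ := pf n (rowOne B A)

/-- Coefficient of `η ∧ θ ∧ αⁿ⁻²`. -/
def pfTwo (B C A : CMat n) : ℝ :=
  pf n fun i => if (i : ℕ) = 0 then B else if (i : ℕ) = 1 then C else A

/-- Two-forms commute: a permutation of the factors moves the arguments in pairs, which is an even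
permutation of the frame. -/
theorem pf_comp_perm (π : Perm (Fin n)) (A : Fin n → CMat n) :
    pf n (fun i => A (π i)) = pf n A := by
  have hs : Perm.sign (Equiv.prodCongrLeft fun _ : Fin 2 => π) = 1 := by
    rw [Equiv.Perm.sign_prodCongrLeft]
    simp
  rw [pf_apply, pf_apply]
  congr 1
  refine Fintype.sum_equiv (Equiv.mulRight (Equiv.prodCongrLeft fun _ : Fin 2 => π)⁻¹) _ _
    fun σ => ?_
  rw [Equiv.coe_mulRight, Perm.sign_mul, Perm.sign_inv, hs, mul_one]
  congr 1
  refine Fintype.prod_equiv π _ _ fun i => ?_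
  simp

/-- The derivative of `αⁿ` is `n β ∧ αⁿ⁻¹`. -/
theorem sum_pf_update_const (B A : CMat n) :
    ∑ i, pf n (Function.update (fun _ => A) i B) = n * pfOne B A := by
  have h (i : Fin n) : pf n (Function.update (fun _ => A) i B) = pfOne B A := by
    have hn : 0 < n := i.pos
    rw [pfOne, ← pf_comp_perm (swap ⟨0, hn⟩ i) (rowOne B A)]
    congr 1
    funext j
    by_cases hj : j = i
    · subst hj; simp [rowOne]
    · by_cases h0 : j = ⟨0, hn⟩
      · subst h0
        have : (i : ℕ) ≠ 0 := fun h => hj (Fin.ext h.symm)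
        simp [rowOne, hj, this]
      · have : (j : ℕ) ≠ 0 := fun h => h0 (Fin.ext h)
        rw [swap_apply_of_ne_of_ne h0 hj]
        simp [rowOne, hj, this]
  simp [h]

/-- The derivative of `β ∧ αⁿ⁻¹` is `β' ∧ αⁿ⁻¹ + (n - 1) β ∧ α' ∧ αⁿ⁻²`. -/
theorem sum_pf_update_one (i₀ : Fin n) (h₀ : (i₀ : ℕ) = 0) (B A B' A' : CMat n) :
    ∑ i, pf n (Function.update (rowOne B A) i (rowOne B' A' i)) =
      pfOne B' A + ((n : ℝ) - 1) * pfTwo B A' A := by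
  have e₀ (j : Fin n) : j = i₀ ↔ (j : ℕ) = 0 := by rw [Fin.ext_iff, h₀]
  have h (i : Fin n) (hi : i ≠ i₀) :
      pf n (Function.update (rowOne B A) i (rowOne B' A' i)) = pfTwo B A' A := by
    have hi0 : (i : ℕ) ≠ 0 := fun h => hi ((e₀ i).2 h)
    have hn : 1 < n := by omega
    rw [pfTwo, ← pf_comp_perm (swap ⟨1, hn⟩ i)]
    congr 1
    funext j
    by_cases hj : j = i
    · subst hj
      by_cases h1 : j = ⟨1, hn⟩
      · have : (j : ℕ) = 1 := congrArg Fin.val h1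
        rw [← h1, swap_self]; simp [rowOne, this]
      · have : (j : ℕ) ≠ 1 := fun h => h1 (Fin.ext h)
        rw [swap_apply_right, Function.update_of_ne (Ne.symm h1)]
        simp [rowOne, hi0, this]
    · by_cases h1 : j = ⟨1, hn⟩
      · subst h1
        simp [rowOne, hi0]
      · have : (j : ℕ) ≠ 1 := fun h => h1 (Fin.ext h)
        rw [swap_apply_of_ne_of_ne h1 hj]
        simp [rowOne, hj, this]
  rw [← Finset.add_sum_erase _ _ (mem_univ i₀),
    Finset.sum_congr rfl fun i hi => h i (ne_of_mem_erase hi)]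
  congr 1
  · rw [pfOne]
    congr 1
    funext j
    by_cases hj : j = i₀
    · subst hj; simp [rowOne, h₀]
    · have : (j : ℕ) ≠ 0 := fun h => hj ((e₀ j).2 h)
      simp [rowOne, hj, this]
  · have : 1 ≤ n := i₀.pos
    simp [Nat.cast_sub this]

/-! ### The algebra behind Stokes' theorem -/

theorem sum_perm_comp (τ : Perm (Idx n)) (f : Perm (Idx n) → ℝ) :
    ∑ σ, f (σ * τ) = ∑ σ, f σ :=
  Fintype.sum_equiv (Equiv.mulRight τ) _ _ fun _ => rfl

/-- The terms of `d(αⁿ⁻¹) ∧ a` cancel in triples, which are the orbits of the cyclic permutations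
of the three arguments of `dα`. -/
theorem sum_cycle_eq_zero (i₀ k : Fin n) (hk : k ≠ i₀) (a : Idx n → ℝ) (A : CMat n)
    (dA : Idx n → CMat n) (hdA : ∀ p q r, dA p q r + dA q r p + dA r p q = 0) :
    ∑ σ : Perm (Idx n), ((Perm.sign σ : ℤ) : ℝ) *
      (a (σ (i₀, 1)) * (dA (σ (i₀, 0)) (σ (k, 0)) (σ (k, 1)) *
        ∏ i ∈ (univ.erase i₀).erase k, A (σ (i, 0)) (σ (i, 1)))) = 0 := by
  set f : Perm (Idx n) → ℝ := fun σ => ((Perm.sign σ : ℤ) : ℝ) *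
      (a (σ (i₀, 1)) * (dA (σ (i₀, 0)) (σ (k, 0)) (σ (k, 1)) *
        ∏ i ∈ (univ.erase i₀).erase k, A (σ (i, 0)) (σ (i, 1)))) with hf
  set c : Perm (Idx n) := swap (i₀, 0) (k, 0) * swap (k, 0) (k, 1) with hc
  have hk' := hk.symm
  have c1 : c (i₀, 0) = (k, 0) := by
    simp [hc, swap_apply_of_ne_of_ne, hk']
  have c2 : c (k, 0) = (k, 1) := by
    simp [hc, swap_apply_of_ne_of_ne, hk]
  have c3 : c (k, 1) = (i₀, 0) := by simp [hc]
  have c4 : c (i₀, 1) = (i₀, 1) := by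
    simp [hc, swap_apply_of_ne_of_ne, hk']
  have c5 (i : Fin n) (h0 : i ≠ i₀) (h1 : i ≠ k) (j : Fin 2) : c (i, j) = (i, j) := by
    simp [hc, swap_apply_of_ne_of_ne, h0, h1]
  have hsc : Perm.sign c = 1 := by
    rw [hc, Perm.sign_mul, Perm.sign_swap (by simp [hk']), Perm.sign_swap (by simp)]
    simp
  have hfc (σ : Perm (Idx n)) : f σ + f (σ * c) + f (σ * c * c) = 0 := by
    have hp (τ : Perm (Idx n)) (hτ : ∀ i, i ≠ i₀ → i ≠ k → ∀ j, τ (i, j) = (i, j)) :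
        ∏ i ∈ (univ.erase i₀).erase k, A ((σ * τ) (i, 0)) ((σ * τ) (i, 1)) =
        ∏ i ∈ (univ.erase i₀).erase k, A (σ (i, 0)) (σ (i, 1)) := by
      refine prod_congr rfl fun i hi => ?_
      have h1 := ne_of_mem_erase hi
      have h0 := ne_of_mem_erase (mem_of_mem_erase hi)
      simp [hτ i h0 h1]
    have hp1 := hp c fun i h0 h1 j => c5 i h0 h1 j
    have hp2 := hp (c * c) fun i h0 h1 j => by simp [c5 i h0 h1 j]
    simp only [hf, mul_assoc σ c c, hp1, hp2]
    simp only [Perm.sign_mul, hsc, mul_one, Perm.mul_apply, c1, c2, c3, c4]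
    have := hdA (σ (i₀, 0)) (σ (k, 0)) (σ (k, 1))
    linear_combination ((Perm.sign σ : ℤ) : ℝ) * (a (σ (i₀, 1)) *
      ∏ i ∈ (univ.erase i₀).erase k, A (σ (i, 0)) (σ (i, 1))) * this
  have h3 : ∑ σ, (f σ + f (σ * c) + f (σ * c * c)) = 0 := by simp [hfc]
  rw [sum_add_distrib, sum_add_distrib] at h3
  have e1 := sum_perm_comp c f
  have e2 := sum_perm_comp c fun σ => f (σ * c)
  linarith

/-- `da ∧ αⁿ⁻¹` is a divergence: it is the total derivative of the products `a ∏ α`, if `α` is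
closed. Here `da p q` stands for `∂ₚ a_q` and `dA p q r` for `∂ₚ α_{qr}`. -/
theorem pfOne_curl (i₀ : Fin n) (h₀ : (i₀ : ℕ) = 0) (a : Idx n → ℝ) (da A : CMat n)
    (dA : Idx n → CMat n) (hdA : ∀ p q r, dA p q r + dA q r p + dA r p q = 0) :
    pfOne (fun p q => da p q - da q p) A = (1 / 2) ^ n * 2 * ∑ σ : Perm (Idx n),
      ((Perm.sign σ : ℤ) : ℝ) * (da (σ (i₀, 0)) (σ (i₀, 1)) *
          ∏ i ∈ univ.erase i₀, A (σ (i, 0)) (σ (i, 1)) +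
        a (σ (i₀, 1)) * ∑ k ∈ univ.erase i₀, (dA (σ (i₀, 0)) (σ (k, 0)) (σ (k, 1)) *
          ∏ i ∈ (univ.erase i₀).erase k, A (σ (i, 0)) (σ (i, 1)))) := by
  have e₀ (j : Fin n) : (j : ℕ) = 0 ↔ j = i₀ := by rw [Fin.ext_iff, h₀]
  have hz : ∑ σ : Perm (Idx n), ((Perm.sign σ : ℤ) : ℝ) *
      (a (σ (i₀, 1)) * ∑ k ∈ univ.erase i₀, (dA (σ (i₀, 0)) (σ (k, 0)) (σ (k, 1)) *
          ∏ i ∈ (univ.erase i₀).erase k, A (σ (i, 0)) (σ (i, 1)))) = 0 := by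
    simp only [mul_sum]
    rw [sum_comm]
    exact sum_eq_zero fun k hk => sum_cycle_eq_zero i₀ k (ne_of_mem_erase hk) a A dA hdA
  simp only [mul_add, sum_add_distrib, hz, add_zero]
  set g : Perm (Idx n) → ℝ := fun σ => ((Perm.sign σ : ℤ) : ℝ) * (da (σ (i₀, 0)) (σ (i₀, 1)) *
          ∏ i ∈ univ.erase i₀, A (σ (i, 0)) (σ (i, 1))) with hg
  have hsw := sum_perm_comp (swap (i₀, 0) (i₀, 1)) g
  rw [pfOne, pf_apply, mul_assoc, two_mul]
  congr 1
  nth_rewrite 1 [← hsw]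
  rw [← sum_add_distrib]
  refine sum_congr rfl fun σ _ => ?_
  have hp : ∏ i ∈ univ.erase i₀, A ((σ * (swap (i₀, 0) (i₀, 1) : Perm (Idx n))) (i, 0))
      ((σ * (swap (i₀, 0) (i₀, 1) : Perm (Idx n))) (i, 1)) = ∏ i ∈ univ.erase i₀, A (σ (i, 0)) (σ (i, 1)) := by
    refine prod_congr rfl fun i hi => ?_
    have h0 := ne_of_mem_erase hi
    simp [swap_apply_of_ne_of_ne, h0]
  have hp' : ∏ i ∈ univ.erase i₀, rowOne (fun p q => da p q - da q p) A i (σ (i, 0)) (σ (i, 1)) =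
      ∏ i ∈ univ.erase i₀, A (σ (i, 0)) (σ (i, 1)) := by
    refine prod_congr rfl fun i hi => ?_
    have h0 := ne_of_mem_erase hi
    simp [rowOne, e₀, h0]
  rw [hg]
  simp only [hp, Perm.sign_mul, Perm.sign_swap (show ((i₀, 0) : Idx n) ≠ (i₀, 1) by simp)]
  rw [← mul_prod_erase _ _ (mem_univ i₀), hp']
  simp only [rowOne, h₀, if_true, Perm.mul_apply, swap_apply_left, swap_apply_right]
  push_cast
  ring

/-! ### The action of the complex structure on coefficients -/

/-- `J` permutes the standard frame up to signs: `J e_p = jSign p • e_(jPerm p)`. -/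
def jPerm (n : ℕ) : Perm (Idx n) := Equiv.prodCongrRight fun _ => swap 0 1

/-- The signs of the action of `J` on the standard frame. -/
def jSign (p : Idx n) : ℝ := if p.2 = 0 then 1 else -1

theorem sign_jPerm : Perm.sign (jPerm n) = (-1) ^ n := by
  rw [jPerm, Equiv.Perm.sign_prodCongrRight]
  simp

theorem prod_jSign : ∏ p : Idx n, jSign p = (-1) ^ n := by
  rw [Fintype.prod_prod_type]
  simp [jSign]

/-- A product `η ∧ αⁿ⁻¹` vanishes if `α` is `J`-invariant and `η` is `J`-anti-invariant. -/
theorem pfOne_eq_zero_of_anti (i₀ : Fin n) (h₀ : (i₀ : ℕ) = 0) (B A : CMat n)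
    (hB : ∀ p q, jSign p * jSign q * B (jPerm n p) (jPerm n q) = -B p q)
    (hA : ∀ p q, jSign p * jSign q * A (jPerm n p) (jPerm n q) = A p q) :
    pfOne B A = 0 := by
  have e₀ (j : Fin n) : (j : ℕ) = 0 ↔ j = i₀ := by rw [Fin.ext_iff, h₀]
  have key (σ : Perm (Idx n)) :
      ((Perm.sign (jPerm n * σ) : ℤ) : ℝ) *
        ∏ i, rowOne B A i ((jPerm n * σ) (i, 0)) ((jPerm n * σ) (i, 1)) =
      -(((Perm.sign σ : ℤ) : ℝ) * ∏ i, rowOne B A i (σ (i, 0)) (σ (i, 1))) := by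
    have h1 : ∏ i, (jSign (σ (i, 0)) * jSign (σ (i, 1))) = (-1 : ℝ) ^ n := by
      rw [← prod_jSign, ← Equiv.prod_comp σ, Fintype.prod_prod_type]
      simp
    have h2 : (∏ i, (jSign (σ (i, 0)) * jSign (σ (i, 1)))) *
        ∏ i, rowOne B A i ((jPerm n * σ) (i, 0)) ((jPerm n * σ) (i, 1)) =
        -∏ i, rowOne B A i (σ (i, 0)) (σ (i, 1)) := by
      rw [← prod_mul_distrib, ← mul_prod_erase _ _ (mem_univ i₀),
        ← mul_prod_erase _ (fun i => rowOne B A i (σ (i, 0)) (σ (i, 1))) (mem_univ i₀),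
        ← neg_mul]
      congr 1
      · simp only [rowOne, h₀, if_true, Perm.mul_apply, hB]
      · refine prod_congr rfl fun i hi => ?_
        simp only [rowOne, e₀, ne_of_mem_erase hi, if_false, Perm.mul_apply, hA]
    rw [Perm.sign_mul, sign_jPerm, ← mul_neg, ← h2, h1]
    push_cast
    ring
  have h := Fintype.sum_equiv (Equiv.mulLeft (jPerm n))
    (fun σ => ((Perm.sign (jPerm n * σ) : ℤ) : ℝ) *
        ∏ i, rowOne B A i ((jPerm n * σ) (i, 0)) ((jPerm n * σ) (i, 1)))
    (fun σ => ((Perm.sign σ : ℤ) : ℝ) * ∏ i, rowOne B A i (σ (i, 0)) (σ (i, 1))) fun _ => rfl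
  simp only [key, sum_neg_distrib] at h
  rw [pfOne, pf_apply]
  have : ∑ σ : Perm (Idx n), ((Perm.sign σ : ℤ) : ℝ) *
      ∏ i, rowOne B A i (σ (i, 0)) (σ (i, 1)) = 0 := by linarith
  rw [this, mul_zero]

/-! ### Coefficients of forms on `ℂⁿ` -/

/-- The coefficients of a two-form on `ℂⁿ` in the standard frame. -/
def coeffs (α : Cn n [⋀^Fin 2]→L[ℝ] ℝ) : CMat n := fun p q => α ![stdFrame n p, stdFrame n q]

/-- The values of a wedge product on the standard frame are given by `pf`. -/
theorem wedge_stdFrame (α : Fin n → Cn n [⋀^Fin 2]→L[ℝ] ℝ) :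
    (((1 / 2 : ℝ) ^ n) • (tensorTwo α).alternatization) (stdFrame n) =
      pf n fun i => coeffs (α i) := by
  rw [pf_apply]
  simp only [ContinuousAlternatingMap.smul_apply,
    ContinuousMultilinearMap.alternatization_apply_apply, smul_eq_mul]
  congr 1
  refine sum_congr rfl fun σ _ => ?_
  rw [Units.smul_def, ← Int.cast_smul_eq_zsmul ℝ, smul_eq_mul]
  congr 1
  change ∏ i, α i (fun j => stdFrame n (σ (i, j))) = _
  refine Finset.prod_congr rfl fun i _ => ?_
  rw [coeffs]
  congr 1
  funext j
  fin_cases j <;> rfl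

end

section

variable {n : ℕ} {X : Type*} [TopologicalSpace X] [ChartedSpace (Cn n) X]

/-! ### Forms in charts -/

/-- A form on `X`, with each tangent space identified with `ℂⁿ` by the preferred chart there. -/
def raw {ι : Type} (α : DForm n X ι) : X → Cn n [⋀^ι]→L[ℝ] ℝ := α

/-- The derivative of the inverse of a chart, with the tangent space of `X` identified with `ℂⁿ`. -/
def symmD (e : OpenPartialHomeomorph X (Cn n)) (y : Cn n) : Cn n →L[ℝ] Cn n :=
  mfderiv 𝓘(ℝ, Cn n) 𝓘(ℝ, Cn n) e.symm y

theorem inChart_eq {ι : Type} (e : OpenPartialHomeomorph X (Cn n)) (α : DForm n X ι) (y : Cn n) :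
    inChart e α y = (raw α (e.symm y)).compContinuousLinearMap (symmD e y) := rfl

omit [ChartedSpace (Cn n) X] in
theorem symm_eventuallyEq {e e' : OpenPartialHomeomorph X (Cn n)} {y : Cn n}
    (hy : y ∈ e.target) (hy' : e.symm y ∈ e'.source) :
    ∀ᶠ z in 𝓝 y, z ∈ e.target ∧ e.symm z ∈ e'.source ∧ e'.symm (e' (e.symm z)) = e.symm z := by
  have h1 : ∀ᶠ z in 𝓝 y, e.symm z ∈ e'.source :=
    (e.continuousAt_symm hy).eventually (e'.open_source.mem_nhds hy')
  filter_upwards [h1, e.open_target.mem_nhds hy] with z hz hz'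
  exact ⟨hz', hz, e'.left_inv hz⟩

section

variable [IsManifold 𝓘(ℂ, Cn n) ω X]

theorem mem_maximalAtlas_of_mem_atlas {e : OpenPartialHomeomorph X (Cn n)}
    (he : e ∈ atlas (Cn n) X) : e ∈ IsManifold.maximalAtlas 𝓘(ℝ, Cn n) ∞ X :=
  IsManifold.subset_maximalAtlas he

theorem contDiffAt_transition {e e' : OpenPartialHomeomorph X (Cn n)} (he : e ∈ atlas (Cn n) X)
    (he' : e' ∈ atlas (Cn n) X) {y : Cn n} (hy : y ∈ e.target) (hy' : e.symm y ∈ e'.source) :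
    ContDiffAt ℂ ω (e' ∘ e.symm) y := by
  have h1 := (contDiffGroupoid ω 𝓘(ℂ, Cn n)).compatible he he'
  have h2 : ContDiffOn ℂ ω (e.symm ≫ₕ e') (e.symm ≫ₕ e').source := by
    rw [contDiffGroupoid, mem_groupoid_of_pregroupoid] at h1
    simpa [contDiffPregroupoid] using h1.1
  exact h2.contDiffAt ((e.symm ≫ₕ e').open_source.mem_nhds (by simp [hy, hy']))

theorem contDiffAt_transition_real {e e' : OpenPartialHomeomorph X (Cn n)}
    (he : e ∈ atlas (Cn n) X) (he' : e' ∈ atlas (Cn n) X) {y : Cn n} (hy : y ∈ e.target)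
    (hy' : e.symm y ∈ e'.source) : ContDiffAt ℝ ∞ (e' ∘ e.symm) y :=
  ((contDiffAt_transition he he' hy hy').restrict_scalars ℝ).of_le le_top

theorem fderiv_transition {e e' : OpenPartialHomeomorph X (Cn n)}
    (he : e ∈ atlas (Cn n) X) (he' : e' ∈ atlas (Cn n) X) {y : Cn n} (hy : y ∈ e.target)
    (hy' : e.symm y ∈ e'.source) :
    fderiv ℝ (e' ∘ e.symm) y = (fderiv ℂ (e' ∘ e.symm) y).restrictScalars ℝ :=
  ((contDiffAt_transition he he' hy hy').differentiableAt (by simp)).fderiv_restrictScalars ℝ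

theorem mdifferentiableAt_symm {e : OpenPartialHomeomorph X (Cn n)}
    (he : e ∈ atlas (Cn n) X) {y : Cn n} (hy : y ∈ e.target) :
    MDifferentiableAt 𝓘(ℝ, Cn n) 𝓘(ℝ, Cn n) e.symm y :=
  haveI : IsManifold 𝓘(ℝ, Cn n) 1 X := IsManifold.of_le (n := ∞) (by simp)
  mdifferentiableAt_atlas_symm he hy

theorem symmD_eq_comp {e e' : OpenPartialHomeomorph X (Cn n)}
    (he : e ∈ atlas (Cn n) X) (he' : e' ∈ atlas (Cn n) X) {y : Cn n} (hy : y ∈ e.target)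
    (hy' : e.symm y ∈ e'.source) :
    symmD e y = (symmD e' (e' (e.symm y))).comp (fderiv ℝ (e' ∘ e.symm) y) := by
  have h1 : (e.symm : Cn n → X) =ᶠ[𝓝 y] e'.symm ∘ (e' ∘ e.symm) := by
    filter_upwards [symm_eventuallyEq hy hy'] with z hz
    exact hz.2.2.symm
  have h2 : MDifferentiableAt 𝓘(ℝ, Cn n) 𝓘(ℝ, Cn n) (e' ∘ e.symm) y :=
    ((contDiffAt_transition_real he he' hy hy').differentiableAt (by simp)).mdifferentiableAt
  have h3 := mfderiv_comp (I := 𝓘(ℝ, Cn n)) (I' := 𝓘(ℝ, Cn n)) (I'' := 𝓘(ℝ, Cn n)) y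
    (g := (e'.symm : Cn n → X)) (f := e' ∘ e.symm)
    (mdifferentiableAt_symm he' (e'.map_source hy')) h2
  have h4 := h1.mfderiv_eq (I := 𝓘(ℝ, Cn n)) (I' := 𝓘(ℝ, Cn n))
  rw [mfderiv_eq_fderiv] at h3
  exact h4.trans h3

/-- In the preferred chart at `x`, the identification of `T_x X` with `ℂⁿ` is the tautological
one. -/
theorem symmD_chartAt (x : X) :
    symmD (chartAt (Cn n) x) (chartAt (Cn n) x x) = ContinuousLinearMap.id ℝ (Cn n) := by
  have h := mfderivWithin_range_extChartAt_symm (I := 𝓘(ℝ, Cn n)) (x := x)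
  simp only [extChartAt, OpenPartialHomeomorph.extend, modelWithCornersSelf_partialEquiv,
    modelWithCornersSelf_coe, Set.range_id, mfderivWithin_univ] at h
  exact h

theorem symmD_eq_fderiv {e : OpenPartialHomeomorph X (Cn n)}
    (he : e ∈ atlas (Cn n) X) {y : Cn n} (hy : y ∈ e.target) :
    symmD e y = fderiv ℝ (chartAt (Cn n) (e.symm y) ∘ e.symm) y := by
  rw [symmD_eq_comp he (chart_mem_atlas _ (e.symm y)) hy (mem_chart_source _ _), symmD_chartAt]
  rfl

/-- Charts are compatible with the complex structures, as transition maps are holomorphic. -/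
theorem symmD_smul_I {e : OpenPartialHomeomorph X (Cn n)}
    (he : e ∈ atlas (Cn n) X) {y : Cn n} (hy : y ∈ e.target) (v : Cn n) :
    symmD e y (Complex.I • v) = Complex.I • symmD e y v := by
  rw [symmD_eq_fderiv he hy, fderiv_transition he (chart_mem_atlas _ _) hy (mem_chart_source _ _)]
  simp

theorem inChart_change {ι : Type} (α : DForm n X ι) {e e' : OpenPartialHomeomorph X (Cn n)}
    (he : e ∈ atlas (Cn n) X) (he' : e' ∈ atlas (Cn n) X) {y : Cn n} (hy : y ∈ e.target)
    (hy' : e.symm y ∈ e'.source) :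
    inChart e α y =
      (inChart e' α ((e' ∘ e.symm) y)).compContinuousLinearMap (fderiv ℝ (e' ∘ e.symm) y) := by
  rw [inChart_eq, inChart_eq, symmD_eq_comp he he' hy hy', Function.comp_apply, e'.left_inv hy']
  rfl

theorem inChart_chartAt {ι : Type} (α : DForm n X ι) (x : X) :
    inChart (chartAt (Cn n) x) α (chartAt (Cn n) x x) = raw α x := by
  rw [inChart_eq, symmD_chartAt, (chartAt (Cn n) x).left_inv (mem_chart_source _ x)]
  rfl

theorem eventually_inChart_change {ι : Type} (α : DForm n X ι)
    {e e' : OpenPartialHomeomorph X (Cn n)}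
    (he : e ∈ atlas (Cn n) X) (he' : e' ∈ atlas (Cn n) X) {y : Cn n} (hy : y ∈ e.target)
    (hy' : e.symm y ∈ e'.source) :
    inChart e α =ᶠ[𝓝 y] fun z =>
      (inChart e' α ((e' ∘ e.symm) z)).compContinuousLinearMap (fderiv ℝ (e' ∘ e.symm) z) := by
  filter_upwards [symm_eventuallyEq hy hy'] with z hz
  exact inChart_change α he he' hz.1 hz.2.1

/-- The exterior derivative commutes with passing to coordinates, in every chart. -/
theorem inChart_extd {k : ℕ} (α : DForm n X (Fin k)) {e : OpenPartialHomeomorph X (Cn n)}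
    (he : e ∈ atlas (Cn n) X) {y : Cn n} (hy : y ∈ e.target)
    (hα : DifferentiableAt ℝ (inChart (chartAt (Cn n) (e.symm y)) α)
      (chartAt (Cn n) (e.symm y) (e.symm y))) :
    inChart e (extd α) y = extDeriv (inChart e α) y := by
  have hs := mem_chart_source (Cn n) (e.symm y)
  have ha := chart_mem_atlas (Cn n) (e.symm y)
  rw [(eventually_inChart_change α he ha hy hs).extDeriv_eq,
    extDeriv_pullback (f := chartAt (Cn n) (e.symm y) ∘ e.symm) hα
      (contDiffAt_transition_real he ha hy hs)
      (by simpa using ENat.LEInfty.out), inChart_eq,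
    symmD_eq_fderiv he hy]
  rfl

/-! ### Functions in charts -/

omit [IsManifold 𝓘(ℂ, Cn n) ω X] in
variable (n) in
/-- Smoothness of a function on `X`, read in the charts of the atlas. -/
def ChartSmooth (u : X → ℝ) : Prop :=
  ∀ e ∈ atlas (Cn n) X, ContDiffOn ℝ ∞ (u ∘ e.symm) e.target

theorem chartSmooth_of_contMDiff {u : X → ℝ} (hu : ContMDiff 𝓘(ℝ, Cn n) 𝓘(ℝ, ℝ) ∞ u) :
    ChartSmooth n u := fun _ he => (hu.comp_contMDiffOn
  (contMDiffOn_symm_of_mem_maximalAtlas (mem_maximalAtlas_of_mem_atlas he))).contDiffOn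

theorem ChartSmooth.contMDiff {u : X → ℝ} (hu : ChartSmooth n u) :
    ContMDiff 𝓘(ℝ, Cn n) 𝓘(ℝ, ℝ) ∞ u := by
  intro x
  have ha := chart_mem_atlas (Cn n) x
  have h1 := ((hu _ ha).contMDiffOn.comp
    (contMDiffOn_of_mem_maximalAtlas (mem_maximalAtlas_of_mem_atlas ha))
    fun z hz => (chartAt (Cn n) x).map_source hz).contMDiffAt
      ((chartAt (Cn n) x).open_source.mem_nhds (mem_chart_source _ x))
  refine h1.congr_of_eventuallyEq ?_
  filter_upwards [(chartAt (Cn n) x).open_source.mem_nhds (mem_chart_source _ x)] with z hz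
  simp [(chartAt (Cn n) x).left_inv hz]

omit [IsManifold 𝓘(ℂ, Cn n) ω X] in
theorem ChartSmooth.contDiffAt {u : X → ℝ} (hu : ChartSmooth n u)
    {e : OpenPartialHomeomorph X (Cn n)} (he : e ∈ atlas (Cn n) X) {y : Cn n} (hy : y ∈ e.target) :
    ContDiffAt ℝ ∞ (u ∘ e.symm) y :=
  (hu e he).contDiffAt (e.open_target.mem_nhds hy)

/-- The differential in coordinates. -/
theorem d_comp_symmD {u : X → ℝ} (hu : ChartSmooth n u)
    {e : OpenPartialHomeomorph X (Cn n)} (he : e ∈ atlas (Cn n) X) {y : Cn n} (hy : y ∈ e.target)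
    (v : Cn n) : d u (e.symm y) (symmD e y v) = fderiv ℝ (u ∘ e.symm) y v := by
  have h := mfderiv_comp (I := 𝓘(ℝ, Cn n)) (I' := 𝓘(ℝ, Cn n)) (I'' := 𝓘(ℝ, ℝ)) y
    (hu.contMDiff.mdifferentiableAt (by simp)) (mdifferentiableAt_symm he hy)
  rw [mfderiv_eq_fderiv] at h
  rw [h]
  rfl

/-- `dᶜf` for a function `f` on `ℂⁿ`. -/
def dcFlat (f : Cn n → ℝ) (y : Cn n) : Cn n →L[ℝ] ℝ :=
  (-(1 / (2 * Real.pi))) • (fderiv ℝ f y).comp (Complex.I • ContinuousLinearMap.id ℝ (Cn n))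

theorem dcFlat_apply (f : Cn n → ℝ) (y v : Cn n) :
    dcFlat f y v = -(1 / (2 * Real.pi)) * fderiv ℝ f y (Complex.I • v) := rfl

theorem dc_comp_symmD {u : X → ℝ} (hu : ChartSmooth n u)
    {e : OpenPartialHomeomorph X (Cn n)} (he : e ∈ atlas (Cn n) X) {y : Cn n} (hy : y ∈ e.target)
    (v : Cn n) : dc u (e.symm y) (symmD e y v) = dcFlat (u ∘ e.symm) y v := by
  rw [dcFlat_apply, ← d_comp_symmD hu he hy, symmD_smul_I he hy]
  rfl

theorem inChart_toOneForm_dc {u : X → ℝ} (hu : ChartSmooth n u)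
    {e : OpenPartialHomeomorph X (Cn n)} (he : e ∈ atlas (Cn n) X) {y : Cn n} (hy : y ∈ e.target) :
    inChart e (toOneForm (dc u)) y =
      ContinuousAlternatingMap.ofSubsingletonLIE (𝕜 := ℝ) (E := Cn n) (F := ℝ) (0 : Fin 1)
        (dcFlat (u ∘ e.symm) y) := by
  ext v
  exact dc_comp_symmD hu he hy (v 0)

theorem contDiffOn_dcFlat {f : Cn n → ℝ} {U : Set (Cn n)} (hU : IsOpen U)
    (hf : ContDiffOn ℝ ∞ f U) : ContDiffOn ℝ ∞ (dcFlat f) U := by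
  have := hf.fderiv_of_isOpen (m := ∞) hU (by simp)
  exact (this.clm_comp contDiffOn_const).const_smul _

/-- The coefficients of `ddᶜf` for a function `f` on `ℂⁿ`. -/
def hess (f : Cn n → ℝ) (y : Cn n) : CMat n := fun p q =>
  -(1 / (2 * Real.pi)) * (fderiv ℝ (fderiv ℝ f) y (stdFrame n p) (Complex.I • stdFrame n q) -
    fderiv ℝ (fderiv ℝ f) y (stdFrame n q) (Complex.I • stdFrame n p))

theorem fderiv_dcFlat {f : Cn n → ℝ} {y : Cn n} (hf : ContDiffAt ℝ ∞ f y) (v w : Cn n) :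
    fderiv ℝ (dcFlat f) y v w =
      -(1 / (2 * Real.pi)) * fderiv ℝ (fderiv ℝ f) y v (Complex.I • w) := by
  have h1 : DifferentiableAt ℝ (fderiv ℝ f) y :=
    (hf.fderiv_right (m := ∞) (by simp)).differentiableAt (by simp)
  have h2 := ((h1.hasFDerivAt.clm_comp (hasFDerivAt_const
    (Complex.I • ContinuousLinearMap.id ℝ (Cn n) : Cn n →L[ℝ] Cn n) y)).const_smul
    (-(1 / (2 * Real.pi)))).fderiv
  have h3 : fderiv ℝ (dcFlat f) y = _ := h2
  rw [h3]
  simp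

/-- `ddᶜ` in coordinates. The exterior derivative is defined by the preferred chart at each point;
by `inChart_extd` any chart may be used. -/
theorem coeffs_ddc {u : X → ℝ} (hu : ChartSmooth n u)
    {e : OpenPartialHomeomorph X (Cn n)} (he : e ∈ atlas (Cn n) X) {y : Cn n} (hy : y ∈ e.target) :
    coeffs (inChart e (ddc u) y) = hess (u ∘ e.symm) y := by
  have key {e' : OpenPartialHomeomorph X (Cn n)} (he' : e' ∈ atlas (Cn n) X) {z : Cn n}
      (hz : z ∈ e'.target) : inChart e' (toOneForm (dc u)) =ᶠ[𝓝 z]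
      fun z => ContinuousAlternatingMap.ofSubsingletonLIE (𝕜 := ℝ) (E := Cn n) (F := ℝ) (0 : Fin 1)
        (dcFlat (u ∘ e'.symm) z) := by
    filter_upwards [e'.open_target.mem_nhds hz] with w hw
    exact inChart_toOneForm_dc hu he' hw
  have hdiff {e' : OpenPartialHomeomorph X (Cn n)} (he' : e' ∈ atlas (Cn n) X) {z : Cn n}
      (hz : z ∈ e'.target) : DifferentiableAt ℝ (dcFlat (u ∘ e'.symm)) z :=
    ((contDiffOn_dcFlat e'.open_target (hu e' he')).contDiffAt
      (e'.open_target.mem_nhds hz)).differentiableAt (by simp)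
  have hLIE {e' : OpenPartialHomeomorph X (Cn n)} (he' : e' ∈ atlas (Cn n) X) {z : Cn n}
      (hz : z ∈ e'.target) : HasFDerivAt
      (fun z => ContinuousAlternatingMap.ofSubsingletonLIE (𝕜 := ℝ) (E := Cn n) (F := ℝ) (0 : Fin 1)
        (dcFlat (u ∘ e'.symm) z)) _ z :=
    (ContinuousAlternatingMap.ofSubsingletonLIE (𝕜 := ℝ) (E := Cn n) (F := ℝ)
        (0 : Fin 1)).toContinuousLinearEquiv.toContinuousLinearMap.hasFDerivAt.comp z
      (hdiff he' hz).hasFDerivAt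
  have hs := mem_chart_source (Cn n) (e.symm y)
  have ha := chart_mem_atlas (Cn n) (e.symm y)
  have ht := (chartAt (Cn n) (e.symm y)).map_source hs
  rw [ddc, inChart_extd _ he hy
    ((hLIE ha ht).differentiableAt.congr_of_eventuallyEq (key ha ht)), (key he hy).extDeriv_eq]
  funext p q
  have hev (v w : Cn n) : fderiv ℝ (fun x => dcFlat (u ∘ e.symm) x w) y v =
      fderiv ℝ (dcFlat (u ∘ e.symm)) y v w := by
    rw [fderiv_clm_apply (hdiff he hy) (differentiableAt_const w)]
    simp
  rw [coeffs, extDeriv_apply (hLIE he hy).differentiableAt, Fin.sum_univ_two]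
  change (-1 : ℤ) ^ 0 • fderiv ℝ (fun x => dcFlat (u ∘ e.symm) x (stdFrame n q)) y (stdFrame n p) +
    (-1 : ℤ) ^ 1 • fderiv ℝ (fun x => dcFlat (u ∘ e.symm) x (stdFrame n p)) y (stdFrame n q) = _
  rw [hev, hev, fderiv_dcFlat (hu.contDiffAt he hy), fderiv_dcFlat (hu.contDiffAt he hy), hess]
  simp only [pow_zero, pow_one, one_smul, neg_smul]
  ring

/-- The coefficients of `df ∧ dᶜg` for functions `f`, `g` on `ℂⁿ`. -/
def gradMat (f g : Cn n → ℝ) (y : Cn n) : CMat n := fun p q =>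
  fderiv ℝ f y (stdFrame n p) * dcFlat g y (stdFrame n q) -
    fderiv ℝ f y (stdFrame n q) * dcFlat g y (stdFrame n p)

theorem coeffs_wedgeOne {u v : X → ℝ} (hu : ChartSmooth n u) (hv : ChartSmooth n v)
    {e : OpenPartialHomeomorph X (Cn n)} (he : e ∈ atlas (Cn n) X) {y : Cn n} (hy : y ∈ e.target) :
    coeffs (inChart e (wedgeOne (d u) (dc v)) y) = gradMat (u ∘ e.symm) (v ∘ e.symm) y := by
  funext p q
  have h : inChart e (wedgeOne (d u) (dc v)) y ![stdFrame n p, stdFrame n q] =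
      wedgeOne (d u) (dc v) (e.symm y) ![symmD e y (stdFrame n p), symmD e y (stdFrame n q)] := by
    rw [inChart_eq, ContinuousAlternatingMap.compContinuousLinearMap_apply]
    simp only [raw]
    congr 1
    funext i
    fin_cases i <;> rfl
  refine (h.trans (wedgeOne_apply (d u) (dc v) (e.symm y) _ _)).trans ?_
  rw [gradMat, ← d_comp_symmD hu he hy, ← d_comp_symmD hu he hy, ← dc_comp_symmD hv he hy,
    ← dc_comp_symmD hv he hy]

omit [IsManifold 𝓘(ℂ, Cn n) ω X] in
theorem inChart_wedgeProd (α : Fin n → DForm n X (Fin 2)) (e : OpenPartialHomeomorph X (Cn n))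
    (y : Cn n) :
    inChart e (wedgeProd α) y (stdFrame n) = pf n fun i => coeffs (inChart e (α i) y) := by
  rw [← wedge_stdFrame]
  change (((1 / 2 : ℝ) ^ n) • (tensorTwo fun i => raw (α i) (e.symm y)).alternatization)
    (symmD e y ∘ stdFrame n) = _
  simp only [ContinuousAlternatingMap.smul_apply,
    ContinuousMultilinearMap.alternatization_apply_apply]
  rfl

end

/-! ### Closed `J`-invariant two-forms on open subsets of `ℂⁿ` -/

theorem coeffs_antisymm (α : Cn n [⋀^Fin 2]→L[ℝ] ℝ) (v w : Cn n) : α ![v, w] = -α ![w, v] := by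
  have h := α.toAlternatingMap.map_swap ![w, v] (show (0 : Fin 2) ≠ 1 by decide)
  have h' : ![w, v] ∘ Equiv.swap (0 : Fin 2) 1 = ![v, w] := by
    funext i
    fin_cases i <;> simp
  rw [h'] at h
  exact h

theorem coeffs_smul_smul (α : Cn n [⋀^Fin 2]→L[ℝ] ℝ) (a b : ℝ) (v w : Cn n) :
    α ![a • v, b • w] = a * b * α ![v, w] := by
  have h := α.toAlternatingMap.toMultilinearMap.map_smul_univ ![a, b] ![v, w]
  have h' : (fun i => ![a, b] i • ![v, w] i) = ![a • v, b • w] := by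
    funext i
    fin_cases i <;> rfl
  rw [h', Fin.prod_univ_two] at h
  exact h

theorem I_smul_stdFrame (p : Idx n) :
    Complex.I • stdFrame n p = jSign p • stdFrame n (jPerm n p) := by
  obtain ⟨i, j⟩ := p
  ext k
  fin_cases j <;> by_cases h : k = i <;> simp [stdFrame, jSign, jPerm, h]

/-- Smooth, closed two-forms of type `(1, 1)` on a subset of `ℂⁿ`, in terms of coefficients. -/
structure ClosedInvOn (A : Cn n → CMat n) (U : Set (Cn n)) : Prop where
  smooth : ContDiffOn ℝ ∞ A U
  closed : ∀ y ∈ U, ∀ p q r, fderiv ℝ A y (stdFrame n p) q r + fderiv ℝ A y (stdFrame n q) r p +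
    fderiv ℝ A y (stdFrame n r) p q = 0
  inv : ∀ y ∈ U, ∀ p q, jSign p * jSign q * A y (jPerm n p) (jPerm n q) = A y p q

theorem ClosedInvOn.add {A B : Cn n → CMat n} {U : Set (Cn n)} (hU : IsOpen U)
    (hA : ClosedInvOn A U) (hB : ClosedInvOn B U) : ClosedInvOn (A + B) U where
  smooth := hA.smooth.add hB.smooth
  closed y hy p q r := by
    have h1 := (hA.smooth.contDiffAt (hU.mem_nhds hy)).differentiableAt (by simp)
    have h2 := (hB.smooth.contDiffAt (hU.mem_nhds hy)).differentiableAt (by simp)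
    rw [fderiv_add h1 h2]
    simp only [add_apply, Pi.add_apply]
    linear_combination hA.closed y hy p q r + hB.closed y hy p q r
  inv y hy p q := by
    simp only [Pi.add_apply]
    linear_combination hA.inv y hy p q + hB.inv y hy p q

theorem ClosedInvOn.congr {A B : Cn n → CMat n} {U : Set (Cn n)} (hU : IsOpen U)
    (hA : ClosedInvOn A U) (h : ∀ y ∈ U, B y = A y) : ClosedInvOn B U where
  smooth := hA.smooth.congr h
  closed y hy p q r := by
    have : B =ᶠ[𝓝 y] A := by
      filter_upwards [hU.mem_nhds hy] with z hz using h z hz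
    rw [this.fderiv_eq]
    exact hA.closed y hy p q r
  inv y hy p q := by rw [h y hy]; exact hA.inv y hy p q

theorem contDiffOn_fderiv_fderiv {f : Cn n → ℝ} {U : Set (Cn n)} (hU : IsOpen U)
    (hf : ContDiffOn ℝ ∞ f U) : ContDiffOn ℝ ∞ (fderiv ℝ (fderiv ℝ f)) U :=
  (hf.fderiv_of_isOpen (m := ∞) hU (by simp)).fderiv_of_isOpen (m := ∞) hU (by simp)

theorem contDiffOn_hess {f : Cn n → ℝ} {U : Set (Cn n)} (hU : IsOpen U)
    (hf : ContDiffOn ℝ ∞ f U) : ContDiffOn ℝ ∞ (hess f) U := by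
  have h := contDiffOn_fderiv_fderiv hU hf
  refine contDiffOn_pi.2 fun p => contDiffOn_pi.2 fun q => contDiffOn_const.mul (ContDiffOn.sub ?_ ?_)
  · exact (h.clm_apply contDiffOn_const).clm_apply contDiffOn_const
  · exact (h.clm_apply contDiffOn_const).clm_apply contDiffOn_const

theorem fderiv_fderiv_symm {f : Cn n → ℝ} {y : Cn n} (hf : ContDiffAt ℝ ∞ f y) (v w : Cn n) :
    fderiv ℝ (fderiv ℝ f) y v w = fderiv ℝ (fderiv ℝ f) y w v :=
  hf.isSymmSndFDerivAt (by simpa using ENat.LEInfty.out) v w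

/-- `ddᶜf` is closed, by the symmetry of the third derivatives, and of type `(1, 1)`, by the symmetry
of the second derivatives and `J² = -1`. -/
theorem closedInvOn_hess {f : Cn n → ℝ} {U : Set (Cn n)} (hU : IsOpen U)
    (hf : ContDiffOn ℝ ∞ f U) : ClosedInvOn (hess f) U where
  smooth := contDiffOn_hess hU hf
  closed y hy p q r := by
    have hfy := hf.contDiffAt (hU.mem_nhds hy)
    have h1 : ContDiffAt ℝ ∞ (fderiv ℝ f) y := hfy.fderiv_right (by simp)
    have h2 : DifferentiableAt ℝ (fderiv ℝ (fderiv ℝ f)) y :=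
      (h1.fderiv_right (m := ∞) (by simp)).differentiableAt (by simp)
    have key (p q r : Idx n) : fderiv ℝ (hess f) y (stdFrame n p) q r =
        -(1 / (2 * Real.pi)) *
        (fderiv ℝ (fderiv ℝ (fderiv ℝ f)) y (stdFrame n p) (stdFrame n q)
            (Complex.I • stdFrame n r) -
          fderiv ℝ (fderiv ℝ (fderiv ℝ f)) y (stdFrame n p) (stdFrame n r)
            (Complex.I • stdFrame n q)) := by
      have hd := ((contDiffOn_hess hU hf).contDiffAt (hU.mem_nhds hy)).differentiableAt (by simp)
      have hev (v w : Cn n) :=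
        (h2.hasFDerivAt.clm_apply (hasFDerivAt_const v y)).clm_apply (hasFDerivAt_const w y)
      have e1 := hasFDerivAt_pi'.1 (hasFDerivAt_pi'.1 hd.hasFDerivAt q) r
      have e2 := ((hev (stdFrame n q) (Complex.I • stdFrame n r)).sub
        (hev (stdFrame n r) (Complex.I • stdFrame n q))).const_mul (-(1 / (2 * Real.pi)))
      have e3 := congrArg (fun L : Cn n →L[ℝ] ℝ => L (stdFrame n p)) (e1.unique e2)
      simpa using e3
    have hsymm (v w : Cn n) := h1.isSymmSndFDerivAt (n := ∞) (by simpa using ENat.LEInfty.out) v w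
    rw [key, key, key, hsymm (stdFrame n q) (stdFrame n p), hsymm (stdFrame n r) (stdFrame n p),
      hsymm (stdFrame n r) (stdFrame n q)]
    ring
  inv y hy p q := by
    have hfy := hf.contDiffAt (hU.mem_nhds hy)
    have hI (v : Cn n) : Complex.I • Complex.I • v = -v := by
      rw [smul_smul, Complex.I_mul_I, neg_one_smul]
    have h1 (p q : Idx n) : jSign p * jSign q * hess f y (jPerm n p) (jPerm n q) =
        -(1 / (2 * Real.pi)) *
          (fderiv ℝ (fderiv ℝ f) y (jSign p • stdFrame n (jPerm n p))
              (Complex.I • jSign q • stdFrame n (jPerm n q)) -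
            fderiv ℝ (fderiv ℝ f) y (jSign q • stdFrame n (jPerm n q))
              (Complex.I • jSign p • stdFrame n (jPerm n p))) := by
      simp only [hess, smul_comm Complex.I (_ : ℝ), map_smul, smul_apply,
        smul_eq_mul]
      ring
    rw [h1, ← I_smul_stdFrame, ← I_smul_stdFrame, hI, hI, map_neg, map_neg,
      fderiv_fderiv_symm hfy (Complex.I • stdFrame n p),
      fderiv_fderiv_symm hfy (Complex.I • stdFrame n q), hess]
    ring

section

variable [IsManifold 𝓘(ℂ, Cn n) ω X]

omit [IsManifold 𝓘(ℂ, Cn n) ω X] in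
theorem KaehlerForm.contDiffOn_coeffs (κ : KaehlerForm n X) {e : OpenPartialHomeomorph X (Cn n)}
    (he : e ∈ atlas (Cn n) X) :
    ContDiffOn ℝ ∞ (fun y => coeffs (inChart e κ.form y)) e.target :=
  contDiffOn_pi.2 fun p => contDiffOn_pi.2 fun q =>
    (ContinuousAlternatingMap.apply ℝ (Cn n) ℝ ![stdFrame n p, stdFrame n q]).contDiff.comp_contDiffOn
      (κ.smooth e he)

/-- A Kähler form is closed in every chart, not only at the centres of the preferred charts. -/
theorem KaehlerForm.closedInvOn (κ : KaehlerForm n X) {e : OpenPartialHomeomorph X (Cn n)}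
    (he : e ∈ atlas (Cn n) X) : ClosedInvOn (fun y => coeffs (inChart e κ.form y)) e.target where
  smooth := κ.contDiffOn_coeffs he
  closed y hy p q r := by
    have hd {e : OpenPartialHomeomorph X (Cn n)} (he : e ∈ atlas (Cn n) X) {y : Cn n}
        (hy : y ∈ e.target) : DifferentiableAt ℝ (inChart e κ.form) y :=
      ((κ.smooth e he).contDiffAt (e.open_target.mem_nhds hy)).differentiableAt (by simp)
    have h1 := inChart_extd κ.form he hy (hd (chart_mem_atlas _ _) (mem_chart_target _ _))
    have h2 : extDeriv (inChart e κ.form) y = 0 := by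
      rw [← h1, κ.closed]; rfl
    have h3 := congrArg (fun L => L ![stdFrame n p, stdFrame n q, stdFrame n r]) h2
    have h4 (p q r : Idx n) : fderiv ℝ (fun y => coeffs (inChart e κ.form y)) y (stdFrame n p) q r =
        fderiv ℝ (fun y => inChart e κ.form y ![stdFrame n q, stdFrame n r]) y (stdFrame n p) := by
      have hd := ((κ.contDiffOn_coeffs he).contDiffAt (e.open_target.mem_nhds hy)).differentiableAt (by simp)
      have e1 := hasFDerivAt_pi'.1 (hasFDerivAt_pi'.1 hd.hasFDerivAt q) r
      exact (congrArg (fun L : Cn n →L[ℝ] ℝ => L (stdFrame n p)) e1.fderiv).symm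
    have h5 : fderiv ℝ (fun y => coeffs (inChart e κ.form y)) y (stdFrame n q) r p =
        -fderiv ℝ (fun y => coeffs (inChart e κ.form y)) y (stdFrame n q) p r := by
      rw [h4, h4]
      have : (fun y => inChart e κ.form y ![stdFrame n r, stdFrame n p]) =
          fun y => -inChart e κ.form y ![stdFrame n p, stdFrame n r] := by
        funext y
        exact coeffs_antisymm _ _ _
      rw [this, fderiv_fun_neg]
      rfl
    rw [h5, h4, h4, h4]
    rw [extDeriv_apply (hd he hy)] at h3
    have h6 := (Fin.sum_univ_three (M := ℝ) _).symm.trans h3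
    have r0 (a b c : Cn n) : Fin.removeNth 0 ![a, b, c] = ![b, c] := by
      funext i; fin_cases i <;> rfl
    have r1 (a b c : Cn n) : Fin.removeNth 1 ![a, b, c] = ![a, c] := by
      funext i; fin_cases i <;> rfl
    have r2 (a b c : Cn n) : Fin.removeNth 2 ![a, b, c] = ![a, b] := by
      funext i; fin_cases i <;> rfl
    simp only [r0, r1, r2] at h6
    simp only [Fin.val_zero, Fin.val_one, Fin.val_two, pow_zero, pow_one, one_smul, neg_smul,
      even_two, Even.neg_pow, one_pow] at h6
    exact h6
  inv y hy p q := by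
    have h (v w : Cn n) : inChart e κ.form y ![Complex.I • v, Complex.I • w] =
        inChart e κ.form y ![v, w] := by
      have h1 (v w : Cn n) : inChart e κ.form y ![v, w] =
          raw κ.form (e.symm y) ![symmD e y v, symmD e y w] := by
        rw [inChart_eq, ContinuousAlternatingMap.compContinuousLinearMap_apply]
        congr 1
        funext i
        fin_cases i <;> rfl
      rw [h1, h1, symmD_smul_I he hy, symmD_smul_I he hy]
      exact κ.type_one_one (e.symm y) _ _
    have h2 := h (stdFrame n p) (stdFrame n q)
    rw [I_smul_stdFrame, I_smul_stdFrame] at h2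
    rw [coeffs, coeffs, ← h2, coeffs_smul_smul]

theorem KaehlerForm.coeffs_add (κ : KaehlerForm n X) {u : X → ℝ} (hu : ChartSmooth n u)
    {e : OpenPartialHomeomorph X (Cn n)} (he : e ∈ atlas (Cn n) X) {y : Cn n} (hy : y ∈ e.target) :
    coeffs (inChart e (κ.add u) y) = coeffs (inChart e κ.form y) + hess (u ∘ e.symm) y := by
  rw [← coeffs_ddc hu he hy]
  rfl

theorem KaehlerForm.closedInvOn_add (κ : KaehlerForm n X) {u : X → ℝ} (hu : ChartSmooth n u)
    {e : OpenPartialHomeomorph X (Cn n)} (he : e ∈ atlas (Cn n) X) :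
    ClosedInvOn (fun y => coeffs (inChart e (κ.add u) y)) e.target :=
  ((κ.closedInvOn he).add e.open_target (closedInvOn_hess e.open_target (hu e he))).congr
    e.open_target fun _ hy => κ.coeffs_add hu he hy

end

end

section

open MeasureTheory Finset

variable {n : ℕ}

/-! ### Green's formula on open subsets of `ℂⁿ` -/

theorem pfOne_eq_update (i₀ : Fin n) (h₀ : (i₀ : ℕ) = 0) (B A : CMat n) :
    pfOne B A = pf n (Function.update (rowOne 0 A) i₀ B) := by
  rw [pfOne]
  congr 1
  funext j
  by_cases hj : j = i₀
  · subst hj; simp [rowOne, h₀]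
  · have : (j : ℕ) ≠ 0 := fun h => hj (Fin.ext (h.trans h₀.symm))
    simp [rowOne, hj, this]

theorem pfOne_add (i₀ : Fin n) (h₀ : (i₀ : ℕ) = 0) (B C A : CMat n) :
    pfOne (B + C) A = pfOne B A + pfOne C A := by
  simp only [pfOne_eq_update i₀ h₀, ContinuousMultilinearMap.map_update_add]

theorem pfOne_sub (i₀ : Fin n) (h₀ : (i₀ : ℕ) = 0) (B C A : CMat n) :
    pfOne (B - C) A = pfOne B A - pfOne C A := by
  simp only [pfOne_eq_update i₀ h₀, ContinuousMultilinearMap.map_update_sub]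

theorem pfOne_smul (i₀ : Fin n) (h₀ : (i₀ : ℕ) = 0) (c : ℝ) (B A : CMat n) :
    pfOne (c • B) A = c * pfOne B A := by
  simp only [pfOne_eq_update i₀ h₀, ContinuousMultilinearMap.map_update_smul, smul_eq_mul]

theorem continuous_pfOne : Continuous fun p : CMat n × CMat n => pfOne p.1 p.2 := by
  refine (pf n).cont.comp (continuous_pi fun i => ?_)
  by_cases h : (i : ℕ) = 0
  · simpa [rowOne, h] using continuous_fst
  · simpa [rowOne, h] using continuous_snd

theorem integrableOn_of_eq_zero_off_compact {E : Type*} [NormedAddCommGroup E] [MeasurableSpace E]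
    [BorelSpace E] {μ : Measure E} [IsFiniteMeasureOnCompacts μ] {U K : Set E} (hU : IsOpen U)
    (hK : IsCompact K) (hKU : K ⊆ U) {f : E → ℝ} (hf : ContinuousOn f U)
    (h0 : ∀ y ∈ U, y ∉ K → f y = 0) : IntegrableOn f U μ :=
  ((hf.mono hKU).integrableOn_compact hK).of_forall_sdiff_eq_zero hU.measurableSet
    fun y hy => h0 y hy.1 hy.2

/-- The integral of a derivative of a compactly supported function vanishes. -/
theorem setIntegral_fderiv_eq_zero {U K : Set (Cn n)} (hU : IsOpen U)
    (hK : IsCompact K) (hKU : K ⊆ U) {b : Cn n → ℝ} (hb : ContDiffOn ℝ 1 b U)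
    (h0 : ∀ y ∈ U, y ∉ K → b y = 0) (v : Cn n) : ∫ y in U, fderiv ℝ b y v = 0 := by
  set b' : Cn n → ℝ := U.indicator b with hb'
  have h1 (y : Cn n) (hy : y ∈ U) : b' =ᶠ[𝓝 y] b := by
    filter_upwards [hU.mem_nhds hy] with z hz
    simp [hb', hz]
  have h2 (y : Cn n) (hy : y ∉ K) : b' =ᶠ[𝓝 y] fun _ => 0 := by
    filter_upwards [hK.isClosed.isOpen_compl.mem_nhds hy] with z hz
    by_cases hzU : z ∈ U
    · simp [hb', hzU, h0 z hzU hz]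
    · simp [hb', hzU]
  have hsm : ContDiff ℝ 1 b' := by
    rw [contDiff_iff_contDiffAt]
    intro y
    by_cases hy : y ∈ U
    · exact (hb.contDiffAt (hU.mem_nhds hy)).congr_of_eventuallyEq (h1 y hy)
    · exact contDiffAt_const.congr_of_eventuallyEq (h2 y fun h => hy (hKU h))
  have hcs : HasCompactSupport b' := HasCompactSupport.intro hK fun y hy => (h2 y hy).eq_of_nhds
  have hcf : Continuous fun y => fderiv ℝ b' y v :=
    (hsm.continuous_fderiv (by simp)).clm_apply continuous_const
  have hcs' : HasCompactSupport fun y => fderiv ℝ b' y v := hcs.fderiv_apply ℝ v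
  have hint : ∫ y, fderiv ℝ b' y v = 0 := by
    have := integral_mul_fderiv_eq_neg_fderiv_mul_of_integrable (μ := (volume : Measure (Cn n)))
      (f := fun _ : Cn n => (1 : ℝ)) (g := b') (v := v) (by simp)
      (by simpa using hcf.integrable_of_hasCompactSupport hcs')
      (by simpa using hsm.continuous.integrable_of_hasCompactSupport hcs)
      (fun _ _ => differentiableAt_const _)
      (fun _ _ => hsm.differentiable (by simp) _)
    simpa using this
  rw [← hint, ← setIntegral_eq_integral_of_forall_compl_eq_zero (s := U)
    (f := fun y => fderiv ℝ b' y v)]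
  · refine setIntegral_congr_fun hU.measurableSet fun y hy => ?_
    simp only [(h1 y hy).fderiv_eq]
  · intro y hy
    rw [(h2 y fun h => hy (hKU h)).fderiv_eq]
    simp

/-- Stokes' theorem for `d(a ∧ αⁿ⁻¹)`, with `a` compactly supported and `α` closed. -/
theorem setIntegral_pfOne_curl {U K : Set (Cn n)} (hU : IsOpen U)
    (hK : IsCompact K) (hKU : K ⊆ U) (i₀ : Fin n) (h₀ : (i₀ : ℕ) = 0) {A : Cn n → CMat n}
    (hA : ClosedInvOn A U) {a : Idx n → Cn n → ℝ} (ha : ∀ q, ContDiffOn ℝ ∞ (a q) U)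
    (h0 : ∀ q, ∀ y ∈ U, y ∉ K → a q y = 0) :
    ∫ y in U, pfOne (fun p q => fderiv ℝ (a q) y (stdFrame n p) -
      fderiv ℝ (a p) y (stdFrame n q)) (A y) = 0 := by
  have hAc (p q : Idx n) : ContDiffOn ℝ ∞ (fun y => A y p q) U :=
    contDiffOn_pi.1 (contDiffOn_pi.1 hA.smooth p) q
  set b : Equiv.Perm (Idx n) → Cn n → ℝ := fun σ y =>
    a (σ (i₀, 1)) y * ∏ i ∈ univ.erase i₀, A y (σ (i, 0)) (σ (i, 1)) with hb
  have hbs (σ : Equiv.Perm (Idx n)) : ContDiffOn ℝ ∞ (b σ) U :=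
    (ha _).mul (contDiffOn_prod fun i _ => hAc _ _)
  have hb0 (σ : Equiv.Perm (Idx n)) : ∀ y ∈ U, y ∉ K → b σ y = 0 := fun y hy hyK => by
    simp only [hb, h0 _ y hy hyK, zero_mul]
  have hpt (y : Cn n) (hy : y ∈ U) : pfOne (fun p q => fderiv ℝ (a q) y (stdFrame n p) -
      fderiv ℝ (a p) y (stdFrame n q)) (A y) = (1 / 2) ^ n * 2 * ∑ σ : Equiv.Perm (Idx n),
        ((Equiv.Perm.sign σ : ℤ) : ℝ) * fderiv ℝ (b σ) y (stdFrame n (σ (i₀, 0))) := by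
    rw [pfOne_curl i₀ h₀ (fun q => a q y) (fun p q => fderiv ℝ (a q) y (stdFrame n p)) (A y)
      (fun p => fderiv ℝ A y (stdFrame n p)) (hA.closed y hy)]
    congr 1
    refine Finset.sum_congr rfl fun σ _ => ?_
    congr 1
    have hd1 := (((ha (σ (i₀, 1))).contDiffAt (hU.mem_nhds hy)).differentiableAt
      (by simp)).hasFDerivAt
    have hdA := ((hA.smooth.contDiffAt (hU.mem_nhds hy)).differentiableAt (by simp)).hasFDerivAt
    have hd2 (i : Fin n) := hasFDerivAt_pi'.1 (hasFDerivAt_pi'.1 hdA (σ (i, 0))) (σ (i, 1))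
    have hd := hd1.mul (HasFDerivAt.finsetProd (u := univ.erase i₀) fun i _ => hd2 i)
    have hd' : HasFDerivAt (b σ) _ y := hd
    rw [hd'.fderiv]
    simp only [add_apply, smul_apply, _root_.sum_apply, smul_eq_mul, ContinuousLinearMap.comp_apply,
      ContinuousLinearMap.proj_apply, mul_comm, add_comm]
  rw [setIntegral_congr_fun hU.measurableSet hpt, integral_const_mul, integral_finsetSum]
  · refine mul_eq_zero_of_right _ (Finset.sum_eq_zero fun σ _ => ?_)
    rw [integral_const_mul, setIntegral_fderiv_eq_zero hU hK hKU ((hbs σ).of_le (by simp)) (hb0 σ),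
      mul_zero]
  · intro σ _
    refine Integrable.const_mul ?_ _
    refine integrableOn_of_eq_zero_off_compact hU hK hKU ?_ ?_
    · exact (((hbs σ).fderiv_of_isOpen (m := ∞) hU (by simp)).clm_apply
        contDiffOn_const).continuousOn
    · intro y hy hyK
      have : b σ =ᶠ[𝓝 y] fun _ => 0 := by
        filter_upwards [hU.mem_nhds hy, hK.isClosed.isOpen_compl.mem_nhds hyK] with z hz hz'
        exact hb0 σ z hz hz'
      rw [this.fderiv_eq]
      simp

/-- `df ∧ dᶜg - dg ∧ dᶜf` is `J`-anti-invariant. -/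
theorem gradMat_sub_anti (f g : Cn n → ℝ) (y : Cn n) (p q : Idx n) :
    jSign p * jSign q * (gradMat f g y - gradMat g f y) (jPerm n p) (jPerm n q) =
      -(gradMat f g y - gradMat g f y) p q := by
  have hI (v : Cn n) : Complex.I • Complex.I • v = -v := by
    rw [smul_smul, Complex.I_mul_I, neg_one_smul]
  have h1 (f : Cn n → ℝ) (p : Idx n) : jSign p * fderiv ℝ f y (stdFrame n (jPerm n p)) =
      fderiv ℝ f y (Complex.I • stdFrame n p) := by
    rw [I_smul_stdFrame, map_smul, smul_eq_mul]
  have h2 (f : Cn n → ℝ) (p : Idx n) :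
      jSign p * fderiv ℝ f y (Complex.I • stdFrame n (jPerm n p)) =
      -fderiv ℝ f y (stdFrame n p) := by
    rw [← smul_eq_mul, ← map_smul, smul_comm, ← I_smul_stdFrame, hI, map_neg]
  simp only [Pi.sub_apply, gradMat, dcFlat_apply]
  linear_combination (exp := 1) (-(1 / (2 * Real.pi))) * (
    jSign q * fderiv ℝ g y (Complex.I • stdFrame n (jPerm n q)) * h1 f p
    - jSign p * fderiv ℝ g y (Complex.I • stdFrame n (jPerm n p)) * h1 f q
    - jSign q * fderiv ℝ f y (Complex.I • stdFrame n (jPerm n q)) * h1 g p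
    + jSign p * fderiv ℝ f y (Complex.I • stdFrame n (jPerm n p)) * h1 g q
    + fderiv ℝ f y (Complex.I • stdFrame n p) * h2 g q
    - fderiv ℝ f y (Complex.I • stdFrame n q) * h2 g p
    - fderiv ℝ g y (Complex.I • stdFrame n p) * h2 f q
    + fderiv ℝ g y (Complex.I • stdFrame n q) * h2 f p)

/-- Green's formula: `g ddᶜf ∧ αⁿ⁻¹` and `f ddᶜg ∧ αⁿ⁻¹` have the same integral, as they differ
by `d((f dᶜg - g dᶜf) ∧ αⁿ⁻¹)`. -/
theorem setIntegral_green {U K : Set (Cn n)} (hU : IsOpen U)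
    (hK : IsCompact K) (hKU : K ⊆ U) (i₀ : Fin n) (h₀ : (i₀ : ℕ) = 0) {A : Cn n → CMat n}
    (hA : ClosedInvOn A U) {f g : Cn n → ℝ} (hf : ContDiffOn ℝ ∞ f U) (hg : ContDiffOn ℝ ∞ g U)
    (h0 : ∀ y ∈ U, y ∉ K → g y = 0) :
    ∫ y in U, (f y * pfOne (hess g y) (A y) - g y * pfOne (hess f y) (A y)) = 0 := by
  have hg0 : ∀ y ∈ U, y ∉ K → g =ᶠ[𝓝 y] fun _ => 0 := fun y hy hyK => by
    filter_upwards [hU.mem_nhds hy, hK.isClosed.isOpen_compl.mem_nhds hyK] with z hz hz'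
    exact h0 z hz hz'
  set a : Idx n → Cn n → ℝ := fun q y =>
    f y * dcFlat g y (stdFrame n q) - g y * dcFlat f y (stdFrame n q) with ha
  rw [← setIntegral_pfOne_curl hU hK hKU i₀ h₀ hA (a := a) (fun q => ?_) (fun q y hy hyK => ?_)]
  · refine setIntegral_congr_fun hU.measurableSet fun y hy => ?_
    have hfy := hf.contDiffAt (hU.mem_nhds hy)
    have hgy := hg.contDiffAt (hU.mem_nhds hy)
    have hd {f : Cn n → ℝ} (hf : ContDiffOn ℝ ∞ f U) : HasFDerivAt (dcFlat f) _ y :=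
      (((contDiffOn_dcFlat hU hf).contDiffAt (hU.mem_nhds hy)).differentiableAt
        (by simp)).hasFDerivAt
    have hda (p q : Idx n) : fderiv ℝ (a q) y (stdFrame n p) =
        f y * (-(1 / (2 * Real.pi)) *
          fderiv ℝ (fderiv ℝ g) y (stdFrame n p) (Complex.I • stdFrame n q)) +
        fderiv ℝ f y (stdFrame n p) * dcFlat g y (stdFrame n q) -
        (g y * (-(1 / (2 * Real.pi)) *
          fderiv ℝ (fderiv ℝ f) y (stdFrame n p) (Complex.I • stdFrame n q)) +
        fderiv ℝ g y (stdFrame n p) * dcFlat f y (stdFrame n q)) := by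
      have h1 := ((hfy.differentiableAt (by simp)).hasFDerivAt.mul
        ((hd hg).clm_apply (hasFDerivAt_const (stdFrame n q) y))).sub
        ((hgy.differentiableAt (by simp)).hasFDerivAt.mul
        ((hd hf).clm_apply (hasFDerivAt_const (stdFrame n q) y)))
      have h2 : HasFDerivAt (a q) _ y := h1
      rw [h2.fderiv, ← fderiv_dcFlat hfy, ← fderiv_dcFlat hgy]
      simp
      ring
    have hM : (fun p q => fderiv ℝ (a q) y (stdFrame n p) - fderiv ℝ (a p) y (stdFrame n q)) =
        f y • hess g y - g y • hess f y + (gradMat f g y - gradMat g f y) := by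
      funext p q
      simp only [hda, Pi.add_apply, Pi.sub_apply, Pi.smul_apply, smul_eq_mul, hess, gradMat]
      ring
    change _ = pfOne _ _
    rw [hM, pfOne_add i₀ h₀, pfOne_sub i₀ h₀, pfOne_smul i₀ h₀, pfOne_smul i₀ h₀,
      pfOne_eq_zero_of_anti i₀ h₀ _ _ (gradMat_sub_anti f g y) (hA.inv y hy), add_zero]
  · exact (hf.mul ((contDiffOn_dcFlat hU hg).clm_apply contDiffOn_const)).sub
      (hg.mul ((contDiffOn_dcFlat hU hf).clm_apply contDiffOn_const))
  · simp only [ha, dcFlat_apply, (hg0 y hy hyK).fderiv_eq, h0 y hy hyK]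
    simp

end

section

open MeasureTheory Finset

variable {n : ℕ} {X : Type*} [TopologicalSpace X] [ChartedSpace (Cn n) X]

/-! ### Top degree forms and their integrals -/

/-- The standard real frame of `ℂⁿ` as a basis. -/
def stdBasis (n : ℕ) : Module.Basis (Idx n) ℝ (Cn n) :=
  (Complex.basisOneI.smulTower (EuclideanSpace.basisFun (Fin n) ℂ).toBasis).reindex
    (Equiv.prodComm _ _)

theorem coe_stdBasis (n : ℕ) : ⇑(stdBasis n) = stdFrame n := by
  funext p
  obtain ⟨i, j⟩ := p
  ext k
  fin_cases j <;> by_cases h : k = i <;>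
    simp [stdBasis, stdFrame, Module.Basis.smulTower_apply, h]

theorem apply_comp_stdFrame (f : Cn n [⋀^Idx n]→L[ℝ] ℝ) (A : Cn n →L[ℝ] Cn n) :
    f (A ∘ stdFrame n) = A.det * f (stdFrame n) := by
  have h := f.toAlternatingMap.eq_smul_basis_det (stdBasis n)
  have h1 (v : Idx n → Cn n) : f v = f (stdFrame n) * (stdBasis n).det v := by
    have := congrArg (fun g : Cn n [⋀^Idx n]→ₗ[ℝ] ℝ => g v) h
    simpa [coe_stdBasis] using this
  have h2 := (stdBasis n).det_comp (A : Cn n →ₗ[ℝ] Cn n) (stdBasis n)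
  rw [(stdBasis n).det_self, mul_one, coe_stdBasis] at h2
  rw [h1 (A ∘ stdFrame n)]
  have h3 : (stdBasis n).det (A ∘ stdFrame n) = A.det := h2
  rw [h3, mul_comm]

/-- A top degree form on `ℂⁿ` is determined by its coefficient in the standard frame. -/
theorem ext_stdFrame {f g : Cn n [⋀^Idx n]→L[ℝ] ℝ} (h : f (stdFrame n) = g (stdFrame n)) :
    f = g := by
  have h1 (f : Cn n [⋀^Idx n]→L[ℝ] ℝ) (v : Idx n → Cn n) :
      f v = f (stdFrame n) * (stdBasis n).det v := by
    have := congrArg (fun g : Cn n [⋀^Idx n]→ₗ[ℝ] ℝ => g v)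
      (f.toAlternatingMap.eq_smul_basis_det (stdBasis n))
    simpa [coe_stdBasis] using this
  ext v
  rw [h1 f, h1 g, h]

theorem det_restrictScalars_nonneg (A : Cn n →L[ℂ] Cn n) : 0 ≤ (A.restrictScalars ℝ).det := by
  have h : (A.restrictScalars ℝ).det = Algebra.norm ℝ (LinearMap.det (A : Cn n →ₗ[ℂ] Cn n)) :=
    LinearMap.det_restrictScalars (R := ℝ) (S := ℂ) (f := (A : Cn n →ₗ[ℂ] Cn n))
  rw [h, Algebra.norm_complex_apply]
  exact Complex.normSq_nonneg _

/-- The coefficient of a top degree form in a chart. -/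
def topCoeff (e : OpenPartialHomeomorph X (Cn n)) (η : DForm n X (Fin n × Fin 2)) (y : Cn n) : ℝ :=
  inChart e η y (stdFrame n)

theorem topCoeff_smul (e : OpenPartialHomeomorph X (Cn n)) (f : X → ℝ)
    (η : DForm n X (Fin n × Fin 2)) (y : Cn n) :
    topCoeff e (fun x => f x • η x) y = f (e.symm y) * topCoeff e η y := rfl

theorem topCoeff_const_smul (e : OpenPartialHomeomorph X (Cn n)) (c : ℝ)
    (η : DForm n X (Fin n × Fin 2)) (y : Cn n) :
    topCoeff e (c • η) y = c * topCoeff e η y := rfl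

theorem topCoeff_add (e : OpenPartialHomeomorph X (Cn n))
    (η θ : DForm n X (Fin n × Fin 2)) (y : Cn n) :
    topCoeff e (η + θ) y = topCoeff e η y + topCoeff e θ y := rfl

theorem topCoeff_sub (e : OpenPartialHomeomorph X (Cn n))
    (η θ : DForm n X (Fin n × Fin 2)) (y : Cn n) :
    topCoeff e (η - θ) y = topCoeff e η y - topCoeff e θ y := rfl

theorem topCoeff_wedgePow (e : OpenPartialHomeomorph X (Cn n)) (α : DForm n X (Fin 2))
    (y : Cn n) : topCoeff e (wedgePow α) y = pfPow (coeffs (inChart e α y)) :=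
  inChart_wedgeProd _ e y

theorem topCoeff_wedgePowOne (e : OpenPartialHomeomorph X (Cn n)) (η α : DForm n X (Fin 2))
    (y : Cn n) : topCoeff e (wedgePowOne η α) y =
      pfOne (coeffs (inChart e η y)) (coeffs (inChart e α y)) := by
  refine (inChart_wedgeProd _ e y).trans ?_
  rw [pfOne]
  congr 1
  funext i
  unfold rowOne
  split_ifs <;> rfl

theorem topCoeff_wedgePowTwo (e : OpenPartialHomeomorph X (Cn n)) (η θ α : DForm n X (Fin 2))
    (y : Cn n) : topCoeff e (wedgePowTwo η θ α) y =
      pfTwo (coeffs (inChart e η y)) (coeffs (inChart e θ y)) (coeffs (inChart e α y)) := by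
  refine (inChart_wedgeProd _ e y).trans ?_
  rw [pfTwo]
  congr 1
  funext i
  split_ifs <;> rfl

section

variable [IsManifold 𝓘(ℂ, Cn n) ω X]

/-- The change of charts for top degree forms. The absolute value is that of the formula for the
change of variables in integrals: determinants of complex linear maps are nonnegative. -/
theorem topCoeff_change (η : DForm n X (Fin n × Fin 2)) {e e' : OpenPartialHomeomorph X (Cn n)}
    (he : e ∈ atlas (Cn n) X) (he' : e' ∈ atlas (Cn n) X) {y : Cn n} (hy : y ∈ e.target)
    (hy' : e.symm y ∈ e'.source) :
    topCoeff e η y =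
      |(fderiv ℝ (e' ∘ e.symm) y).det| * topCoeff e' η ((e' ∘ e.symm) y) := by
  rw [topCoeff, inChart_change η he he' hy hy',
    ContinuousAlternatingMap.compContinuousLinearMap_apply, apply_comp_stdFrame, abs_of_nonneg]
  · rfl
  · rw [fderiv_transition he he' hy hy']
    exact det_restrictScalars_nonneg _

omit [IsManifold 𝓘(ℂ, Cn n) ω X] in
theorem ChartSmooth.mul {u v : X → ℝ} (hu : ChartSmooth n u) (hv : ChartSmooth n v) :
    ChartSmooth n (fun x => u x * v x) := fun e he => (hu e he).mul (hv e he)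

omit [IsManifold 𝓘(ℂ, Cn n) ω X] in
theorem ChartSmooth.add {u v : X → ℝ} (hu : ChartSmooth n u) (hv : ChartSmooth n v) :
    ChartSmooth n (fun x => u x + v x) := fun e he => (hu e he).add (hv e he)

theorem hess_add {f g : Cn n → ℝ} {U : Set (Cn n)} (hU : IsOpen U) (hf : ContDiffOn ℝ ∞ f U)
    (hg : ContDiffOn ℝ ∞ g U) {y : Cn n} (hy : y ∈ U) :
    hess (fun z => f z + g z) y = hess f y + hess g y := by
  have hd {f : Cn n → ℝ} (hf : ContDiffOn ℝ ∞ f U) {z : Cn n} (hz : z ∈ U) :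
      DifferentiableAt ℝ f z := (hf.contDiffAt (hU.mem_nhds hz)).differentiableAt (by simp)
  have hd2 {f : Cn n → ℝ} (hf : ContDiffOn ℝ ∞ f U) : DifferentiableAt ℝ (fderiv ℝ f) y :=
    ((hf.fderiv_of_isOpen (m := ∞) hU (by simp)).contDiffAt (hU.mem_nhds hy)).differentiableAt
      (by simp)
  have h : fderiv ℝ (fun z => f z + g z) =ᶠ[𝓝 y] fun z => fderiv ℝ f z + fderiv ℝ g z := by
    filter_upwards [hU.mem_nhds hy] with z hz
    exact fderiv_fun_add (hd hf hz) (hd hg hz)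
  funext p q
  simp only [hess, h.fderiv_eq, fderiv_fun_add (hd2 hf) (hd2 hg), add_apply, Pi.add_apply]
  ring

theorem hess_const_mul (c : ℝ) (f : Cn n → ℝ) (y : Cn n) :
    hess (fun z => c * f z) y = c • hess f y := by
  have h1 : fderiv ℝ (fun z => c * f z) = fun z => c • fderiv ℝ f z :=
    fderiv_const_smul_field (𝕜 := ℝ) (f := f) c
  have h2 : fderiv ℝ (fun z => c • fderiv ℝ f z) y = c • fderiv ℝ (fderiv ℝ f) y :=
    congrFun (fderiv_const_smul_field (𝕜 := ℝ) (f := fderiv ℝ f) c) y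
  funext p q
  simp only [hess, h1, h2, smul_apply, Pi.smul_apply, smul_eq_mul]
  ring

variable [T2Space X] [CompactSpace X]

variable (n) in
/-- The functions of the partition of unity used to integrate. -/
def pou (i : X) : X → ℝ := chartPartition n X i

theorem tsupport_pou (i : X) : tsupport (pou n i) ⊆ (chartAt (Cn n) i).source :=
  (SmoothPartitionOfUnity.exists_isSubordinate_chartAt_source 𝓘(ℝ, Cn n) X).choose_spec i

theorem chartSmooth_pou (i : X) : ChartSmooth n (pou n i) :=
  chartSmooth_of_contMDiff (chartPartition n X i).contMDiff

theorem finite_pou : {i : X | (Function.support (pou n i)).Nonempty}.Finite :=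
  (chartPartition n X).locallyFinite.finite_nonempty_of_compact

variable (n X) in
/-- The finitely many indices whose partition function does not vanish identically. -/
def idxSet : Finset X := (finite_pou (n := n) (X := X)).toFinset

theorem pou_eq_zero {i : X} (hi : i ∉ idxSet n X) : pou n i = 0 := by
  simpa [idxSet] using hi

theorem sum_pou (x : X) : ∑ i ∈ idxSet n X, pou n i x = 1 := by
  rw [← (chartPartition n X).sum_eq_one (Set.mem_univ x)]
  refine (finsum_eq_sum_of_support_subset _ fun i hi => ?_).symm
  by_contra h
  exact hi (congrFun (pou_eq_zero h) x)

variable (n) in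
/-- The weights `ρᵢ` in the chart at `i`. -/
def wt (i : X) (y : Cn n) : ℝ := pou n i ((chartAt (Cn n) i).symm y)

variable (n) in
/-- The support of `ρᵢ` in the chart at `i`. -/
def wtSupp (i : X) : Set (Cn n) := chartAt (Cn n) i '' tsupport (pou n i)

theorem isCompact_wtSupp (i : X) : IsCompact (wtSupp n i) :=
  (isClosed_tsupport _).isCompact.image_of_continuousOn
    ((chartAt (Cn n) i).continuousOn.mono (tsupport_pou i))

theorem wtSupp_subset (i : X) : wtSupp n i ⊆ (chartAt (Cn n) i).target := by
  rintro _ ⟨x, hx, rfl⟩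
  exact (chartAt (Cn n) i).map_source (tsupport_pou i hx)

theorem wt_eq_zero {i : X} {y : Cn n} (hy : y ∈ (chartAt (Cn n) i).target) (h : y ∉ wtSupp n i) :
    wt n i y = 0 := by
  by_contra h1
  exact h ⟨_, subset_tsupport _ h1, (chartAt (Cn n) i).right_inv hy⟩

theorem contDiffOn_wt (i : X) : ContDiffOn ℝ ∞ (wt n i) (chartAt (Cn n) i).target :=
  chartSmooth_pou i _ (chart_mem_atlas _ i)

theorem integral_eq_sum_target (η : DForm n X (Fin n × Fin 2)) :
    integral η = ∑ i ∈ idxSet n X,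
      ∫ y in (chartAt (Cn n) i).target, wt n i y * topCoeff (chartAt (Cn n) i) η y := by
  refine finsum_eq_sum_of_support_subset _ fun i hi => ?_
  by_contra h
  refine hi ?_
  have : ∀ x, chartPartition n X i x = 0 := fun x => congrFun (pou_eq_zero h) x
  simp [this]

theorem integral_eq_sum (η : DForm n X (Fin n × Fin 2)) :
    integral η = ∑ i ∈ idxSet n X,
      ∫ y in wtSupp n i, wt n i y * topCoeff (chartAt (Cn n) i) η y := by
  rw [integral_eq_sum_target]
  refine Finset.sum_congr rfl fun i _ => ?_
  refine setIntegral_eq_of_subset_of_forall_sdiff_eq_zero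
    (chartAt (Cn n) i).open_target.measurableSet (wtSupp_subset i) fun y hy => ?_
  rw [wt_eq_zero hy.1 hy.2, zero_mul]

/-- Forms of top degree with continuous coefficients in charts. -/
def ContTop (η : DForm n X (Fin n × Fin 2)) : Prop :=
  ∀ e ∈ atlas (Cn n) X, ContinuousOn (topCoeff e η) e.target

theorem integral_congr {η θ : DForm n X (Fin n × Fin 2)}
    (h : ∀ e ∈ atlas (Cn n) X, ∀ y ∈ e.target, topCoeff e η y = topCoeff e θ y) :
    integral η = integral θ := by
  rw [integral_eq_sum_target, integral_eq_sum_target]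
  refine Finset.sum_congr rfl fun i _ => setIntegral_congr_fun
    (chartAt (Cn n) i).open_target.measurableSet fun y hy => ?_
  simp only [h _ (chart_mem_atlas _ i) y hy]

theorem integrableOn_wtSupp {η : DForm n X (Fin n × Fin 2)} (hη : ContTop η) (i : X) :
    IntegrableOn (fun y => wt n i y * topCoeff (chartAt (Cn n) i) η y) (wtSupp n i) :=
  (((contDiffOn_wt i).continuousOn.mul (hη _ (chart_mem_atlas _ i))).mono
    (wtSupp_subset i)).integrableOn_compact (isCompact_wtSupp i)

theorem integral_add_form {η θ : DForm n X (Fin n × Fin 2)} (hη : ContTop η) (hθ : ContTop θ) :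
    integral (η + θ) = integral η + integral θ := by
  simp only [integral_eq_sum, ← Finset.sum_add_distrib, topCoeff_add, mul_add]
  exact Finset.sum_congr rfl fun i _ => integral_add (integrableOn_wtSupp hη i) (integrableOn_wtSupp hθ i)

theorem integral_const_smul (c : ℝ) (η : DForm n X (Fin n × Fin 2)) :
    integral (c • η) = c * integral η := by
  simp only [integral_eq_sum, topCoeff_const_smul, Finset.mul_sum, ← integral_const_mul]
  refine Finset.sum_congr rfl fun i _ => ?_
  congr 1
  funext y
  ring

/-- The integral of a form supported in one chart can be computed in this chart, as the transition
maps are holomorphic and so preserve the orientation. -/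
theorem integral_eq_setIntegral_chart {η : DForm n X (Fin n × Fin 2)} (hη : ContTop η) (j : X)
    {S : Set X} (hS : IsCompact S) (hSj : S ⊆ (chartAt (Cn n) j).source)
    (h0 : ∀ e ∈ atlas (Cn n) X, ∀ y ∈ e.target, e.symm y ∉ S → topCoeff e η y = 0) :
    integral η = ∫ y in (chartAt (Cn n) j).target, topCoeff (chartAt (Cn n) j) η y := by
  set ej := chartAt (Cn n) j with hej
  have haj : ej ∈ atlas (Cn n) X := chart_mem_atlas _ j
  -- each summand is moved to the chart at `j`; the weights then add up to one
  have hmove (i : X) : ∫ y in (chartAt (Cn n) i).target,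
      wt n i y * topCoeff (chartAt (Cn n) i) η y =
      ∫ y in ej.target, pou n i (ej.symm y) * topCoeff ej η y := by
    set ei := chartAt (Cn n) i with hei
    have hai : ei ∈ atlas (Cn n) X := chart_mem_atlas _ i
    have hopen (e e' : OpenPartialHomeomorph X (Cn n)) :
        MeasurableSet (e.target ∩ e.symm ⁻¹' e'.source) :=
      (e.symm.isOpen_inter_preimage e'.open_source).measurableSet
    have himg : ei.target ∩ ei.symm ⁻¹' ej.source =
        (ei ∘ ej.symm) '' (ej.target ∩ ej.symm ⁻¹' ei.source) := by
      ext y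
      constructor
      · rintro ⟨hy, hy'⟩
        refine ⟨ej (ei.symm y), ⟨ej.map_source hy', ?_⟩, ?_⟩
        · simp only [Set.mem_preimage, ej.left_inv hy']
          exact ei.map_target hy
        · simp only [Function.comp_apply, ej.left_inv hy', ei.right_inv hy]
      · rintro ⟨z, ⟨hz, hz'⟩, rfl⟩
        refine ⟨ei.map_source hz', ?_⟩
        simp only [Set.mem_preimage, Function.comp_apply, ei.left_inv hz']
        exact ej.map_target hz
    rw [setIntegral_eq_of_subset_of_forall_sdiff_eq_zero ei.open_target.measurableSet
        (Set.inter_subset_left (t := ei.symm ⁻¹' ej.source)),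
      setIntegral_eq_of_subset_of_forall_sdiff_eq_zero ej.open_target.measurableSet
        (Set.inter_subset_left (t := ej.symm ⁻¹' ei.source)), himg,
      integral_image_eq_integral_abs_det_fderiv_smul volume (hopen ej ei)
        (f' := fderiv ℝ (ei ∘ ej.symm))]
    · refine setIntegral_congr_fun (hopen ej ei) fun y hy => ?_
      have h1 : ei.symm (ei (ej.symm y)) = ej.symm y := ei.left_inv hy.2
      simp only [topCoeff_change η haj hai hy.1 hy.2, wt, ← hei, Function.comp_apply, h1,
        smul_eq_mul]
      ring
    · intro y hy
      exact ((contDiffAt_transition_real haj hai hy.1 hy.2).differentiableAt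
        (by simp)).hasFDerivAt.hasFDerivWithinAt
    · intro y hy z hz h
      have h1 := ei.injOn hy.2 hz.2 h
      exact ej.symm.injOn hy.1 hz.1 h1
    · rintro y ⟨hy, hy'⟩
      have : pou n i (ej.symm y) = 0 := by
        by_contra h
        exact hy' ⟨hy, tsupport_pou i (subset_tsupport _ h)⟩
      rw [this, zero_mul]
    · rintro y ⟨hy, hy'⟩
      rw [h0 ei hai y hy fun h => hy' ⟨hy, hSj h⟩, mul_zero]
  rw [integral_eq_sum_target, Finset.sum_congr rfl fun i _ => hmove i, ← integral_finsetSum]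
  · congr 1
    funext y
    rw [← Finset.sum_mul, sum_pou, one_mul]
  · intro i _
    refine integrableOn_of_eq_zero_off_compact ej.open_target
      (hS.image_of_continuousOn (ej.continuousOn.mono hSj)) ?_
      ((chartSmooth_pou i ej haj).continuousOn.mul (hη ej haj)) ?_
    · rintro _ ⟨x, hx, rfl⟩
      exact ej.map_source (hSj hx)
    · intro y hy hyS
      rw [h0 ej haj y hy fun h => hyS ⟨_, h, ej.right_inv hy⟩, mul_zero]

/-! ### Green's formula on a compact manifold -/

/-- The form `u ddᶜv ∧ αⁿ⁻¹ - v ddᶜu ∧ αⁿ⁻¹`. -/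
def greenForm (α : DForm n X (Fin 2)) (u v : X → ℝ) : DForm n X (Fin n × Fin 2) :=
  (fun x => u x • wedgePowOne (ddc v) α x) - fun x => v x • wedgePowOne (ddc u) α x

omit [T2Space X] [CompactSpace X] in
theorem topCoeff_smul_wedgePowOne_ddc (α : DForm n X (Fin 2)) (u : X → ℝ) {v : X → ℝ}
    (hv : ChartSmooth n v) {e : OpenPartialHomeomorph X (Cn n)}
    (he : e ∈ atlas (Cn n) X) {y : Cn n} (hy : y ∈ e.target) :
    topCoeff e (fun x => u x • wedgePowOne (ddc v) α x) y =
      u (e.symm y) * pfOne (hess (v ∘ e.symm) y) (coeffs (inChart e α y)) := by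
  rw [topCoeff_smul, topCoeff_wedgePowOne, coeffs_ddc hv he hy]

omit [T2Space X] [CompactSpace X] in
theorem contTop_smul_wedgePowOne_ddc {α : DForm n X (Fin 2)}
    (hα : ∀ e ∈ atlas (Cn n) X, ClosedInvOn (fun y => coeffs (inChart e α y)) e.target)
    {u v : X → ℝ} (hu : ChartSmooth n u) (hv : ChartSmooth n v) :
    ContTop fun x => u x • wedgePowOne (ddc v) α x := fun e he =>
  ((hu e he).continuousOn.mul (continuous_pfOne.comp_continuousOn
    ((contDiffOn_hess e.open_target (hv e he)).continuousOn.prodMk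
      (hα e he).smooth.continuousOn))).congr
    fun _ hy => topCoeff_smul_wedgePowOne_ddc α u hv he hy

/-- Green's formula: by linearity in `v` and a partition of unity, `v` may be supported in a chart
domain, where the flat formula applies. -/
theorem integral_greenForm (i₀ : Fin n) (h₀ : (i₀ : ℕ) = 0) {α : DForm n X (Fin 2)}
    (hα : ∀ e ∈ atlas (Cn n) X, ClosedInvOn (fun y => coeffs (inChart e α y)) e.target)
    {u v : X → ℝ} (hu : ChartSmooth n u) (hv : ChartSmooth n v) :
    integral (greenForm α u v) = 0 := by
  have hform {v : X → ℝ} (hv : ChartSmooth n v) {e : OpenPartialHomeomorph X (Cn n)}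
      (he : e ∈ atlas (Cn n) X) {y : Cn n} (hy : y ∈ e.target) : topCoeff e (greenForm α u v) y =
      (u ∘ e.symm) y * pfOne (hess (v ∘ e.symm) y) (coeffs (inChart e α y)) -
        (v ∘ e.symm) y * pfOne (hess (u ∘ e.symm) y) (coeffs (inChart e α y)) := by
    rw [greenForm, topCoeff_sub, topCoeff_smul_wedgePowOne_ddc α u hv he hy,
      topCoeff_smul_wedgePowOne_ddc α v hu he hy]
    rfl
  have hcont {v : X → ℝ} (hv : ChartSmooth n v) : ContTop (greenForm α u v) := fun e he =>
    (contTop_smul_wedgePowOne_ddc hα hu hv e he).sub (contTop_smul_wedgePowOne_ddc hα hv hu e he)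
  have hlocal (j : X) : integral (greenForm α u fun x => pou n j x * v x) = 0 := by
    have hs := (chartSmooth_pou j).mul hv
    have ha := chart_mem_atlas (Cn n) j
    have hz {e : OpenPartialHomeomorph X (Cn n)} {y : Cn n} (hy : y ∈ e.target)
        (h : e.symm y ∉ tsupport (pou n j)) :
        (fun x => pou n j x * v x) ∘ e.symm =ᶠ[𝓝 y] fun _ => 0 := by
      filter_upwards [(e.continuousAt_symm hy).eventually
        ((isClosed_tsupport _).isOpen_compl.mem_nhds h)] with z hz
      simp [image_eq_zero_of_notMem_tsupport hz]
    rw [integral_eq_setIntegral_chart (hcont hs) j (isClosed_tsupport _).isCompact (tsupport_pou j)]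
    · rw [← setIntegral_green (chartAt (Cn n) j).open_target (isCompact_wtSupp j) (wtSupp_subset j)
        i₀ h₀ (hα _ ha) (hu _ ha) (hs _ ha) ?_]
      · exact setIntegral_congr_fun (chartAt (Cn n) j).open_target.measurableSet
          fun y hy => hform hs ha hy
      · intro y hy hyK
        exact (hz hy fun h => hyK ⟨_, h, (chartAt (Cn n) j).right_inv hy⟩).eq_of_nhds
    · intro e he y hy h
      rw [hform hs he hy, (hz hy h).eq_of_nhds]
      have h1 : fderiv ℝ ((fun x => pou n j x * v x) ∘ e.symm) =ᶠ[𝓝 y] fun _ => 0 := by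
        filter_upwards [(hz hy h).fderiv (𝕜 := ℝ)] with z hz
        rw [hz]
        simp
      have h2 : hess ((fun x => pou n j x * v x) ∘ e.symm) y = (0 : ℝ) • (0 : CMat n) := by
        funext p q
        simp [hess, h1.fderiv_eq]
      rw [h2, pfOne_smul i₀ h₀]
      ring
  have hsum (s : Finset X) : ChartSmooth n (fun x => ∑ j ∈ s, pou n j x * v x) ∧
      integral (greenForm α u fun x => ∑ j ∈ s, pou n j x * v x) = 0 := by
    classical
    induction s using Finset.induction_on with
    | empty =>
      have hs : ChartSmooth n (fun _ : X => (0 : ℝ)) := fun e he => contDiffOn_const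
      refine ⟨by simpa using hs, ?_⟩
      have h := integral_const_smul 0 (greenForm α u fun _ => 0)
      rw [zero_mul] at h
      refine Eq.trans (integral_congr fun e he y hy => ?_) h
      simp only [Finset.sum_empty]
      rw [topCoeff_const_smul, hform hs he hy]
      have h2 : hess ((fun _ : X => (0 : ℝ)) ∘ e.symm) y = (0 : ℝ) • (0 : CMat n) := by
        funext p q
        have : fderiv ℝ ((fun _ : X => (0 : ℝ)) ∘ e.symm) = 0 := by
          funext z
          exact fderiv_const_apply (0 : ℝ)
        simp [hess, this]
      rw [h2, pfOne_smul i₀ h₀]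
      simp
    | insert j s hj ih =>
      have hs := (chartSmooth_pou j).mul hv
      refine ⟨?_, ?_⟩
      · simpa only [Finset.sum_insert hj] using hs.add ih.1
      · have h := integral_add_form (hcont hs) (hcont ih.1)
        rw [hlocal j, ih.2, add_zero] at h
        refine Eq.trans (integral_congr fun e he y hy => ?_) h
        have hfun : (fun x => ∑ k ∈ insert j s, pou n k x * v x) =
            fun x => pou n j x * v x + ∑ k ∈ s, pou n k x * v x := by
          funext x
          rw [Finset.sum_insert hj]
        rw [hfun, topCoeff_add, hform (hs.add ih.1) he hy, hform hs he hy, hform ih.1 he hy]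
        have hh := hess_add e.open_target (hs e he) (ih.1 e he) hy
        have hh' : hess ((fun x => pou n j x * v x + ∑ k ∈ s, pou n k x * v x) ∘ e.symm) y =
          hess ((fun x => pou n j x * v x) ∘ e.symm) y +
            hess ((fun x => ∑ k ∈ s, pou n k x * v x) ∘ e.symm) y := hh
        rw [hh', pfOne_add i₀ h₀]
        simp only [Function.comp_apply]
        ring
  have h := (hsum (idxSet n X)).2
  have hfun : (fun x => ∑ j ∈ idxSet n X, pou n j x * v x) = v := by
    funext x
    rw [← Finset.sum_mul, sum_pou, one_mul]
  rwa [hfun] at h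

end

end

section

open MeasureTheory Finset

variable {n : ℕ}

/-! ### Functions depending on parameters -/

section Parameters

variable {P : Type*} [NormedAddCommGroup P] [NormedSpace ℝ P] {Q : Set P} {U : Set (Cn n)}

theorem hasFDerivAt_slice (hU : IsOpen U) {G : Type*} [NormedAddCommGroup G] [NormedSpace ℝ G]
    {F : P × Cn n → G} {q : P} (hq : q ∈ Q) {y : Cn n} (hy : y ∈ U)
    (hF : DifferentiableWithinAt ℝ F (Q ×ˢ U) (q, y)) :
    HasFDerivAt (fun z => F (q, z))
      ((fderivWithin ℝ F (Q ×ˢ U) (q, y)).comp (ContinuousLinearMap.inr ℝ P (Cn n))) y := by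
  have h := hF.hasFDerivWithinAt.comp y (s := U)
    (hasFDerivAt_prodMk_right q y).hasFDerivWithinAt fun z hz => ⟨hq, hz⟩
  exact h.hasFDerivAt (hU.mem_nhds hy)

/-- Derivatives in the space direction depend smoothly on parameters. -/
theorem contDiffOn_fderiv_slice (hQ : UniqueDiffOn ℝ Q) (hU : IsOpen U) {F : P × Cn n → ℝ}
    (hF : ContDiffOn ℝ ∞ F (Q ×ˢ U)) (v : Cn n) :
    ContDiffOn ℝ ∞ (fun p : P × Cn n => fderiv ℝ (fun z => F (p.1, z)) p.2 v) (Q ×ˢ U) := by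
  have h := hF.fderivWithin (m := ∞) (hQ.prod hU.uniqueDiffOn) (by simp)
  refine (h.clm_apply (contDiffOn_const (c := ((0, v) : P × Cn n)))).congr fun p hp => ?_
  rw [(hasFDerivAt_slice hU hp.1 hp.2 (hF.differentiableOn (by simp) p hp)).fderiv]
  rfl

theorem contDiffOn_slice {F : P × Cn n → ℝ} (hF : ContDiffOn ℝ ∞ F (Q ×ˢ U)) {q : P} (hq : q ∈ Q) :
    ContDiffOn ℝ ∞ (fun z => F (q, z)) U :=
  hF.comp (contDiff_prodMk_right q).contDiffOn fun _ hz => ⟨hq, hz⟩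

theorem fderiv_fderiv_apply {f : Cn n → ℝ} {y : Cn n} (hf : ContDiffAt ℝ ∞ f y) (v w : Cn n) :
    fderiv ℝ (fderiv ℝ f) y v w = fderiv ℝ (fun z => fderiv ℝ f z w) y v := by
  have h1 : DifferentiableAt ℝ (fderiv ℝ f) y :=
    (hf.fderiv_right (m := ∞) (by simp)).differentiableAt (by simp)
  rw [(h1.hasFDerivAt.clm_apply (hasFDerivAt_const w y)).fderiv]
  simp

theorem contDiffOn_hess_slice (hQ : UniqueDiffOn ℝ Q) (hU : IsOpen U) {F : P × Cn n → ℝ}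
    (hF : ContDiffOn ℝ ∞ F (Q ×ˢ U)) :
    ContDiffOn ℝ ∞ (fun p : P × Cn n => hess (fun z => F (p.1, z)) p.2) (Q ×ˢ U) := by
  have h2 (v w : Cn n) : ContDiffOn ℝ ∞ (fun p : P × Cn n =>
      fderiv ℝ (fderiv ℝ fun z => F (p.1, z)) p.2 v w) (Q ×ˢ U) := by
    refine (contDiffOn_fderiv_slice hQ hU (contDiffOn_fderiv_slice hQ hU hF w) v).congr
      fun p hp => ?_
    exact fderiv_fderiv_apply ((contDiffOn_slice hF hp.1).contDiffAt (hU.mem_nhds hp.2)) v w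
  exact contDiffOn_pi.2 fun p => contDiffOn_pi.2 fun q =>
    contDiffOn_const.mul ((h2 _ _).sub (h2 _ _))

theorem hasDerivWithinAt_curve {G : Type*} [NormedAddCommGroup G] [NormedSpace ℝ G]
    {F : P × Cn n → G} {γ : ℝ → P} {w : P} {T : Set ℝ} {t : ℝ} {y : Cn n}
    (hγ : HasDerivWithinAt γ w T t) (hT : Set.MapsTo γ T Q) (hy : y ∈ U)
    (hF : DifferentiableWithinAt ℝ F (Q ×ˢ U) (γ t, y)) :
    HasDerivWithinAt (fun τ => F (γ τ, y)) (fderivWithin ℝ F (Q ×ˢ U) (γ t, y) (w, 0)) T t := by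
  have h : HasDerivWithinAt (fun τ => (γ τ, y)) (w, 0) T t :=
    hγ.prodMk (hasDerivWithinAt_const t T y)
  exact hF.hasFDerivWithinAt.comp_hasDerivWithinAt t h
    (show Set.MapsTo (fun τ => (γ τ, y)) T (Q ×ˢ U) from fun τ hτ => ⟨hT hτ, hy⟩)

end Parameters

/-! ### Functions depending on time -/

/-- The time derivative of a function on `[0, 1] × ℂⁿ`. -/
def dt (F : ℝ × Cn n → ℝ) (p : ℝ × Cn n) : ℝ :=
  derivWithin (fun τ => F (τ, p.2)) (Set.Icc 0 1) p.1

section Time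

variable {U : Set (Cn n)} {F : ℝ × Cn n → ℝ}

theorem uniqueDiffOn_unitInterval : UniqueDiffOn ℝ (Set.Icc (0 : ℝ) 1) :=
  uniqueDiffOn_Icc zero_lt_one

theorem hasDerivWithinAt_time (hF : ContDiffOn ℝ ∞ F (Set.Icc 0 1 ×ˢ U)) {t : ℝ}
    (ht : t ∈ Set.Icc (0 : ℝ) 1) {y : Cn n} (hy : y ∈ U) :
    HasDerivWithinAt (fun τ => F (τ, y)) (fderivWithin ℝ F (Set.Icc 0 1 ×ˢ U) (t, y) (1, 0))
      (Set.Icc 0 1) t :=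
  hasDerivWithinAt_curve (hasDerivWithinAt_id t _) (fun _ h => h) hy
    (hF.differentiableOn (by simp) (t, y) ⟨ht, hy⟩)

theorem dt_eq (hF : ContDiffOn ℝ ∞ F (Set.Icc 0 1 ×ˢ U)) {t : ℝ}
    (ht : t ∈ Set.Icc (0 : ℝ) 1) {y : Cn n} (hy : y ∈ U) :
    dt F (t, y) = fderivWithin ℝ F (Set.Icc 0 1 ×ˢ U) (t, y) (1, 0) :=
  (hasDerivWithinAt_time hF ht hy).derivWithin (uniqueDiffOn_unitInterval t ht)

theorem hasDerivWithinAt_dt (hF : ContDiffOn ℝ ∞ F (Set.Icc 0 1 ×ˢ U)) {t : ℝ}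
    (ht : t ∈ Set.Icc (0 : ℝ) 1) {y : Cn n} (hy : y ∈ U) :
    HasDerivWithinAt (fun τ => F (τ, y)) (dt F (t, y)) (Set.Icc 0 1) t := by
  rw [dt_eq hF ht hy]
  exact hasDerivWithinAt_time hF ht hy

theorem contDiffOn_dt (hU : IsOpen U) (hF : ContDiffOn ℝ ∞ F (Set.Icc 0 1 ×ˢ U)) :
    ContDiffOn ℝ ∞ (dt F) (Set.Icc 0 1 ×ˢ U) := by
  have h := hF.fderivWithin (m := ∞) (uniqueDiffOn_unitInterval.prod hU.uniqueDiffOn) (by simp)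
  exact (h.clm_apply (contDiffOn_const (c := ((1, 0) : ℝ × Cn n)))).congr
    fun p hp => dt_eq hF hp.1 hp.2

/-- Time and space derivatives commute. -/
theorem dt_fderiv_slice (hU : IsOpen U) (hF : ContDiffOn ℝ ∞ F (Set.Icc 0 1 ×ˢ U)) {t : ℝ}
    (ht : t ∈ Set.Icc (0 : ℝ) 1) {y : Cn n} (hy : y ∈ U) (v : Cn n) :
    dt (fun p => fderiv ℝ (fun z => F (p.1, z)) p.2 v) (t, y) =
      fderiv ℝ (fun z => dt F (t, z)) y v := by
  set D := Set.Icc (0 : ℝ) 1 ×ˢ U with hD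
  have hp : (t, y) ∈ D := ⟨ht, hy⟩
  have hDu : UniqueDiffOn ℝ D := uniqueDiffOn_unitInterval.prod hU.uniqueDiffOn
  have h2 : DifferentiableWithinAt ℝ (fderivWithin ℝ F D) D (t, y) :=
    (hF.fderivWithin (m := ∞) hDu (by simp)).differentiableOn (by simp) _ hp
  have hev (u : ℝ × Cn n) : HasFDerivWithinAt (fun p => fderivWithin ℝ F D p u)
      ((fderivWithin ℝ (fderivWithin ℝ F D) D (t, y)).flip u) D (t, y) := by
    have := h2.hasFDerivWithinAt.clm_apply (hasFDerivWithinAt_const u (t, y) D)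
    refine this.congr_fderiv ?_
    ext <;> simp
  have hsymm : IsSymmSndFDerivWithinAt ℝ F D (t, y) := by
    refine (hF (t, y) hp).isSymmSndFDerivWithinAt (by simpa using ENat.LEInfty.out) hDu ?_ hp
    rw [hD, interior_prod_eq, closure_prod_eq, interior_Icc, closure_Ioo zero_ne_one,
      hU.interior_eq]
    exact ⟨ht, subset_closure hy⟩
  rw [dt_eq (contDiffOn_fderiv_slice uniqueDiffOn_unitInterval hU hF v) ht hy,
    (hasFDerivAt_slice hU ht hy ((contDiffOn_dt hU hF).differentiableOn (by simp) _ hp)).fderiv]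
  have e1 : fderivWithin ℝ (fun p : ℝ × Cn n => fderiv ℝ (fun z => F (p.1, z)) p.2 v) D (t, y) =
      (fderivWithin ℝ (fderivWithin ℝ F D) D (t, y)).flip (0, v) := by
    refine HasFDerivWithinAt.fderivWithin ((hev (0, v)).congr (fun p hp => ?_) ?_) (hDu _ hp)
    · rw [(hasFDerivAt_slice hU hp.1 hp.2 (hF.differentiableOn (by simp) p hp)).fderiv]
      rfl
    · rw [(hasFDerivAt_slice hU ht hy (hF.differentiableOn (by simp) _ hp)).fderiv]
      rfl
  have e2 : fderivWithin ℝ (dt F) D (t, y) =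
      (fderivWithin ℝ (fderivWithin ℝ F D) D (t, y)).flip (1, 0) :=
    HasFDerivWithinAt.fderivWithin ((hev (1, 0)).congr (fun p hp => dt_eq hF hp.1 hp.2)
      (dt_eq hF ht hy)) (hDu _ hp)
  rw [e1, e2]
  exact hsymm (1, 0) (0, v)

/-- The time derivative of `ddᶜF` is `ddᶜ` of the time derivative of `F`. -/
theorem hasDerivWithinAt_hess (hU : IsOpen U) (hF : ContDiffOn ℝ ∞ F (Set.Icc 0 1 ×ˢ U)) {t : ℝ}
    (ht : t ∈ Set.Icc (0 : ℝ) 1) {y : Cn n} (hy : y ∈ U) :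
    HasDerivWithinAt (fun τ => hess (fun z => F (τ, z)) y) (hess (fun z => dt F (t, z)) y)
      (Set.Icc 0 1) t := by
  have key (v w : Cn n) : HasDerivWithinAt
      (fun τ => fderiv ℝ (fderiv ℝ fun z => F (τ, z)) y v w)
      (fderiv ℝ (fderiv ℝ fun z => dt F (t, z)) y v w) (Set.Icc 0 1) t := by
    have hG := contDiffOn_fderiv_slice uniqueDiffOn_unitInterval hU hF w
    have h1 := hasDerivWithinAt_dt (contDiffOn_fderiv_slice uniqueDiffOn_unitInterval hU hG v)
      ht hy
    rw [dt_fderiv_slice hU hG ht hy v] at h1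
    have h2 : (fun z => dt (fun p => fderiv ℝ (fun z => F (p.1, z)) p.2 w) (t, z)) =ᶠ[𝓝 y]
        fun z => fderiv ℝ (fun z => dt F (t, z)) z w := by
      filter_upwards [hU.mem_nhds hy] with z hz
      exact dt_fderiv_slice hU hF ht hz w
    rw [h2.fderiv_eq, ← fderiv_fderiv_apply
      ((contDiffOn_slice (contDiffOn_dt hU hF) ht).contDiffAt (hU.mem_nhds hy))] at h1
    refine h1.congr_of_mem (fun τ hτ => ?_) ht
    exact fderiv_fderiv_apply ((contDiffOn_slice hF hτ).contDiffAt (hU.mem_nhds hy)) v w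
  exact hasDerivWithinAt_pi.2 fun p => hasDerivWithinAt_pi.2 fun q =>
    ((key _ _).sub (key _ _)).const_mul _

end Time

/-! ### Integrals over space-time -/

section SpaceTime

variable {X : Type*} [TopologicalSpace X] [ChartedSpace (Cn n) X] [IsManifold 𝓘(ℂ, Cn n) ω X]
  [T2Space X] [CompactSpace X]

theorem continuousOn_setIntegral {K : Set (Cn n)} (hK : IsCompact K) {f : ℝ × Cn n → ℝ}
    (hf : ContinuousOn f (Set.Icc 0 1 ×ˢ K)) :
    ContinuousOn (fun t => ∫ y in K, f (t, y)) (Set.Icc 0 1) := by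
  obtain ⟨C, hC⟩ := (isCompact_Icc.prod hK).exists_bound_of_continuousOn hf
  refine continuousOn_of_dominated (bound := fun _ => C) (fun t ht => ?_) (fun t ht => ?_) ?_ ?_
  · exact (hf.comp (by fun_prop) fun z hz => ⟨ht, hz⟩).aestronglyMeasurable hK.measurableSet
  · exact (ae_restrict_iff' hK.measurableSet).2 (.of_forall fun y hy => hC _ ⟨ht, hy⟩)
  · exact integrableOn_const hK.measure_ne_top
  · exact (ae_restrict_iff' hK.measurableSet).2 (.of_forall fun y hy =>
      hf.comp (by fun_prop) fun z hz => ⟨hz, hy⟩)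

theorem intervalIntegral_setIntegral_swap {K : Set (Cn n)} (hK : IsCompact K) {f : ℝ × Cn n → ℝ}
    (hf : ContinuousOn f (Set.Icc 0 1 ×ˢ K)) :
    ∫ t in (0 : ℝ)..1, ∫ y in K, f (t, y) = ∫ y in K, ∫ t in (0 : ℝ)..1, f (t, y) := by
  refine intervalIntegral_integral_swap ?_
  rw [Set.uIoc_of_le zero_le_one, Measure.prod_restrict]
  exact (hf.integrableOn_compact (isCompact_Icc.prod hK)).mono_set
    (Set.prod_mono Set.Ioc_subset_Icc_self subset_rfl)

/-- The integral over `X` of a top degree form with given coefficients in the charts. -/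
def spInt (g : X → Cn n → ℝ) : ℝ :=
  ∑ i ∈ idxSet n X, ∫ y in wtSupp n i, wt n i y * g i y

/-- The integral over `[0, 1] × X` of a family of top degree forms with given coefficients. -/
def stInt (f : X → ℝ → Cn n → ℝ) : ℝ := ∫ t in (0 : ℝ)..1, spInt fun i => f i t

/-- Continuity on `[0, 1] × X` of a family of coefficients. -/
def ContST {G : Type*} [TopologicalSpace G] (f : X → ℝ → Cn n → G) : Prop :=
  ∀ i, ContinuousOn (fun p : ℝ × Cn n => f i p.1 p.2)
    (Set.Icc 0 1 ×ˢ (chartAt (Cn n) i).target)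

theorem ContST.wt_mul {f : X → ℝ → Cn n → ℝ} (hf : ContST f) (i : X) :
    ContinuousOn (fun p : ℝ × Cn n => wt n i p.2 * f i p.1 p.2) (Set.Icc 0 1 ×ˢ wtSupp n i) :=
  (((contDiffOn_wt i).continuousOn.comp continuousOn_snd fun _ hp => hp.2).mul (hf i)).mono
    (Set.prod_mono subset_rfl (wtSupp_subset i))

theorem spInt_congr {g h : X → Cn n → ℝ}
    (H : ∀ i, ∀ y ∈ (chartAt (Cn n) i).target, g i y = h i y) : spInt g = spInt h := by
  refine Finset.sum_congr rfl fun i _ => setIntegral_congr_fun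
    (isCompact_wtSupp i).measurableSet fun y hy => ?_
  simp only [H i y (wtSupp_subset i hy)]

theorem stInt_congr {f g : X → ℝ → Cn n → ℝ}
    (H : ∀ i, ∀ t ∈ Set.Icc (0 : ℝ) 1, ∀ y ∈ (chartAt (Cn n) i).target, f i t y = g i t y) :
    stInt f = stInt g := by
  refine intervalIntegral.integral_congr fun t ht => ?_
  rw [Set.uIcc_of_le zero_le_one] at ht
  exact spInt_congr fun i y hy => H i t ht y hy

theorem ContST.continuousOn_spInt {f : X → ℝ → Cn n → ℝ} (hf : ContST f) :
    ContinuousOn (fun t => spInt fun i => f i t) (Set.Icc 0 1) :=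
  continuousOn_finsetSum _ fun i _ =>
    continuousOn_setIntegral (isCompact_wtSupp i) (hf.wt_mul i)

theorem ContST.intervalIntegrable {f : X → ℝ → Cn n → ℝ} (hf : ContST f) :
    IntervalIntegrable (fun t => spInt fun i => f i t) volume 0 1 :=
  ContinuousOn.intervalIntegrable
    (by simpa only [Set.uIcc_of_le zero_le_one] using hf.continuousOn_spInt)

theorem ContST.integrableOn_slice {f : X → ℝ → Cn n → ℝ} (hf : ContST f) {t : ℝ}
    (ht : t ∈ Set.Icc (0 : ℝ) 1) (i : X) :
    IntegrableOn (fun y => wt n i y * f i t y) (wtSupp n i) :=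
  ContinuousOn.integrableOn_compact (isCompact_wtSupp i)
    ((hf.wt_mul i).comp (f := fun y => (t, y)) (by fun_prop) fun z hz => ⟨ht, hz⟩)

theorem spInt_add {f g : X → ℝ → Cn n → ℝ} (hf : ContST f) (hg : ContST g) {t : ℝ}
    (ht : t ∈ Set.Icc (0 : ℝ) 1) :
    (spInt fun i y => f i t y + g i t y) = (spInt fun i => f i t) + spInt fun i => g i t := by
  simp only [spInt, ← Finset.sum_add_distrib, mul_add]
  exact Finset.sum_congr rfl fun i _ =>
    integral_add (hf.integrableOn_slice ht i) (hg.integrableOn_slice ht i)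

theorem stInt_add {f g : X → ℝ → Cn n → ℝ} (hf : ContST f) (hg : ContST g) :
    (stInt fun i t y => f i t y + g i t y) = stInt f + stInt g := by
  rw [stInt, stInt, stInt, ← intervalIntegral.integral_add hf.intervalIntegrable
    hg.intervalIntegrable]
  refine intervalIntegral.integral_congr fun t ht => ?_
  rw [Set.uIcc_of_le zero_le_one] at ht
  exact spInt_add hf hg ht

theorem spInt_const_mul (c : ℝ) (g : X → Cn n → ℝ) :
    (spInt fun i y => c * g i y) = c * spInt g := by
  simp only [spInt, Finset.mul_sum, ← integral_const_mul]
  refine Finset.sum_congr rfl fun i _ => ?_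
  congr 1
  funext y
  ring

theorem stInt_const_mul (c : ℝ) (f : X → ℝ → Cn n → ℝ) :
    (stInt fun i t y => c * f i t y) = c * stInt f := by
  simp only [stInt, spInt_const_mul, intervalIntegral.integral_const_mul]

omit [IsManifold 𝓘(ℂ, Cn n) ω X] [T2Space X] [CompactSpace X] in
theorem ContST.add {f g : X → ℝ → Cn n → ℝ} (hf : ContST f) (hg : ContST g) :
    ContST fun i t y => f i t y + g i t y := fun i => (hf i).add (hg i)

omit [IsManifold 𝓘(ℂ, Cn n) ω X] [T2Space X] [CompactSpace X] in
theorem ContST.sub {f g : X → ℝ → Cn n → ℝ} (hf : ContST f) (hg : ContST g) :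
    ContST fun i t y => f i t y - g i t y := fun i => (hf i).sub (hg i)

omit [IsManifold 𝓘(ℂ, Cn n) ω X] [T2Space X] [CompactSpace X] in
theorem ContST.mul {f g : X → ℝ → Cn n → ℝ} (hf : ContST f) (hg : ContST g) :
    ContST fun i t y => f i t y * g i t y := fun i => (hf i).mul (hg i)

omit [IsManifold 𝓘(ℂ, Cn n) ω X] [T2Space X] [CompactSpace X] in
theorem ContST.const_mul (c : ℝ) {f : X → ℝ → Cn n → ℝ} (hf : ContST f) :
    ContST fun i t y => c * f i t y := fun i => continuousOn_const.mul (hf i)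

theorem stInt_sub {f g : X → ℝ → Cn n → ℝ} (hf : ContST f) (hg : ContST g) :
    (stInt fun i t y => f i t y - g i t y) = stInt f - stInt g := by
  have h := stInt_add hf (hg.const_mul (-1))
  rw [stInt_const_mul] at h
  simp only [neg_one_mul, ← sub_eq_add_neg] at h
  exact h

/-- The integral over space-time of a time derivative. -/
theorem stInt_eq_zero_of_deriv {q q' : X → ℝ → Cn n → ℝ} (hq' : ContST q')
    (hd : ∀ i, ∀ t ∈ Set.Icc (0 : ℝ) 1, ∀ y ∈ (chartAt (Cn n) i).target,
      HasDerivWithinAt (fun τ => q i τ y) (q' i t y) (Set.Icc 0 1) t)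
    (h0 : ∀ i, ∀ y ∈ (chartAt (Cn n) i).target, q i 0 y = 0)
    (h1 : ∀ i, ∀ y ∈ (chartAt (Cn n) i).target, q i 1 y = 0) : stInt q' = 0 := by
  simp only [stInt, spInt]
  rw [intervalIntegral.integral_finsetSum]
  · refine Finset.sum_eq_zero fun i _ => ?_
    rw [intervalIntegral_setIntegral_swap (isCompact_wtSupp i)
      (f := fun p => wt n i p.2 * q' i p.1 p.2) (hq'.wt_mul i)]
    refine setIntegral_eq_zero_of_forall_eq_zero fun y hy => ?_
    have hy' := wtSupp_subset i hy
    have hc : ContinuousOn (fun t => q' i t y) (Set.Icc 0 1) :=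
      (hq' i).comp (f := fun t => (t, y)) (by fun_prop) fun z hz => ⟨hz, hy'⟩
    have := intervalIntegral.integral_eq_sub_of_hasDerivAt_of_le (zero_le_one (α := ℝ))
      (f := fun τ => q i τ y) (f' := fun t => q' i t y)
      (fun t ht => (hd i t ht y hy').continuousWithinAt)
      (fun t ht => (hd i t (Set.Ioo_subset_Icc_self ht) y hy').hasDerivAt
        (Icc_mem_nhds ht.1 ht.2))
      (ContinuousOn.intervalIntegrable (by simpa only [Set.uIcc_of_le zero_le_one] using hc))
    simp only [intervalIntegral.integral_const_mul, this, h0 i y hy', h1 i y hy']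
    simp
  · intro i _
    refine ContinuousOn.intervalIntegrable ?_
    rw [Set.uIcc_of_le zero_le_one]
    exact continuousOn_setIntegral (isCompact_wtSupp i) (hq'.wt_mul i)

/-- Space-time integrals are bounded by the supremum of the coefficients on the supports of the
weights. -/
theorem exists_stInt_le : ∃ M : ℝ, 0 ≤ M ∧ ∀ (f : X → ℝ → Cn n → ℝ) (C : ℝ),
    (∀ i ∈ idxSet n X, ∀ t ∈ Set.Icc (0 : ℝ) 1, ∀ y ∈ wtSupp n i, |f i t y| ≤ C) →
      |stInt f| ≤ M * C := by
  have hb (i : X) : ∃ B : ℝ, ∀ y ∈ wtSupp n i, ‖wt n i y‖ ≤ B :=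
    (isCompact_wtSupp i).exists_bound_of_continuousOn
      ((contDiffOn_wt i).continuousOn.mono (wtSupp_subset i))
  choose B hB using hb
  refine ⟨∑ i ∈ idxSet n X, |B i| * volume.real (wtSupp n i), by positivity, fun f C hf => ?_⟩
  have h : ‖stInt f‖ ≤ (∑ i ∈ idxSet n X, |B i| * volume.real (wtSupp n i)) * C * |(1 : ℝ) - 0| := by
    refine intervalIntegral.norm_integral_le_of_norm_le_const fun t ht => ?_
    rw [Set.uIoc_of_le zero_le_one] at ht
    rw [Finset.sum_mul]
    refine norm_sum_le_of_le _ fun i hi => ?_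
    have h1 := norm_setIntegral_le_of_norm_le_const (μ := volume) (f := fun y => wt n i y * f i t y)
      (C := |B i| * C) (isCompact_wtSupp i).measure_lt_top fun y hy => ?_
    · calc _ ≤ _ := h1
        _ = _ := by ring
    · rw [norm_mul]
      exact mul_le_mul ((hB i y hy).trans (le_abs_self _)) (hf i hi t ⟨ht.1.le, ht.2⟩ y hy)
        (norm_nonneg _) (abs_nonneg _)
  simpa using h

theorem integral_eq_spInt (η : DForm n X (Fin n × Fin 2)) :
    integral η = spInt fun i => topCoeff (chartAt (Cn n) i) η := integral_eq_sum η

end SpaceTime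

end

section

open MeasureTheory Finset

variable {n : ℕ}

/-! ### Derivatives of mixed products -/

theorem continuous_pfPow : Continuous (pfPow (n := n)) :=
  (pf n).cont.comp (continuous_pi fun _ => continuous_id)

theorem continuous_pfTwo : Continuous fun p : CMat n × CMat n × CMat n => pfTwo p.1 p.2.1 p.2.2 := by
  refine (pf n).cont.comp (continuous_pi fun i => ?_)
  split_ifs
  · exact continuous_fst
  · exact continuous_fst.comp continuous_snd
  · exact continuous_snd.comp continuous_snd

theorem hasFDerivAt_pfPow (A : CMat n) :
    HasFDerivAt (pfPow (n := n)) (((pf n).linearDeriv fun _ => A).comp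
      (ContinuousLinearMap.pi fun _ => ContinuousLinearMap.id ℝ (CMat n))) A :=
  ((pf n).hasFDerivAt fun _ => A).comp A
    (ContinuousLinearMap.pi fun _ => ContinuousLinearMap.id ℝ (CMat n)).hasFDerivAt

theorem hasDerivWithinAt_pfPow {A : ℝ → CMat n} {A' : CMat n} {T : Set ℝ} {t : ℝ}
    (hA : HasDerivWithinAt A A' T t) :
    HasDerivWithinAt (fun τ => pfPow (A τ)) (n * pfOne A' (A t)) T t := by
  have h := (hasFDerivAt_pfPow (A t)).comp_hasDerivWithinAt t hA
  refine h.congr_deriv ?_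
  rw [← sum_pf_update_const]
  exact ContinuousMultilinearMap.linearDeriv_apply _ _ _

theorem hasDerivWithinAt_pfOne {A B : ℝ → CMat n} {A' B' : CMat n} {T : Set ℝ} {t : ℝ}
    (hB : HasDerivWithinAt B B' T t) (hA : HasDerivWithinAt A A' T t) :
    HasDerivWithinAt (fun τ => n * pfOne (B τ) (A τ))
      (n * (pfOne B' (A t) + ((n : ℝ) - 1) * pfTwo (B t) A' (A t))) T t := by
  rcases Nat.eq_zero_or_pos n with rfl | hn
  · simpa using hasDerivWithinAt_const t T (0 : ℝ)
  · refine HasDerivWithinAt.const_mul _ ?_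
    have h0 : HasDerivWithinAt (fun τ => rowOne (B τ) (A τ)) (rowOne B' A') T t := by
      refine hasDerivWithinAt_pi.2 fun i => ?_
      unfold rowOne
      split_ifs
      · exact hB
      · exact hA
    have h := ((pf n).hasFDerivAt (rowOne (B t) (A t))).comp_hasDerivWithinAt t h0
    refine h.congr_deriv ?_
    rw [← sum_pf_update_one ⟨0, hn⟩ rfl]
    exact ContinuousMultilinearMap.linearDeriv_apply _ _ _

/-- The factor `n` makes the formula hold for `n = 0` too, where `pfOne` is the constant `1`. -/
theorem nat_mul_pfOne_smul_add (c : ℝ) (B C A : CMat n) :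
    n * pfOne (c • B + C) A = n * (c * pfOne B A + pfOne C A) := by
  rcases Nat.eq_zero_or_pos n with rfl | hn
  · simp
  · rw [pfOne_add ⟨0, hn⟩ rfl, pfOne_smul ⟨0, hn⟩ rfl]

/-- `½ ddᶜ(f²) = f ddᶜf + df ∧ dᶜf`. -/
theorem hess_half_sq {f : Cn n → ℝ} {U : Set (Cn n)} (hU : IsOpen U) (hf : ContDiffOn ℝ ∞ f U)
    {y : Cn n} (hy : y ∈ U) :
    hess (fun z => 1 / 2 * f z ^ 2) y = f y • hess f y + gradMat f f y := by
  have hd {z : Cn n} (hz : z ∈ U) : HasFDerivAt f (fderiv ℝ f z) z :=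
    ((hf.contDiffAt (hU.mem_nhds hz)).differentiableAt (by simp)).hasFDerivAt
  have hd2 : HasFDerivAt (fderiv ℝ f) _ y :=
    (((hf.fderiv_of_isOpen (m := ∞) hU (by simp)).contDiffAt (hU.mem_nhds hy)).differentiableAt
      (by simp)).hasFDerivAt
  have h : fderiv ℝ (fun z => 1 / 2 * f z ^ 2) =ᶠ[𝓝 y] fun z => f z • fderiv ℝ f z := by
    filter_upwards [hU.mem_nhds hy] with z hz
    rw [(((hd hz).pow 2).const_mul (1 / 2)).fderiv]
    ext v
    simp
    ring
  have h2 (v w : Cn n) : fderiv ℝ (fderiv ℝ fun z => 1 / 2 * f z ^ 2) y v w =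
      f y * fderiv ℝ (fderiv ℝ f) y v w + fderiv ℝ f y v * fderiv ℝ f y w := by
    have h3 : HasFDerivAt (fun z => f z • fderiv ℝ f z) _ y := (hd hy).smul hd2
    rw [h.fderiv_eq, h3.fderiv]
    simp
  funext p q
  simp only [hess, h2, Pi.add_apply, Pi.smul_apply, smul_eq_mul, gradMat, dcFlat_apply]
  ring

/-! ### Jets of paths -/

section Paths

variable {X : Type*} [TopologicalSpace X] [ChartedSpace (Cn n) X]

/-- A path of functions in a chart. -/
def rep (φ : ℝ → X → ℝ) (e : OpenPartialHomeomorph X (Cn n)) (p : ℝ × Cn n) : ℝ :=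
  φ p.1 (e.symm p.2)

variable (n) in
/-- Smoothness of a path of functions on `[0, 1] × X`, read in the charts of `X`. -/
def PathSmooth (φ : ℝ → X → ℝ) : Prop :=
  ∀ e ∈ atlas (Cn n) X, ContDiffOn ℝ ∞ (rep φ e) (Set.Icc 0 1 ×ˢ e.target)

theorem PathSmooth.dot {φ : ℝ → X → ℝ} (hφ : PathSmooth n φ) : PathSmooth n (dot φ) :=
  fun e he => contDiffOn_dt e.open_target (hφ e he)

theorem PathSmooth.chartSmooth {φ : ℝ → X → ℝ} (hφ : PathSmooth n φ) {t : ℝ}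
    (ht : t ∈ Set.Icc (0 : ℝ) 1) : ChartSmooth n (φ t) :=
  fun e he => contDiffOn_slice (hφ e he) ht

theorem PathSmooth.sub {φ ψ : ℝ → X → ℝ} (hφ : PathSmooth n φ) (hψ : PathSmooth n ψ) :
    PathSmooth n fun t x => φ t x - ψ t x := fun e he => (hφ e he).sub (hψ e he)

variable (n) in
/-- The values of a path in the preferred charts. -/
def val (φ : ℝ → X → ℝ) (i : X) (t : ℝ) (y : Cn n) : ℝ := φ t ((chartAt (Cn n) i).symm y)

/-- The coefficients of `ddᶜφ_t` in the preferred charts. -/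
def hs (φ : ℝ → X → ℝ) (i : X) (t : ℝ) (y : Cn n) : CMat n :=
  hess (φ t ∘ (chartAt (Cn n) i).symm) y

/-- The coefficients of `ω + ddᶜφ_t` in the preferred charts. -/
def KaehlerForm.mat (κ : KaehlerForm n X) (φ : ℝ → X → ℝ) (i : X) (t : ℝ) (y : Cn n) : CMat n :=
  coeffs (inChart (chartAt (Cn n) i) κ.form y) + hs φ i t y

/-- The coefficients of `dφ_t ∧ dᶜφ_t` in the preferred charts. -/
def gs (φ : ℝ → X → ℝ) (i : X) (t : ℝ) (y : Cn n) : CMat n :=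
  gradMat (φ t ∘ (chartAt (Cn n) i).symm) (φ t ∘ (chartAt (Cn n) i).symm) y

theorem PathSmooth.contST_val {φ : ℝ → X → ℝ} (hφ : PathSmooth n φ) : ContST (val n φ) :=
  fun i => (hφ _ (chart_mem_atlas _ i)).continuousOn

theorem PathSmooth.contST_hs {φ : ℝ → X → ℝ} (hφ : PathSmooth n φ) : ContST (hs (n := n) φ) :=
  fun i => (contDiffOn_hess_slice uniqueDiffOn_unitInterval (chartAt (Cn n) i).open_target
    (hφ _ (chart_mem_atlas _ i))).continuousOn

theorem KaehlerForm.contST_mat (κ : KaehlerForm n X) {φ : ℝ → X → ℝ} (hφ : PathSmooth n φ) :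
    ContST (κ.mat φ) := fun i =>
  ((κ.contDiffOn_coeffs (chart_mem_atlas _ i)).continuousOn.comp continuousOn_snd
    fun _ hp => hp.2).add (hφ.contST_hs i)

theorem PathSmooth.contST_gs {φ : ℝ → X → ℝ} (hφ : PathSmooth n φ) : ContST (gs (n := n) φ) :=
  fun i => by
    have h (v : Cn n) := (contDiffOn_fderiv_slice uniqueDiffOn_unitInterval
      (chartAt (Cn n) i).open_target (hφ _ (chart_mem_atlas _ i)) v).continuousOn
    refine continuousOn_pi.2 fun p => continuousOn_pi.2 fun q => ?_
    exact ((h _).mul (continuousOn_const.mul (h _))).sub ((h _).mul (continuousOn_const.mul (h _)))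

theorem PathSmooth.hasDerivWithinAt_val {φ : ℝ → X → ℝ} (hφ : PathSmooth n φ) (i : X) {t : ℝ}
    (ht : t ∈ Set.Icc (0 : ℝ) 1) {y : Cn n} (hy : y ∈ (chartAt (Cn n) i).target) :
    HasDerivWithinAt (fun τ => val n φ i τ y) (val n (KaehlerPotentials.dot φ) i t y)
      (Set.Icc 0 1) t :=
  hasDerivWithinAt_dt (hφ _ (chart_mem_atlas _ i)) ht hy

theorem PathSmooth.hasDerivWithinAt_hs {φ : ℝ → X → ℝ} (hφ : PathSmooth n φ) (i : X) {t : ℝ}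
    (ht : t ∈ Set.Icc (0 : ℝ) 1) {y : Cn n} (hy : y ∈ (chartAt (Cn n) i).target) :
    HasDerivWithinAt (fun τ => hs φ i τ y) (hs (KaehlerPotentials.dot φ) i t y)
      (Set.Icc 0 1) t :=
  hasDerivWithinAt_hess (chartAt (Cn n) i).open_target (hφ _ (chart_mem_atlas _ i)) ht hy

theorem KaehlerForm.hasDerivWithinAt_mat (κ : KaehlerForm n X) {φ : ℝ → X → ℝ}
    (hφ : PathSmooth n φ) (i : X) {t : ℝ}
    (ht : t ∈ Set.Icc (0 : ℝ) 1) {y : Cn n} (hy : y ∈ (chartAt (Cn n) i).target) :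
    HasDerivWithinAt (fun τ => κ.mat φ i τ y) (hs (KaehlerPotentials.dot φ) i t y)
      (Set.Icc 0 1) t :=
  (hφ.hasDerivWithinAt_hs i ht hy).const_add _

theorem ContST.pfPow {A : X → ℝ → Cn n → CMat n} (hA : ContST A) :
    ContST fun i t y => pfPow (A i t y) := fun i => continuous_pfPow.comp_continuousOn (hA i)

theorem ContST.pfOne {B A : X → ℝ → Cn n → CMat n} (hB : ContST B) (hA : ContST A) :
    ContST fun i t y => pfOne (B i t y) (A i t y) := fun i =>
  continuous_pfOne.comp_continuousOn ((hB i).prodMk (hA i))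

theorem ContST.pfTwo {B C A : X → ℝ → Cn n → CMat n} (hB : ContST B) (hC : ContST C)
    (hA : ContST A) : ContST fun i t y => pfTwo (B i t y) (C i t y) (A i t y) := fun i =>
  continuous_pfTwo.comp_continuousOn ((hB i).prodMk ((hC i).prodMk (hA i)))

/-! ### The functional in coordinates and its first variation -/

/-- The integrand of the functional as a function of the jet `(φ̇, ω_φ, ω_φ̇)`. -/
def lag (z : ℝ × CMat n × CMat n) : ℝ := 1 / 2 * z.1 ^ 2 * pfPow z.2.1 + z.1 * pfPow z.2.2

/-- The differential of `lag`. -/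
def dLag (z δ : ℝ × CMat n × CMat n) : ℝ :=
  z.1 * δ.1 * pfPow z.2.1 + 1 / 2 * z.1 ^ 2 * (n * pfOne δ.2.1 z.2.1) +
    (δ.1 * pfPow z.2.2 + z.1 * (n * pfOne δ.2.2 z.2.2))

/-- The jet `(φ̇, ω_φ, ω_φ̇)` of a path. -/
def KaehlerForm.jet (κ : KaehlerForm n X) (φ : ℝ → X → ℝ) (i : X) (t : ℝ) (y : Cn n) :
    ℝ × CMat n × CMat n := (val n (dot φ) i t y, κ.mat φ i t y, κ.mat (dot φ) i t y)

/-- The jet `(η̇, ddᶜη, ddᶜη̇)` of a variation. -/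
def varJet (η : ℝ → X → ℝ) (i : X) (t : ℝ) (y : Cn n) :
    ℝ × CMat n × CMat n := (val n (dot η) i t y, hs η i t y, hs (dot η) i t y)

/-- The Euler–Lagrange expression in the preferred charts: multiplied by `V⁻¹`, it is the difference
of the right and left hand sides of the equation of magnetic geodesics. -/
def KaehlerForm.euler (κ : KaehlerForm n X) (φ : ℝ → X → ℝ) (i : X) (t : ℝ) (y : Cn n) : ℝ :=
  n * (pfOne (gs (dot φ) i t y) (κ.mat φ i t y) -
      2 * pfOne (hs (dot (dot φ)) i t y) (κ.mat (dot φ) i t y) -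
      ((n : ℝ) - 1) * pfTwo (hs (dot φ) i t y) (hs (dot (dot φ)) i t y) (κ.mat (dot φ) i t y)) -
    val n (dot (dot φ)) i t y * pfPow (κ.mat φ i t y)

theorem KaehlerForm.contST_euler (κ : KaehlerForm n X) {φ : ℝ → X → ℝ} (hφ : PathSmooth n φ) :
    ContST (κ.euler φ) := by
  have hA := κ.contST_mat hφ
  have hB := κ.contST_mat hφ.dot
  exact ((((hφ.dot.contST_gs.pfOne hA).sub ((hφ.dot.dot.contST_hs.pfOne hB).const_mul 2)).sub
    ((hφ.dot.contST_hs.pfTwo hφ.dot.dot.contST_hs hB).const_mul _)).const_mul _).sub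
    (hφ.dot.dot.contST_val.mul hA.pfPow)

variable [IsManifold 𝓘(ℂ, Cn n) ω X] [T2Space X] [CompactSpace X]

/-- Green's formula for `ω_w`, in terms of coefficients. The factor `n` covers the case `n = 0`. -/
theorem spInt_green (κ : KaehlerForm n X) {u v w : X → ℝ} (hu : ChartSmooth n u)
    (hv : ChartSmooth n v) (hw : ChartSmooth n w) :
    (spInt fun i y => u ((chartAt (Cn n) i).symm y) *
      (n * pfOne (hess (v ∘ (chartAt (Cn n) i).symm) y)
        (coeffs (inChart (chartAt (Cn n) i) κ.form y) + hess (w ∘ (chartAt (Cn n) i).symm) y))) =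
    spInt fun i y => v ((chartAt (Cn n) i).symm y) *
      (n * pfOne (hess (u ∘ (chartAt (Cn n) i).symm) y)
        (coeffs (inChart (chartAt (Cn n) i) κ.form y) +
          hess (w ∘ (chartAt (Cn n) i).symm) y)) := by
  rcases Nat.eq_zero_or_pos n with rfl | hn
  · simp
  have hα : ∀ e ∈ atlas (Cn n) X,
    ClosedInvOn (fun y => coeffs (inChart e (κ.add w) y)) e.target :=
    fun e he => κ.closedInvOn_add hw he
  have h := integral_greenForm ⟨0, hn⟩ rfl hα hu hv
  have h1 : integral (fun x => u x • wedgePowOne (ddc v) (κ.add w) x) =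
      integral (fun x => v x • wedgePowOne (ddc u) (κ.add w) x) := by
    have e1 : (fun x => u x • wedgePowOne (ddc v) (κ.add w) x) =
      greenForm (κ.add w) u v + fun x => v x • wedgePowOne (ddc u) (κ.add w) x :=
      (sub_add_cancel _ _).symm
    rw [e1, integral_add_form _ (contTop_smul_wedgePowOne_ddc hα hv hu), h, zero_add]
    exact fun e he => (contTop_smul_wedgePowOne_ddc hα hu hv e he).sub
      (contTop_smul_wedgePowOne_ddc hα hv hu e he)
  have h2 {u v : X → ℝ} (hv : ChartSmooth n v) :
      (spInt fun i y => u ((chartAt (Cn n) i).symm y) *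
      (n * pfOne (hess (v ∘ (chartAt (Cn n) i).symm) y)
        (coeffs (inChart (chartAt (Cn n) i) κ.form y) + hess (w ∘ (chartAt (Cn n) i).symm) y))) =
      n * integral (fun x => u x • wedgePowOne (ddc v) (κ.add w) x) := by
    rw [integral_eq_spInt, ← spInt_const_mul]
    refine spInt_congr fun i y hy => ?_
    rw [topCoeff_smul_wedgePowOne_ddc _ _ hv (chart_mem_atlas _ i) hy,
      κ.coeffs_add hw (chart_mem_atlas _ i) hy]
    ring
  rw [h2 hv, h2 hu, h1]

/-- The first variation formula: integration by parts in space (Green's formula) and in time. -/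
theorem stInt_dLag (κ : KaehlerForm n X) {φ η : ℝ → X → ℝ} (hφ : PathSmooth n φ)
    (hη : PathSmooth n η) (h0 : ∀ x, η 0 x = 0) (h1 : ∀ x, η 1 x = 0) :
    (stInt fun i t y => dLag (κ.jet φ i t y) (varJet η i t y)) =
      stInt fun i t y => val n η i t y * κ.euler φ i t y := by
  have ca := hφ.dot.contST_val
  have cA := κ.contST_mat hφ
  have cB := κ.contST_mat hφ.dot
  have cη := hη.contST_val
  have cη' := hη.dot.contST_val
  -- the four terms of the differential
  have c1 : ContST fun i t y => val n (dot φ) i t y * val n (dot η) i t y *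
    pfPow (κ.mat φ i t y) := (ca.mul cη').mul cA.pfPow
  have c2 : ContST fun i t y => 1 / 2 * val n (dot φ) i t y ^ 2 *
      (n * pfOne (hs η i t y) (κ.mat φ i t y)) :=
    ContST.mul (fun i => continuousOn_const.mul ((ca i).pow 2))
      ((hη.contST_hs.pfOne cA).const_mul n)
  have c3 : ContST fun i t y => val n (dot η) i t y * pfPow (κ.mat (dot φ) i t y) :=
    cη'.mul cB.pfPow
  have c4 : ContST fun i t y => val n (dot φ) i t y *
      (n * pfOne (hs (dot η) i t y) (κ.mat (dot φ) i t y)) :=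
    ca.mul ((hη.dot.contST_hs.pfOne cB).const_mul n)
  have c2' : ContST fun i t y => val n η i t y * (n * (val n (dot φ) i t y *
      pfOne (hs (dot φ) i t y) (κ.mat φ i t y) + pfOne (gs (dot φ) i t y) (κ.mat φ i t y))) :=
    cη.mul (((ca.mul (hφ.dot.contST_hs.pfOne cA)).add (hφ.dot.contST_gs.pfOne cA)).const_mul n)
  have c4' : ContST fun i t y => val n (dot η) i t y *
      (n * pfOne (hs (dot φ) i t y) (κ.mat (dot φ) i t y)) :=
    cη'.mul ((hφ.dot.contST_hs.pfOne cB).const_mul n)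
  -- integration by parts in space
  have e2 : (stInt fun i t y => 1 / 2 * val n (dot φ) i t y ^ 2 *
      (n * pfOne (hs η i t y) (κ.mat φ i t y))) =
      stInt fun i t y => val n η i t y * (n * (val n (dot φ) i t y *
      pfOne (hs (dot φ) i t y) (κ.mat φ i t y) + pfOne (gs (dot φ) i t y) (κ.mat φ i t y))) := by
    refine intervalIntegral.integral_congr fun t ht => ?_
    rw [Set.uIcc_of_le zero_le_one] at ht
    have hd := hφ.dot.chartSmooth ht
    have hsq : ChartSmooth n fun x => 1 / 2 * dot φ t x ^ 2 :=
      fun e he => contDiffOn_const.mul ((hd e he).pow 2)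
    refine (spInt_green κ hsq (hη.chartSmooth ht) (hφ.chartSmooth ht)).trans
      (spInt_congr fun i y hy => ?_)
    have hh := hess_half_sq (chartAt (Cn n) i).open_target (hd _ (chart_mem_atlas _ i)) hy
    have hh' : hess ((fun x => 1 / 2 * dot φ t x ^ 2) ∘ (chartAt (Cn n) i).symm) y = _ := hh
    rw [hh', nat_mul_pfOne_smul_add]
    rfl
  have e4 : (stInt fun i t y => val n (dot φ) i t y *
      (n * pfOne (hs (dot η) i t y) (κ.mat (dot φ) i t y))) =
      stInt fun i t y => val n (dot η) i t y *
      (n * pfOne (hs (dot φ) i t y) (κ.mat (dot φ) i t y)) := by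
    refine intervalIntegral.integral_congr fun t ht => ?_
    rw [Set.uIcc_of_le zero_le_one] at ht
    exact spInt_green κ (hφ.dot.chartSmooth ht) (hη.dot.chartSmooth ht) (hφ.dot.chartSmooth ht)
  -- integration by parts in time
  have cq : ContST fun i t y => val n (dot η) i t y *
      (val n (dot φ) i t y * pfPow (κ.mat φ i t y) + pfPow (κ.mat (dot φ) i t y) +
        n * pfOne (hs (dot φ) i t y) (κ.mat (dot φ) i t y)) +
      val n η i t y * (val n (dot (dot φ)) i t y * pfPow (κ.mat φ i t y) +
        val n (dot φ) i t y * (n * pfOne (hs (dot φ) i t y) (κ.mat φ i t y)) +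
        n * pfOne (hs (dot (dot φ)) i t y) (κ.mat (dot φ) i t y) +
        n * (pfOne (hs (dot (dot φ)) i t y) (κ.mat (dot φ) i t y) +
          ((n : ℝ) - 1) * pfTwo (hs (dot φ) i t y) (hs (dot (dot φ)) i t y)
            (κ.mat (dot φ) i t y))) := by
    refine (cη'.mul (((ca.mul cA.pfPow).add cB.pfPow).add
      ((hφ.dot.contST_hs.pfOne cB).const_mul n))).add (cη.mul (ContST.add (ContST.add (ContST.add
      (hφ.dot.dot.contST_val.mul cA.pfPow) (ca.mul ((hφ.dot.contST_hs.pfOne cA).const_mul n)))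
      ((hφ.dot.dot.contST_hs.pfOne cB).const_mul n))
      (((hφ.dot.dot.contST_hs.pfOne cB).add
      ((hφ.dot.contST_hs.pfTwo hφ.dot.dot.contST_hs cB).const_mul _)).const_mul n)))
  have eq := stInt_eq_zero_of_deriv (q := fun i t y => val n η i t y *
      (val n (dot φ) i t y * pfPow (κ.mat φ i t y) + pfPow (κ.mat (dot φ) i t y) +
        n * pfOne (hs (dot φ) i t y) (κ.mat (dot φ) i t y))) cq (fun i t ht y hy => by
    have dA := hasDerivWithinAt_pfPow (κ.hasDerivWithinAt_mat hφ i ht hy)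
    have dB' := κ.hasDerivWithinAt_mat hφ.dot i ht hy
    have dB := hasDerivWithinAt_pfPow dB'
    have dC := hasDerivWithinAt_pfOne (hφ.dot.hasDerivWithinAt_hs i ht hy) dB'
    exact (hη.hasDerivWithinAt_val i ht hy).mul
      ((((hφ.dot.hasDerivWithinAt_val i ht hy).mul dA).add dB).add dC))
    (fun i y _ => by simp [val, h0]) (fun i y _ => by simp [val, h1])
  have ce : ContST fun i t y => val n η i t y * κ.euler φ i t y := cη.mul (κ.contST_euler hφ)
  have e0 : (stInt fun i t y => dLag (κ.jet φ i t y) (varJet η i t y)) =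
      (stInt fun i t y => val n (dot φ) i t y * val n (dot η) i t y * pfPow (κ.mat φ i t y) +
        1 / 2 * val n (dot φ) i t y ^ 2 * (n * pfOne (hs η i t y) (κ.mat φ i t y))) +
      stInt fun i t y => val n (dot η) i t y * pfPow (κ.mat (dot φ) i t y) +
        val n (dot φ) i t y * (n * pfOne (hs (dot η) i t y) (κ.mat (dot φ) i t y)) :=
    stInt_add (c1.add c2) (c3.add c4)
  have e5 := stInt_add cq ce
  rw [eq, zero_add] at e5
  rw [e0, stInt_add c1 c2, stInt_add c3 c4, e2, e4, ← stInt_add c1 c2', ← stInt_add c3 c4',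
    ← stInt_add (c1.add c2') (c3.add c4'), ← e5]
  refine stInt_congr fun i t _ y _ => ?_
  simp only [KaehlerForm.euler]
  ring

omit [IsManifold 𝓘(ℂ, Cn n) ω X] [T2Space X] [CompactSpace X] in
theorem KaehlerForm.contST_jet (κ : KaehlerForm n X) {φ : ℝ → X → ℝ} (hφ : PathSmooth n φ) :
    ContST (κ.jet φ) := fun i =>
  (hφ.dot.contST_val i).prodMk ((κ.contST_mat hφ i).prodMk (κ.contST_mat hφ.dot i))

theorem continuous_lag : Continuous (lag (n := n)) :=
  ((continuous_const.mul (continuous_fst.pow 2)).mul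
    (continuous_pfPow.comp (continuous_fst.comp continuous_snd))).add
    (continuous_fst.mul (continuous_pfPow.comp (continuous_snd.comp continuous_snd)))

theorem topCoeff_MA (κ : KaehlerForm n X) {u : X → ℝ} (hu : ChartSmooth n u)
    {e : OpenPartialHomeomorph X (Cn n)} (he : e ∈ atlas (Cn n) X) {y : Cn n} (hy : y ∈ e.target) :
    topCoeff e (κ.MA u) y =
      κ.vol⁻¹ * pfPow (coeffs (inChart e κ.form y) + hess (u ∘ e.symm) y) := by
  rw [KaehlerForm.MA, topCoeff_const_smul, topCoeff_wedgePow, κ.coeffs_add hu he hy]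

/-- The functional in coordinates. -/
theorem LH_eq_stInt (κ : KaehlerForm n X) {φ : ℝ → X → ℝ} (hφ : PathSmooth n φ) :
    κ.LH φ = κ.vol⁻¹ * stInt fun i t y => lag (κ.jet φ i t y) := by
  have ca := hφ.dot.contST_val
  have cA := κ.contST_mat hφ
  have cB := κ.contST_mat hφ.dot
  have c1 : ContST fun i t y => 1 / 2 * val n (dot φ) i t y ^ 2 * pfPow (κ.mat φ i t y) :=
    ContST.mul (fun i => continuousOn_const.mul ((ca i).pow 2)) cA.pfPow
  have c2 : ContST fun i t y => val n (dot φ) i t y * pfPow (κ.mat (dot φ) i t y) :=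
    ca.mul cB.pfPow
  have h : (stInt fun i t y => lag (κ.jet φ i t y)) = _ := stInt_add c1 c2
  rw [h, mul_add, ← stInt_const_mul, ← stInt_const_mul, KaehlerForm.LH,
    ← intervalIntegral.integral_const_mul]
  congr 1
  · refine intervalIntegral.integral_congr fun t ht => ?_
    rw [Set.uIcc_of_le zero_le_one] at ht
    beta_reduce
    rw [integral_eq_spInt, ← spInt_const_mul]
    refine spInt_congr fun i y hy => ?_
    rw [topCoeff_smul _ (fun x => dot φ t x ^ 2),
      topCoeff_MA κ (hφ.chartSmooth ht) (chart_mem_atlas _ i) hy]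
    simp only [KaehlerForm.jet, val, KaehlerForm.mat, hs]
    ring
  · refine intervalIntegral.integral_congr fun t ht => ?_
    rw [Set.uIcc_of_le zero_le_one] at ht
    beta_reduce
    rw [integral_eq_spInt]
    refine spInt_congr fun i y hy => ?_
    rw [topCoeff_smul, topCoeff_MA κ (hφ.dot.chartSmooth ht) (chart_mem_atlas _ i) hy]
    simp only [KaehlerForm.jet, val, KaehlerForm.mat, hs]
    ring

end Paths

end

section

open MeasureTheory Finset

variable {n : ℕ}

/-! ### Uniform first order expansions -/

/-- First order Taylor expansion with a remainder that is uniform on balls. -/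
theorem exists_taylor_bound {Z : Type*} [NormedAddCommGroup Z] [NormedSpace ℝ Z] [ProperSpace Z]
    {f : Z → ℝ} (hf : ContDiff ℝ 2 f) (R : ℝ) :
    ∃ C : ℝ, 0 ≤ C ∧ ∀ z w : Z, ‖z‖ ≤ R → ‖w‖ ≤ R →
      |f w - f z - fderiv ℝ f z (w - z)| ≤ C * ‖w - z‖ ^ 2 := by
  have hf' : ContDiff ℝ 1 (fderiv ℝ f) := hf.fderiv_right (by norm_num)
  obtain ⟨C, hC⟩ := (isCompact_closedBall (0 : Z) R).exists_bound_of_continuousOn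
    (hf'.continuous_fderiv one_ne_zero).continuousOn
  refine ⟨|C|, abs_nonneg C, fun z w hz hw => ?_⟩
  have hz' : z ∈ Metric.closedBall (0 : Z) R := by simpa using hz
  have hw' : w ∈ Metric.closedBall (0 : Z) R := by simpa using hw
  have hs : segment ℝ z w ⊆ Metric.closedBall (0 : Z) R :=
    (convex_closedBall _ _).segment_subset hz' hw'
  have h1 : ∀ x ∈ segment ℝ z w, ‖fderiv ℝ f x - fderiv ℝ f z‖ ≤ |C| * ‖w - z‖ := fun x hx => by
    refine ((convex_closedBall (0 : Z) R).norm_image_sub_le_of_norm_fderiv_le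
      (fun y _ => hf'.differentiable one_ne_zero y) hC hz' (hs hx)).trans ?_
    refine mul_le_mul (le_abs_self C) ?_ (norm_nonneg _) (abs_nonneg C)
    obtain ⟨θ, hθ, rfl⟩ := (segment_eq_image' ℝ z w ▸ hx :)
    rw [add_sub_cancel_left, norm_smul, Real.norm_of_nonneg hθ.1]
    exact mul_le_of_le_one_left (norm_nonneg _) hθ.2
  have h2 := (convex_segment z w).norm_image_sub_le_of_norm_fderiv_le'
    (fun y _ => hf.differentiable two_ne_zero y) h1 (left_mem_segment ℝ z w)
    (right_mem_segment ℝ z w)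
  calc _ ≤ |C| * ‖w - z‖ * ‖w - z‖ := h2
    _ = _ := by ring

/-- A family depending smoothly on a parameter `s` is bounded and Lipschitz in `s`, uniformly on
compact sets. -/
theorem exists_lipschitz_family {G : Type*} [NormedAddCommGroup G] [NormedSpace ℝ G]
    {U K : Set (Cn n)} (hU : IsOpen U) (hK : IsCompact K) (hKU : K ⊆ U) {ε : ℝ} (hε : 0 < ε)
    {g : (ℝ × ℝ) × Cn n → G}
    (hg : ContDiffOn ℝ ∞ g ((Set.Ioo (-ε) ε ×ˢ Set.Icc 0 1) ×ˢ U)) :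
    ∃ C : ℝ, ∀ s ∈ Set.Icc (-(ε / 2)) (ε / 2), ∀ t ∈ Set.Icc (0 : ℝ) 1, ∀ y ∈ K,
      ‖g ((s, t), y)‖ ≤ C ∧ ‖g ((s, t), y) - g ((0, t), y)‖ ≤ C * |s| := by
  set D := (Set.Ioo (-ε) ε ×ˢ Set.Icc (0 : ℝ) 1) ×ˢ U with hD
  set S := Set.Icc (-(ε / 2)) (ε / 2) with hS
  have hSsub : S ⊆ Set.Ioo (-ε) ε := fun s hs => ⟨by linarith [hs.1], by linarith [hs.2]⟩
  have hDu : UniqueDiffOn ℝ D :=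
    (isOpen_Ioo.uniqueDiffOn.prod uniqueDiffOn_unitInterval).prod hU.uniqueDiffOn
  have hsub : (S ×ˢ Set.Icc (0 : ℝ) 1) ×ˢ K ⊆ D :=
    Set.prod_mono (Set.prod_mono hSsub subset_rfl) hKU
  have hcomp : IsCompact ((S ×ˢ Set.Icc (0 : ℝ) 1) ×ˢ K) :=
    (isCompact_Icc.prod isCompact_Icc).prod hK
  have hd : ContinuousOn (fun p => fderivWithin ℝ g D p ((1, 0), 0)) D :=
    (hg.fderivWithin (m := ∞) hDu (by simp)).continuousOn.clm_apply continuousOn_const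
  obtain ⟨A, hA⟩ := hcomp.exists_bound_of_continuousOn (hg.continuousOn.mono hsub)
  obtain ⟨B, hB⟩ := hcomp.exists_bound_of_continuousOn (hd.mono hsub)
  refine ⟨max A B, fun s hs t ht y hy => ⟨(hA _ ⟨⟨hs, ht⟩, hy⟩).trans (le_max_left _ _), ?_⟩⟩
  have h0 : (0 : ℝ) ∈ S := ⟨by linarith, by linarith⟩
  have hcurve : ∀ σ ∈ S, HasDerivWithinAt (fun σ => g ((σ, t), y))
      (fderivWithin ℝ g D ((σ, t), y) ((1, 0), 0)) S σ := fun σ hσ =>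
    hasDerivWithinAt_curve (γ := fun σ : ℝ => (σ, t)) (w := (1, 0))
      ((hasDerivWithinAt_id σ S).prodMk (hasDerivWithinAt_const σ S t))
      (fun τ hτ => ⟨hSsub hτ, ht⟩) (hKU hy)
      (hg.differentiableOn (by simp) _ (hsub ⟨⟨hσ, ht⟩, hy⟩))
  have := (convex_Icc (-(ε / 2)) (ε / 2)).norm_image_sub_le_of_norm_hasDerivWithin_le hcurve
    (fun σ hσ => hB _ ⟨⟨hσ, ht⟩, hy⟩) h0 hs
  rw [sub_zero, Real.norm_eq_abs] at this
  exact this.trans (mul_le_mul_of_nonneg_right (le_max_right _ _) (abs_nonneg s))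

theorem contDiff_pfPow : ContDiff ℝ ∞ (pfPow (n := n)) :=
  (pf n).contDiff.comp (contDiff_pi.2 fun _ => contDiff_id)

theorem contDiff_lag : ContDiff ℝ ∞ (lag (n := n)) :=
  ((contDiff_const.mul (contDiff_fst.pow 2)).mul
    (contDiff_pfPow.comp (contDiff_fst.comp contDiff_snd))).add
    (contDiff_fst.mul (contDiff_pfPow.comp (contDiff_snd.comp contDiff_snd)))

theorem fderiv_lag (z δ : ℝ × CMat n × CMat n) : fderiv ℝ lag z δ = dLag z δ := by
  have hd : DifferentiableAt ℝ (lag (n := n)) z := contDiff_lag.differentiable (by simp) z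
  rw [← hd.lineDeriv_eq_fderiv]
  have hl {W : Type} [NormedAddCommGroup W] [NormedSpace ℝ W] (a b : W) :
      HasDerivWithinAt (fun τ : ℝ => a + τ • b) b Set.univ 0 := by
    have h := (((hasDerivAt_id (0 : ℝ)).smul_const b).const_add a).hasDerivWithinAt (s := Set.univ)
    rwa [one_smul] at h
  have h1 := hl z.1 δ.1
  have h := (((h1.pow 2).const_mul (1 / 2 : ℝ)).mul (hasDerivWithinAt_pfPow (hl z.2.1 δ.2.1))).add
    (h1.mul (hasDerivWithinAt_pfPow (hl z.2.2 δ.2.2)))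
  refine (HasDerivAt.deriv (hasDerivWithinAt_univ.1 h)).trans ?_
  simp only [dLag, Pi.pow_apply, zero_smul, add_zero]
  push_cast
  ring

theorem continuous_dLag :
    Continuous fun p : (ℝ × CMat n × CMat n) × (ℝ × CMat n × CMat n) => dLag p.1 p.2 := by
  simpa only [fderiv_lag] using contDiff_lag.continuous_fderiv_apply (n := ∞) (by simp)

theorem hess_sub {f g : Cn n → ℝ} {U : Set (Cn n)} (hU : IsOpen U) (hf : ContDiffOn ℝ ∞ f U)
    (hg : ContDiffOn ℝ ∞ g U) {y : Cn n} (hy : y ∈ U) :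
    hess (fun z => f z - g z) y = hess f y - hess g y := by
  have h := hess_add hU hf ((contDiffOn_const (c := (-1 : ℝ))).mul hg) hy
  rw [hess_const_mul, neg_one_smul, ← sub_eq_add_neg] at h
  rw [← h]
  congr 1
  funext z
  ring

/-! ### Smooth families of paths -/

section Families

variable {X : Type*} [TopologicalSpace X] [ChartedSpace (Cn n) X]

variable (n) in
/-- Smoothness of a family of paths `Φ_{s,t}`, `|s| < ε`, `0 ≤ t ≤ 1`, read in the charts of `X`. -/
def FamilySmooth (ε : ℝ) (Φ : ℝ → ℝ → X → ℝ) : Prop :=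
  ∀ e ∈ atlas (Cn n) X, ContDiffOn ℝ ∞ (fun p : (ℝ × ℝ) × Cn n => Φ p.1.1 p.1.2 (e.symm p.2))
    ((Set.Ioo (-ε) ε ×ˢ Set.Icc 0 1) ×ˢ e.target)

variable {ε : ℝ} {Φ : ℝ → ℝ → X → ℝ}

theorem FamilySmooth.pathSmooth (hΦ : FamilySmooth n ε Φ) {s : ℝ} (hs : s ∈ Set.Ioo (-ε) ε) :
    PathSmooth n (Φ s) := fun e he => by
  have h : Set.MapsTo (fun p : ℝ × Cn n => ((s, p.1), p.2)) (Set.Icc 0 1 ×ˢ e.target)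
    ((Set.Ioo (-ε) ε ×ˢ Set.Icc 0 1) ×ˢ e.target) := fun p hp => ⟨⟨hs, hp.1⟩, hp.2⟩
  exact (hΦ e he).comp (by fun_prop) h

theorem FamilySmooth.dot (hΦ : FamilySmooth n ε Φ) : FamilySmooth n ε fun s => dot (Φ s) := by
  intro e he
  have h := (hΦ e he).fderivWithin (m := ∞) ((isOpen_Ioo.uniqueDiffOn.prod
    uniqueDiffOn_unitInterval).prod e.open_target.uniqueDiffOn) (by simp)
  refine (h.clm_apply (contDiffOn_const (c := (((0, 1), 0) : (ℝ × ℝ) × Cn n)))).congr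
    fun p hp => ?_
  refine HasDerivWithinAt.derivWithin ?_ (uniqueDiffOn_unitInterval _ hp.1.2)
  exact hasDerivWithinAt_curve (Q := Set.Ioo (-ε) ε ×ˢ Set.Icc 0 1) (U := e.target)
    (γ := fun τ : ℝ => (p.1.1, τ)) (w := (0, 1))
    ((hasDerivWithinAt_const p.1.2 _ p.1.1).prodMk (hasDerivWithinAt_id p.1.2 _))
    (fun τ hτ => ⟨hp.1.1, hτ⟩) hp.2 ((hΦ e he).differentiableOn (by simp) _ hp)

theorem FamilySmooth.contDiffOn_mat (κ : KaehlerForm n X) (hΦ : FamilySmooth n ε Φ) (i : X) :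
    ContDiffOn ℝ ∞ (fun p : (ℝ × ℝ) × Cn n => κ.mat (Φ p.1.1) i p.1.2 p.2)
      ((Set.Ioo (-ε) ε ×ˢ Set.Icc 0 1) ×ˢ (chartAt (Cn n) i).target) :=
  ((κ.contDiffOn_coeffs (chart_mem_atlas _ i)).comp contDiffOn_snd fun _ hp => hp.2).add
    (contDiffOn_hess_slice (isOpen_Ioo.uniqueDiffOn.prod uniqueDiffOn_unitInterval)
      (chartAt (Cn n) i).open_target (hΦ _ (chart_mem_atlas _ i)))

theorem FamilySmooth.contDiffOn_jet (κ : KaehlerForm n X) (hΦ : FamilySmooth n ε Φ) (i : X) :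
    ContDiffOn ℝ ∞ (fun p : (ℝ × ℝ) × Cn n => κ.jet (Φ p.1.1) i p.1.2 p.2)
      ((Set.Ioo (-ε) ε ×ˢ Set.Icc 0 1) ×ˢ (chartAt (Cn n) i).target) :=
  (hΦ.dot _ (chart_mem_atlas _ i)).prodMk
    ((hΦ.contDiffOn_mat κ i).prodMk (hΦ.dot.contDiffOn_mat κ i))

theorem PathSmooth.hasDerivWithinAt_dot {φ : ℝ → X → ℝ} (hφ : PathSmooth n φ) {t : ℝ}
    (ht : t ∈ Set.Icc (0 : ℝ) 1) (x : X) :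
    HasDerivWithinAt (fun τ => φ τ x) (KaehlerPotentials.dot φ t x) (Set.Icc 0 1) t := by
  have h := hφ.hasDerivWithinAt_val x ht (mem_chart_target (Cn n) x)
  simpa only [val, (chartAt (Cn n) x).left_inv (mem_chart_source (Cn n) x)] using h

theorem PathSmooth.dot_sub {φ ψ : ℝ → X → ℝ} (hφ : PathSmooth n φ) (hψ : PathSmooth n ψ) {t : ℝ}
    (ht : t ∈ Set.Icc (0 : ℝ) 1) :
    KaehlerPotentials.dot (fun t x => φ t x - ψ t x) t =
      fun x => KaehlerPotentials.dot φ t x - KaehlerPotentials.dot ψ t x := by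
  funext x
  exact ((hφ.hasDerivWithinAt_dot ht x).sub (hψ.hasDerivWithinAt_dot ht x)).derivWithin
    (uniqueDiffOn_unitInterval t ht)

theorem hs_sub {φ ψ : ℝ → X → ℝ} (hφ : PathSmooth n φ) (hψ : PathSmooth n ψ) {i : X} {t : ℝ}
    (ht : t ∈ Set.Icc (0 : ℝ) 1) {y : Cn n} (hy : y ∈ (chartAt (Cn n) i).target) :
    hs (fun t x => φ t x - ψ t x) i t y = hs φ i t y - hs ψ i t y :=
  hess_sub (chartAt (Cn n) i).open_target (hφ.chartSmooth ht _ (chart_mem_atlas _ i))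
    (hψ.chartSmooth ht _ (chart_mem_atlas _ i)) hy

theorem varJet_sub (κ : KaehlerForm n X) {φ ψ : ℝ → X → ℝ} (hφ : PathSmooth n φ)
    (hψ : PathSmooth n ψ) {i : X} {t : ℝ}
    (ht : t ∈ Set.Icc (0 : ℝ) 1) {y : Cn n} (hy : y ∈ (chartAt (Cn n) i).target) :
    varJet (fun t x => φ t x - ψ t x) i t y = κ.jet φ i t y - κ.jet ψ i t y := by
  have h1 : hs (dot fun t x => φ t x - ψ t x) i t y =
      hs (fun t x => dot φ t x - dot ψ t x) i t y := by
    simp only [hs, hφ.dot_sub hψ ht]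
  refine Prod.ext ?_ (Prod.ext ?_ ?_)
  · exact congrFun (hφ.dot_sub hψ ht) _
  · simp only [varJet, KaehlerForm.jet, KaehlerForm.mat, hs_sub hφ hψ ht hy, Prod.fst_sub,
      Prod.snd_sub, add_sub_add_left_eq_sub]
  · simp only [varJet, KaehlerForm.jet, KaehlerForm.mat, h1, hs_sub hφ.dot hψ.dot ht hy,
      Prod.snd_sub, add_sub_add_left_eq_sub]

theorem PathSmooth.contST_varJet {η : ℝ → X → ℝ} (hη : PathSmooth n η) :
    ContST (varJet (n := n) η) := fun i =>
  (hη.dot.contST_val i).prodMk ((hη.contST_hs i).prodMk (hη.dot.contST_hs i))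

variable [IsManifold 𝓘(ℂ, Cn n) ω X] [T2Space X] [CompactSpace X]

/-- The first variation of the functional along a family with fixed endpoints, with a quadratic
error term. -/
theorem exists_LH_expansion (κ : KaehlerForm n X) (hε : 0 < ε) (hΦ : FamilySmooth n ε Φ)
    (h0 : ∀ s ∈ Set.Ioo (-ε) ε, Φ s 0 = Φ 0 0) (h1 : ∀ s ∈ Set.Ioo (-ε) ε, Φ s 1 = Φ 0 1) :
    ∃ C : ℝ, ∀ s ∈ Set.Icc (-(ε / 2)) (ε / 2),
      |κ.LH (Φ s) - κ.LH (Φ 0) - κ.vol⁻¹ * stInt fun i t y =>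
        val n (fun t x => Φ s t x - Φ 0 t x) i t y * κ.euler (Φ 0) i t y| ≤ C * s ^ 2 := by
  obtain ⟨M, hM, hM'⟩ := exists_stInt_le (n := n) (X := X)
  have hl (i : X) := exists_lipschitz_family (chartAt (Cn n) i).open_target (isCompact_wtSupp i)
    (wtSupp_subset i) hε (hΦ.contDiffOn_jet κ i)
  choose B hB using hl
  set R := ∑ i ∈ idxSet n X, |B i| with hR
  have hBR {i : X} (hi : i ∈ idxSet n X) : B i ≤ R :=
    (le_abs_self _).trans (single_le_sum (f := fun i => |B i|) (fun _ _ => abs_nonneg _) hi)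
  obtain ⟨T, hT, hT'⟩ := exists_taylor_bound (contDiff_lag (n := n) |>.of_le ENat.LEInfty.out) R
  refine ⟨|κ.vol⁻¹| * (M * (T * R ^ 2)), fun s hs => ?_⟩
  have hs' : s ∈ Set.Ioo (-ε) ε := ⟨by linarith [hs.1], by linarith [hs.2]⟩
  have hz : (0 : ℝ) ∈ Set.Icc (-(ε / 2)) (ε / 2) := ⟨by linarith, by linarith⟩
  have hz' : (0 : ℝ) ∈ Set.Ioo (-ε) ε := ⟨by linarith, hε⟩
  have hψ := hΦ.pathSmooth hs'
  have hφ := hΦ.pathSmooth hz'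
  have hη := hψ.sub hφ
  have c1 : ContST fun i t y => lag (κ.jet (Φ s) i t y) :=
    fun i => continuous_lag.comp_continuousOn (κ.contST_jet hψ i)
  have c2 : ContST fun i t y => lag (κ.jet (Φ 0) i t y) :=
    fun i => continuous_lag.comp_continuousOn (κ.contST_jet hφ i)
  have c3 : ContST fun i t y => dLag (κ.jet (Φ 0) i t y)
      (varJet (fun t x => Φ s t x - Φ 0 t x) i t y) :=
    fun i => continuous_dLag.comp_continuousOn ((κ.contST_jet hφ i).prodMk (hη.contST_varJet i))
  rw [LH_eq_stInt κ hψ, LH_eq_stInt κ hφ, ← stInt_dLag κ hφ hη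
    (fun x => by simp [h0 s hs']) (fun x => by simp [h1 s hs']), ← mul_sub, ← mul_sub,
    ← stInt_sub c1 c2, ← stInt_sub (c1.sub c2) c3, abs_mul, mul_assoc, mul_assoc, mul_assoc]
  refine mul_le_mul_of_nonneg_left (hM' _ _ fun i hi t ht y hy => ?_) (abs_nonneg _)
  have hy' := wtSupp_subset i hy
  rw [varJet_sub κ hψ hφ ht hy', ← fderiv_lag]
  refine (hT' _ _ ((hB i 0 hz t ht y hy).1.trans (hBR hi))
    ((hB i s hs t ht y hy).1.trans (hBR hi))).trans ?_
  refine mul_le_mul_of_nonneg_left ?_ hT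
  rw [← sq_abs s, ← mul_pow]
  exact pow_le_pow_left₀ (norm_nonneg _) ((hB i s hs t ht y hy).2.trans
    (mul_le_mul_of_nonneg_right (hBR hi) (abs_nonneg s))) 2

/-- A quadratic error term does not contribute to the derivative. -/
theorem hasDerivAt_zero_of_sq_bound {f : ℝ → ℝ} {d C δ : ℝ} (hδ : 0 < δ)
    (h : ∀ s ∈ Set.Icc (-δ) δ, |f s - f 0 - s * d| ≤ C * s ^ 2) : HasDerivAt f d 0 := by
  rw [hasDerivAt_iff_isLittleO]
  refine Asymptotics.IsBigO.trans_isLittleO (g := fun s : ℝ => s ^ 2) ?_ ?_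
  · refine Asymptotics.IsBigO.of_bound C ?_
    filter_upwards [Icc_mem_nhds (show -δ < 0 by linarith) hδ] with s hs
    simpa using h s hs
  · simpa using Asymptotics.isLittleO_pow_id (𝕜 := ℝ) (one_lt_two)

end Families

end

section

open MeasureTheory Finset

variable {n : ℕ} {X : Type*} [TopologicalSpace X] [ChartedSpace (Cn n) X]
  [IsManifold 𝓘(ℂ, Cn n) ω X]

/-! ### Paths and variations in charts -/

theorem contMDiffOn_prodMap_symm {P : Type*} [NormedAddCommGroup P] [NormedSpace ℝ P] (Q : Set P)
    {e : OpenPartialHomeomorph X (Cn n)} (he : e ∈ atlas (Cn n) X) :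
    ContMDiffOn 𝓘(ℝ, P × Cn n) 𝓘(ℝ, Cn n) ∞ (fun p : P × Cn n => e.symm p.2) (Q ×ˢ e.target) :=
  (contMDiffOn_symm_of_mem_maximalAtlas (mem_maximalAtlas_of_mem_atlas he)).comp
    (contDiff_snd.contMDiff.contMDiffOn) fun _ hp => hp.2

theorem KaehlerForm.IsPath.pathSmooth {κ : KaehlerForm n X} {φ : ℝ → X → ℝ} (hφ : κ.IsPath φ) :
    PathSmooth n φ := fun e he => by
  have h : ContMDiffOn 𝓘(ℝ, ℝ × Cn n) (𝓘(ℝ, ℝ).prod 𝓘(ℝ, Cn n)) ∞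
      (fun p : ℝ × Cn n => (p.1, e.symm p.2)) (Set.Icc 0 1 ×ˢ e.target) :=
    (contDiff_fst.contMDiff.contMDiffOn).prodMk (contMDiffOn_prodMap_symm _ he)
  exact contMDiffOn_iff_contDiffOn.1 (hφ.1.comp h fun p hp => ⟨hp.1, trivial⟩)

theorem KaehlerForm.IsVariation.familySmooth [T2Space X] [CompactSpace X] {κ : KaehlerForm n X}
    {φ : ℝ → X → ℝ} {ε : ℝ} {Φ : ℝ → ℝ → X → ℝ} (hΦ : κ.IsVariation φ ε Φ) :
    FamilySmooth n ε Φ := fun e he => by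
  have h : ContMDiffOn 𝓘(ℝ, (ℝ × ℝ) × Cn n) (𝓘(ℝ, ℝ).prod (𝓘(ℝ, ℝ).prod 𝓘(ℝ, Cn n))) ∞
      (fun p : (ℝ × ℝ) × Cn n => (p.1.1, p.1.2, e.symm p.2))
      ((Set.Ioo (-ε) ε ×ˢ Set.Icc 0 1) ×ˢ e.target) :=
    ((contDiff_fst.fst).contMDiff.contMDiffOn).prodMk
      (((contDiff_fst.snd).contMDiff.contMDiffOn).prodMk (contMDiffOn_prodMap_symm _ he))
  exact contMDiffOn_iff_contDiffOn.1 (hΦ.smooth.comp h fun p hp => ⟨hp.1.1, hp.1.2, trivial⟩)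

/-! ### Positivity is an open condition -/

/-- The quadratic form `v ↦ α(v, iv)` of the two-form `α` with coefficients `A`. -/
def quad (A : CMat n) (v : Cn n) : ℝ :=
  ∑ p, ∑ q, (stdBasis n).repr v p * (stdBasis n).repr (Complex.I • v) q * A p q

theorem apply_sum_left (α : Cn n [⋀^Fin 2]→L[ℝ] ℝ) (a : Idx n → ℝ) (w : Cn n) :
    α ![∑ p, a p • stdFrame n p, w] = ∑ p, a p * α ![stdFrame n p, w] := by
  have h (v : Cn n) : α ![v, w] = α.curryLeft v ![w] := rfl
  simp only [h, map_sum, map_smul, ContinuousAlternatingMap.sum_apply,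
    ContinuousAlternatingMap.smul_apply, smul_eq_mul]

theorem quad_coeffs (α : Cn n [⋀^Fin 2]→L[ℝ] ℝ) (v : Cn n) :
    quad (coeffs α) v = α ![v, Complex.I • v] := by
  have h (v : Cn n) : ∑ p, (stdBasis n).repr v p • stdFrame n p = v := by
    simpa only [coe_stdBasis] using (stdBasis n).sum_repr v
  conv_rhs => rw [← h v, apply_sum_left]
  refine Finset.sum_congr rfl fun p _ => ?_
  rw [h v, coeffs_antisymm]
  conv_rhs => rw [← h (Complex.I • v), apply_sum_left]
  rw [← Finset.sum_neg_distrib, Finset.mul_sum]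
  refine Finset.sum_congr rfl fun q _ => ?_
  rw [coeffs_antisymm (v := stdFrame n q), coeffs]
  ring

theorem quad_add_smul (A B : CMat n) (c : ℝ) (v : Cn n) :
    quad (A + c • B) v = quad A v + c * quad B v := by
  simp only [quad, Finset.mul_sum, ← Finset.sum_add_distrib, Pi.add_apply, Pi.smul_apply,
    smul_eq_mul]
  refine Finset.sum_congr rfl fun p _ => Finset.sum_congr rfl fun q _ => ?_
  ring

theorem quad_smul (A : CMat n) (c : ℝ) (v : Cn n) : quad A (c • v) = c ^ 2 * quad A v := by
  simp only [quad, Finset.mul_sum, smul_comm Complex.I c v, map_smul, Finsupp.smul_apply,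
    smul_eq_mul]
  refine Finset.sum_congr rfl fun p _ => Finset.sum_congr rfl fun q _ => ?_
  ring

theorem continuous_quad : Continuous (Function.uncurry (quad (n := n))) := by
  have h (p : Idx n) : Continuous fun v : Cn n => (stdBasis n).repr v p :=
    LinearMap.continuous_of_finiteDimensional ((stdBasis n).coord p)
  have h1 (p : Idx n) : Continuous fun z : CMat n × Cn n => (stdBasis n).repr z.2 p :=
    (h p).comp continuous_snd
  have h2 (p : Idx n) :
      Continuous fun z : CMat n × Cn n => (stdBasis n).repr (Complex.I • z.2) p :=
    (h p).comp (continuous_snd.const_smul Complex.I)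
  have h3 (p q : Idx n) : Continuous fun z : CMat n × Cn n => z.1 p q :=
    (continuous_apply q).comp ((continuous_apply p).comp continuous_fst)
  simp only [Function.uncurry_def, quad]
  exact continuous_finsetSum _ fun p _ => continuous_finsetSum _ fun q _ =>
    ((h1 p).mul (h2 q)).mul (h3 p q)

/-- The derivative of the inverse of a chart has a right inverse, hence is bijective. -/
theorem symmD_comp_fderiv {e : OpenPartialHomeomorph X (Cn n)} (he : e ∈ atlas (Cn n) X) {x : X}
    (hx : x ∈ e.source) :
    (symmD e (e x)).comp (fderiv ℝ (e ∘ (chartAt (Cn n) x).symm) (chartAt (Cn n) x x)) =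
      ContinuousLinearMap.id ℝ (Cn n) := by
  have hl := (chartAt (Cn n) x).left_inv (mem_chart_source (Cn n) x)
  have h := symmD_eq_comp (chart_mem_atlas (Cn n) x) he (mem_chart_target (Cn n) x)
    (by rwa [hl])
  rw [symmD_chartAt, hl] at h
  exact h.symm

theorem symmD_surjective {e : OpenPartialHomeomorph X (Cn n)} (he : e ∈ atlas (Cn n) X) {x : X}
    (hx : x ∈ e.source) : Function.Surjective (symmD e (e x)) := fun v =>
  ⟨_, congrArg (fun A : Cn n →L[ℝ] Cn n => A v) (symmD_comp_fderiv he hx)⟩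

theorem symmD_injective {e : OpenPartialHomeomorph X (Cn n)} (he : e ∈ atlas (Cn n) X) {x : X}
    (hx : x ∈ e.source) : Function.Injective (symmD e (e x)) :=
  LinearMap.injective_iff_surjective.2 (symmD_surjective he hx)

theorem quad_inChart (α : DForm n X (Fin 2)) {e : OpenPartialHomeomorph X (Cn n)}
    (he : e ∈ atlas (Cn n) X) {x : X} (hx : x ∈ e.source) (v : Cn n) :
    quad (coeffs (inChart e α (e x))) v =
      raw α x ![symmD e (e x) v, Complex.I • symmD e (e x) v] := by
  rw [quad_coeffs, inChart_eq, e.left_inv hx, ← symmD_smul_I he (e.map_source hx),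
    ContinuousAlternatingMap.compContinuousLinearMap_apply]
  congr 1
  funext i
  fin_cases i <;> rfl

/-- Positivity of a form, read in a chart. -/
theorem quad_pos_of_isPositive {α : DForm n X (Fin 2)} (hα : IsPositive α)
    {e : OpenPartialHomeomorph X (Cn n)} (he : e ∈ atlas (Cn n) X) {y : Cn n} (hy : y ∈ e.target)
    {v : Cn n} (hv : v ≠ 0) : 0 < quad (coeffs (inChart e α y)) v := by
  have hx := e.map_target hy
  rw [← e.right_inv hy, quad_inChart α he hx]
  exact hα (e.symm y) (symmD e (e (e.symm y)) v)
    fun h => hv (symmD_injective he hx (h.trans (map_zero _).symm))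

variable [T2Space X] [CompactSpace X]

/-- A form is positive if it is positive in the preferred charts, on the supports of the
weights. -/
theorem isPositive_of_quad_pos {α : DForm n X (Fin 2)} (hα : ∀ i ∈ idxSet n X, ∀ y ∈ wtSupp n i,
    ∀ v : Cn n, v ≠ 0 → 0 < quad (coeffs (inChart (chartAt (Cn n) i) α y)) v) : IsPositive α := by
  intro x v hv
  obtain ⟨i, hi, hix⟩ : ∃ i ∈ idxSet n X, pou n i x ≠ 0 := by
    by_contra! h
    exact one_ne_zero ((sum_pou (n := n) x).symm.trans (Finset.sum_eq_zero h))
  have hxt : x ∈ tsupport (pou n i) := subset_tsupport _ hix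
  have hx := tsupport_pou i hxt
  obtain ⟨w, hw⟩ := symmD_surjective (chart_mem_atlas (Cn n) i) hx v
  have h := hα i hi _ ⟨x, hxt, rfl⟩ w (by rintro rfl; exact hv (hw.symm.trans (map_zero _)))
  rw [quad_inChart α (chart_mem_atlas (Cn n) i) hx, hw] at h
  exact h

theorem ContST.continuousOn_quad {A : X → ℝ → Cn n → CMat n} (hA : ContST A) (i : X) :
    ContinuousOn (fun p : (ℝ × Cn n) × Cn n => quad (A i p.1.1 p.1.2) p.2)
      ((Set.Icc (0 : ℝ) 1 ×ˢ wtSupp n i) ×ˢ Metric.sphere (0 : Cn n) 1) := by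
  have h : ContinuousOn (fun p : (ℝ × Cn n) × Cn n => A i p.1.1 p.1.2)
      ((Set.Icc (0 : ℝ) 1 ×ˢ wtSupp n i) ×ˢ Metric.sphere (0 : Cn n) 1) :=
    ((hA i).mono (Set.prod_mono subset_rfl (wtSupp_subset i))).comp
      (f := fun p : (ℝ × Cn n) × Cn n => p.1) continuousOn_fst fun _ hp => hp.1
  have h' := h.prodMk (continuousOn_snd (s := (Set.Icc (0 : ℝ) 1 ×ˢ wtSupp n i) ×ˢ
    Metric.sphere (0 : Cn n) 1))
  have h3 := (continuous_quad (n := n)).comp_continuousOn h'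
  exact h3

/-- Positivity of `ω_φ` persists for small perturbations, uniformly on the part of space-time covered
by one chart: the quadratic forms are bounded below on the unit sphere by compactness. -/
theorem eventually_quad_pos (κ : KaehlerForm n X) {φ η : ℝ → X → ℝ} (hφ : PathSmooth n φ)
    (hη : PathSmooth n η) (hpos : ∀ t ∈ Set.Icc (0 : ℝ) 1, IsPositive (κ.add (φ t))) (i : X) :
    ∀ᶠ s : ℝ in 𝓝 0, ∀ t ∈ Set.Icc (0 : ℝ) 1, ∀ y ∈ wtSupp n i, ∀ v : Cn n,
      v ≠ 0 → 0 < quad (κ.mat φ i t y + s • hs η i t y) v := by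
  set K := (Set.Icc (0 : ℝ) 1 ×ˢ wtSupp n i) ×ˢ Metric.sphere (0 : Cn n) 1
  have hK : IsCompact K := (isCompact_Icc.prod (isCompact_wtSupp i)).prod (isCompact_sphere _ _)
  obtain ⟨m, hm, hm'⟩ := hK.exists_forall_le' ((κ.contST_mat hφ).continuousOn_quad i) (a := 0)
    fun p hp => by
      have hp2 : p.1.2 ∈ (chartAt (Cn n) i).target := wtSupp_subset i hp.1.2
      have h := quad_pos_of_isPositive (hpos p.1.1 hp.1.1) (chart_mem_atlas (Cn n) i) hp2
        (v := p.2) (ne_of_mem_of_not_mem hp.2 (by simp))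
      rwa [κ.coeffs_add (hφ.chartSmooth hp.1.1) (chart_mem_atlas _ i) hp2] at h
  obtain ⟨C, hC⟩ := hK.exists_bound_of_continuousOn (hη.contST_hs.continuousOn_quad i)
  have hlim : Filter.Tendsto (fun s : ℝ => |s| * |C|) (𝓝 0) (𝓝 0) := by
    have : Continuous fun s : ℝ => |s| * |C| := by fun_prop
    simpa using this.tendsto 0
  filter_upwards [hlim.eventually_lt_const hm] with s hs t ht y hy v hv
  have hv' : 0 < ‖v‖ := norm_pos_iff.2 hv
  -- reduction to unit vectors
  have hu : ((t, y), ‖v‖⁻¹ • v) ∈ K := by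
    refine ⟨⟨ht, hy⟩, ?_⟩
    rw [mem_sphere_zero_iff_norm, norm_smul, norm_inv, norm_norm, inv_mul_cancel₀ hv'.ne']
  have h1 : v = ‖v‖ • (‖v‖⁻¹ • v) := by rw [smul_smul, mul_inv_cancel₀ hv'.ne', one_smul]
  rw [h1, quad_smul, quad_add_smul]
  refine mul_pos (by positivity) ?_
  have h2 := hm' _ hu
  have h3 : |s * quad (KaehlerPotentials.hs η i t y) (‖v‖⁻¹ • v)| ≤ |s| * |C| := by
    rw [abs_mul]
    exact mul_le_mul_of_nonneg_left ((hC _ hu).trans (le_abs_self C)) (abs_nonneg s)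
  have h4 := neg_le_of_abs_le h3
  dsimp only at h2
  linarith

/-- Kähler potentials stay Kähler potentials under small perturbations in a fixed direction,
uniformly along a path. -/
theorem exists_isPositive_add (κ : KaehlerForm n X) {φ η : ℝ → X → ℝ} (hφ : PathSmooth n φ)
    (hη : PathSmooth n η) (hpos : ∀ t ∈ Set.Icc (0 : ℝ) 1, IsPositive (κ.add (φ t))) :
    ∃ ε > 0, ∀ s ∈ Set.Ioo (-ε) ε, ∀ t ∈ Set.Icc (0 : ℝ) 1,
      IsPositive (κ.add fun x => φ t x + s * η t x) := by
  obtain ⟨ε, hε, h⟩ := Metric.eventually_nhds_iff.1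
    ((Finset.eventually_all (idxSet n X)).2 fun i _ =>
      eventually_quad_pos κ hφ hη hpos i)
  refine ⟨ε, hε, fun s hs t ht => isPositive_of_quad_pos fun i hi y hy v hv => ?_⟩
  have hd : dist s 0 < ε := by rw [Real.dist_0_eq_abs]; exact abs_lt.2 hs
  have hy' := wtSupp_subset i hy
  have ha := chart_mem_atlas (Cn n) i
  have hsη : ChartSmooth n fun x => s * η t x :=
    fun e he => contDiffOn_const.mul (hη.chartSmooth ht e he)
  have h1 := h hd i hi t ht y hy v hv
  rwa [κ.coeffs_add ((hφ.chartSmooth ht).add hsη) ha hy',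
    show hess ((fun x => φ t x + s * η t x) ∘ (chartAt (Cn n) i).symm) y = _ from
      hess_add (chartAt (Cn n) i).open_target (hφ.chartSmooth ht _ ha) (hsη _ ha) hy',
    show hess ((fun x => s * η t x) ∘ (chartAt (Cn n) i).symm) y = _ from hess_const_mul _ _ _,
    ← add_assoc]

end

section

open MeasureTheory Finset

variable {n : ℕ} {X : Type*} [TopologicalSpace X] [ChartedSpace (Cn n) X]

/-! ### The Euler–Lagrange form -/

/-- The difference of the right and left hand sides of the equation of magnetic geodesics, for
`u = φ_t`, `v = φ̇_t` and `w = φ̈_t`. -/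
def eulerForm [IsManifold 𝓘(ℂ, Cn n) ω X] [T2Space X] [CompactSpace X] (κ : KaehlerForm n X)
    (u v w : X → ℝ) : DForm n X (Fin n × Fin 2) :=
  (n / κ.vol) •
      (wedgePowOne (wedgeOne (d v) (dc v)) (κ.add u)
        - (2 : ℝ) • wedgePowOne (ddc w) (κ.add v)
        - ((n : ℝ) - 1) • wedgePowTwo (ddc v) (ddc w) (κ.add v)) -
    fun x => w x • κ.MA u x

theorem contDiffOn_gradMat {f g : Cn n → ℝ} {U : Set (Cn n)} (hU : IsOpen U)
    (hf : ContDiffOn ℝ ∞ f U) (hg : ContDiffOn ℝ ∞ g U) : ContDiffOn ℝ ∞ (gradMat f g) U := by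
  have h1 (v : Cn n) : ContDiffOn ℝ ∞ (fun y => fderiv ℝ f y v) U :=
    (hf.fderiv_of_isOpen (m := ∞) hU (by simp)).clm_apply contDiffOn_const
  have h2 (v : Cn n) : ContDiffOn ℝ ∞ (fun y => dcFlat g y v) U :=
    (contDiffOn_dcFlat hU hg).clm_apply contDiffOn_const
  exact contDiffOn_pi.2 fun p => contDiffOn_pi.2 fun q =>
    ((h1 _).mul (h2 _)).sub ((h1 _).mul (h2 _))

omit [TopologicalSpace X] [ChartedSpace (Cn n) X] in
theorem dot_congr {φ ψ : ℝ → X → ℝ} (h : ∀ t ∈ Set.Icc (0 : ℝ) 1, φ t = ψ t) {t : ℝ}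
    (ht : t ∈ Set.Icc (0 : ℝ) 1) : dot φ t = dot ψ t := by
  funext x
  exact derivWithin_congr (fun τ hτ => congrFun (h τ hτ) x) (congrFun (h t ht) x)

theorem euler_congr (κ : KaehlerForm n X) {φ ψ : ℝ → X → ℝ}
    (h : ∀ t ∈ Set.Icc (0 : ℝ) 1, φ t = ψ t) {t : ℝ} (ht : t ∈ Set.Icc (0 : ℝ) 1) :
    (fun i => κ.euler φ i t) = fun i => κ.euler ψ i t := by
  have h1 : ∀ t ∈ Set.Icc (0 : ℝ) 1, dot φ t = dot ψ t := fun t ht => dot_congr h ht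
  have h2 := dot_congr h1 ht
  funext i y
  simp only [KaehlerForm.euler, gs, hs, KaehlerForm.mat, val, h t ht, h1 t ht, h2]

variable [IsManifold 𝓘(ℂ, Cn n) ω X] [T2Space X] [CompactSpace X]

theorem topCoeff_eulerForm (κ : KaehlerForm n X) {u v w : X → ℝ} (hu : ChartSmooth n u)
    (hv : ChartSmooth n v) (hw : ChartSmooth n w) {e : OpenPartialHomeomorph X (Cn n)}
    (he : e ∈ atlas (Cn n) X) {y : Cn n} (hy : y ∈ e.target) :
    topCoeff e (eulerForm κ u v w) y = κ.vol⁻¹ *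
      (n * (pfOne (gradMat (v ∘ e.symm) (v ∘ e.symm) y)
            (coeffs (inChart e κ.form y) + hess (u ∘ e.symm) y) -
          2 * pfOne (hess (w ∘ e.symm) y) (coeffs (inChart e κ.form y) + hess (v ∘ e.symm) y) -
          ((n : ℝ) - 1) * pfTwo (hess (v ∘ e.symm) y) (hess (w ∘ e.symm) y)
            (coeffs (inChart e κ.form y) + hess (v ∘ e.symm) y)) -
        w (e.symm y) * pfPow (coeffs (inChart e κ.form y) + hess (u ∘ e.symm) y)) := by
  rw [eulerForm, topCoeff_sub, topCoeff_smul, topCoeff_MA κ hu he hy, topCoeff_const_smul,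
    topCoeff_sub, topCoeff_sub, topCoeff_const_smul, topCoeff_const_smul, topCoeff_wedgePowOne,
    topCoeff_wedgePowOne, topCoeff_wedgePowTwo, coeffs_wedgeOne hv hv he hy, coeffs_ddc hw he hy,
    coeffs_ddc hv he hy, κ.coeffs_add hu he hy, κ.coeffs_add hv he hy]
  ring

theorem contTop_eulerForm (κ : KaehlerForm n X) {u v w : X → ℝ} (hu : ChartSmooth n u)
    (hv : ChartSmooth n v) (hw : ChartSmooth n w) : ContTop (eulerForm κ u v w) := fun e he => by
  refine ContinuousOn.congr ?_ fun y hy => topCoeff_eulerForm κ hu hv hw he hy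
  have cH {f : X → ℝ} (hf : ChartSmooth n f) : ContinuousOn (hess (f ∘ e.symm)) e.target :=
    (contDiffOn_hess e.open_target (hf e he)).continuousOn
  have cA {f : X → ℝ} (hf : ChartSmooth n f) : ContinuousOn
      (fun y => coeffs (inChart e κ.form y) + hess (f ∘ e.symm) y) e.target :=
    (κ.contDiffOn_coeffs he).continuousOn.add (cH hf)
  have cG := (contDiffOn_gradMat e.open_target (hv e he) (hv e he)).continuousOn
  have c1 := continuous_pfOne.comp_continuousOn (cG.prodMk (cA hu))
  have c2 := continuous_pfOne.comp_continuousOn ((cH hw).prodMk (cA hv))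
  have c3 := continuous_pfTwo.comp_continuousOn ((cH hv).prodMk ((cH hw).prodMk (cA hv)))
  have c4 := continuous_pfPow.comp_continuousOn (cA hu)
  exact continuousOn_const.mul ((continuousOn_const.mul ((c1.sub (continuousOn_const.mul c2)).sub
    (continuousOn_const.mul c3))).sub ((hw e he).continuousOn.mul c4))

theorem topCoeff_eulerForm_path (κ : KaehlerForm n X) {φ : ℝ → X → ℝ} (hφ : PathSmooth n φ)
    {t : ℝ} (ht : t ∈ Set.Icc (0 : ℝ) 1) (i : X) {y : Cn n}
    (hy : y ∈ (chartAt (Cn n) i).target) :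
    topCoeff (chartAt (Cn n) i) (eulerForm κ (φ t) (dot φ t) (dot (dot φ) t)) y =
      κ.vol⁻¹ * κ.euler φ i t y :=
  topCoeff_eulerForm κ (hφ.chartSmooth ht) (hφ.dot.chartSmooth ht) (hφ.dot.dot.chartSmooth ht)
    (chart_mem_atlas _ i) hy

omit [T2Space X] [CompactSpace X] in
/-- Top degree forms are determined by their coefficients in the preferred charts. -/
theorem eq_zero_of_topCoeff_eq_zero {η : DForm n X (Fin n × Fin 2)}
    (h : ∀ i : X, ∀ y ∈ (chartAt (Cn n) i).target, topCoeff (chartAt (Cn n) i) η y = 0) :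
    η = 0 := by
  funext x
  have h1 := h x _ (mem_chart_target (Cn n) x)
  rw [topCoeff, inChart_chartAt] at h1
  exact ext_stdFrame (f := raw η x) (g := 0) h1

/-! ### The fundamental lemma of the calculus of variations -/

omit [CompactSpace X] in
/-- A function on a chart domain with compact support extends by zero to `X`. -/
theorem contMDiff_extend_zero (j : X) {g : Cn n → ℝ} (hg : ContDiff ℝ ∞ g)
    (hc : HasCompactSupport g) (hs : tsupport g ⊆ (chartAt (Cn n) j).target) :
    ContMDiff 𝓘(ℝ, Cn n) 𝓘(ℝ, ℝ) ∞
      ((chartAt (Cn n) j).source.indicator fun x => g (chartAt (Cn n) j x)) := by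
  set e := chartAt (Cn n) j
  intro x
  by_cases hx : x ∈ e.source
  · have h1 : ContMDiffAt 𝓘(ℝ, Cn n) 𝓘(ℝ, ℝ) ∞ (fun x => g (e x)) x :=
      hg.contMDiff.contMDiffAt.comp x
        (contMDiffAt_of_mem_maximalAtlas (mem_maximalAtlas_of_mem_atlas (chart_mem_atlas _ j)) hx)
    refine h1.congr_of_eventuallyEq ?_
    filter_upwards [e.open_source.mem_nhds hx] with z hz
    rw [Set.indicator_of_mem hz]
  · have hK : IsCompact (e.symm '' tsupport g) :=
      hc.isCompact.image_of_continuousOn (e.continuousOn_symm.mono hs)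
    have hxK : x ∉ e.symm '' tsupport g := by
      rintro ⟨y, hy, rfl⟩
      exact hx (e.map_target (hs hy))
    refine (contMDiffAt_const (c := (0 : ℝ))).congr_of_eventuallyEq ?_
    filter_upwards [hK.isClosed.isOpen_compl.mem_nhds hxK] with z hz
    by_cases hz' : z ∈ e.source
    · rw [Set.indicator_of_mem hz']
      by_contra h
      exact hz ⟨e z, subset_tsupport _ h, e.left_inv hz'⟩
    · rw [Set.indicator_of_notMem hz']

/-- The fundamental lemma in space: test functions are taken with support in a chart domain. -/
theorem eq_zero_of_integral_smul_eq_zero {η : DForm n X (Fin n × Fin 2)} (hη : ContTop η)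
    (h : ∀ u : X → ℝ, ContMDiff 𝓘(ℝ, Cn n) 𝓘(ℝ, ℝ) ∞ u → integral (fun x => u x • η x) = 0) :
    η = 0 := by
  refine eq_zero_of_topCoeff_eq_zero fun j => ?_
  set e := chartAt (Cn n) j with he
  have hc : ContinuousOn (topCoeff e η) e.target := hη e (chart_mem_atlas _ j)
  have hae : ∀ᵐ y, y ∈ e.target → topCoeff e η y = 0 := by
    refine e.open_target.ae_eq_zero_of_integral_contDiff_smul_eq_zero
      (hc.locallyIntegrableOn e.open_target.measurableSet) fun g hg hgc hgs => ?_
    have hu := contMDiff_extend_zero j hg hgc hgs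
    set u := e.source.indicator fun x => g (e x) with hu_def
    have hu0 {x : X} (hx : x ∉ e.symm '' tsupport g) : u x = 0 := by
      by_cases hx' : x ∈ e.source
      · rw [hu_def, Set.indicator_of_mem hx']
        by_contra h
        exact hx ⟨e x, subset_tsupport _ h, e.left_inv hx'⟩
      · exact Set.indicator_of_notMem hx' _
    have h1 : ContTop (fun x => u x • η x) := fun e' he' => by
      refine ContinuousOn.congr ?_ fun y _ => topCoeff_smul e' u η y
      exact (chartSmooth_of_contMDiff hu e' he').continuousOn.mul (hη e' he')
    have h2 := integral_eq_setIntegral_chart h1 j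
      (hgc.isCompact.image_of_continuousOn (e.continuousOn_symm.mono hgs))
      (Set.image_subset_iff.2 fun y hy => e.map_target (hgs hy)) fun e' _ y _ hy => by
        rw [topCoeff_smul, hu0 hy, zero_mul]
    rw [h u hu] at h2
    rw [← setIntegral_eq_integral_of_forall_compl_eq_zero (s := e.target) fun y hy => by
      rw [image_eq_zero_of_notMem_tsupport fun h => hy (hgs h), zero_smul], h2]
    refine setIntegral_congr_fun e.open_target.measurableSet fun y hy => ?_
    simp only [← he, topCoeff_smul, hu_def, Set.indicator_of_mem (e.map_target hy),
      e.right_inv hy, smul_eq_mul]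
  exact Measure.eqOn_open_of_ae_eq
    ((ae_restrict_iff' e.open_target.measurableSet).2 hae) e.open_target hc continuousOn_const

/-- The fundamental lemma in time, with test functions that vanish at both ends. -/
theorem eq_zero_of_intervalIntegral_mul_eq_zero {G : ℝ → ℝ}
    (hG : ContinuousOn G (Set.Icc 0 1))
    (h : ∀ χ : ℝ → ℝ, ContDiff ℝ ∞ χ → χ 0 = 0 → χ 1 = 0 → ∫ t in (0 : ℝ)..1, χ t * G t = 0) :
    ∀ t ∈ Set.Icc (0 : ℝ) 1, G t = 0 := by
  have hae : ∀ᵐ t, t ∈ Set.Ioo (0 : ℝ) 1 → G t = 0 := by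
    refine isOpen_Ioo.ae_eq_zero_of_integral_contDiff_smul_eq_zero
      ((hG.mono Set.Ioo_subset_Icc_self).locallyIntegrableOn measurableSet_Ioo)
      fun χ hχ _ hs => ?_
    have h0 {t : ℝ} (ht : t ∉ Set.Ioo (0 : ℝ) 1) : χ t = 0 :=
      image_eq_zero_of_notMem_tsupport fun h => ht (hs h)
    have h1 := h χ hχ (h0 (by simp)) (h0 (by simp))
    rw [intervalIntegral.integral_of_le zero_le_one, integral_Ioc_eq_integral_Ioo] at h1
    rw [← setIntegral_eq_integral_of_forall_compl_eq_zero (s := Set.Ioo (0 : ℝ) 1) fun t ht => by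
      rw [h0 ht, zero_smul]]
    exact h1
  refine Measure.eqOn_Icc_of_ae_eq volume zero_ne_one ?_ hG continuousOn_const
  rw [← Measure.restrict_congr_set Ioo_ae_eq_Icc]
  exact (ae_restrict_iff' measurableSet_Ioo).2 hae

/-! ### Extremals -/

/-- A solution of the Euler–Lagrange equation is an extremal. -/
theorem hasDerivAt_LH_of_euler_eq_zero (κ : KaehlerForm n X) {φ : ℝ → X → ℝ} {ε : ℝ}
    (hε : 0 < ε) {Φ : ℝ → ℝ → X → ℝ} (hΦ : κ.IsVariation φ ε Φ)
    (h : ∀ i, ∀ t ∈ Set.Icc (0 : ℝ) 1, ∀ y ∈ (chartAt (Cn n) i).target,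
      κ.vol⁻¹ * κ.euler φ i t y = 0) : HasDerivAt (fun s => κ.LH (Φ s)) 0 0 := by
  have hz : (0 : ℝ) ∈ Set.Ioo (-ε) ε := ⟨by linarith, hε⟩
  obtain ⟨C, hC⟩ := exists_LH_expansion κ hε hΦ.familySmooth
    (fun s hs => (hΦ.left s hs).trans (hΦ.left 0 hz).symm)
    (fun s hs => (hΦ.right s hs).trans (hΦ.right 0 hz).symm)
  refine hasDerivAt_zero_of_sq_bound (half_pos hε) (C := C) fun s hs => ?_
  have h1 := hC s hs
  rw [← stInt_const_mul] at h1
  have h2 : (stInt fun i t y => κ.vol⁻¹ * (val n (fun t x => Φ s t x - Φ 0 t x) i t y *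
      κ.euler (Φ 0) i t y)) = 0 := by
    have h3 : (stInt fun (_ : X) (_ : ℝ) (_ : Cn n) => (0 : ℝ)) = 0 := by simp [stInt, spInt]
    refine (stInt_congr fun i t ht y hy => ?_).trans h3
    have h4 := congrFun (congrFun (euler_congr κ hΦ.center ht) i) y
    rw [h4, mul_left_comm, h i t ht y hy, mul_zero]
  rw [h2] at h1
  simpa using h1

/-- The variations `φ_t + s χ(t) u`. -/
theorem isVariation_add {κ : KaehlerForm n X} {φ : ℝ → X → ℝ} (hφ : κ.IsPath φ) {χ : ℝ → ℝ}
    (hχ : ContDiff ℝ ∞ χ) (h0 : χ 0 = 0) (h1 : χ 1 = 0) {u : X → ℝ}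
    (hu : ContMDiff 𝓘(ℝ, Cn n) 𝓘(ℝ, ℝ) ∞ u) :
    ∃ ε > 0, κ.IsVariation φ ε fun s t x => φ t x + s * (χ t * u x) := by
  have hη : PathSmooth n fun t x => χ t * u x := fun e he =>
    (hχ.comp_contDiffOn contDiffOn_fst).mul
      ((chartSmooth_of_contMDiff hu e he).comp contDiffOn_snd fun _ hp => hp.2)
  obtain ⟨ε, hε, h⟩ := exists_isPositive_add κ hφ.pathSmooth hη fun t ht => (hφ.2 t ht).2
  refine ⟨ε, hε, ?_, fun s hs t ht => ⟨?_, h s hs t ht⟩, fun t _ => ?_, fun s _ => ?_,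
    fun s _ => ?_⟩
  · have c1 := hφ.1.comp (contMDiff_snd (I := 𝓘(ℝ, ℝ)) (J := 𝓘(ℝ, ℝ).prod 𝓘(ℝ, Cn n))
      (M := ℝ) (N := ℝ × X) (n := ∞)).contMDiffOn (s := Set.Ioo (-ε) ε ×ˢ Set.Icc 0 1 ×ˢ Set.univ)
      fun p hp => hp.2
    have c2 : ContMDiff (𝓘(ℝ, ℝ).prod (𝓘(ℝ, ℝ).prod 𝓘(ℝ, Cn n))) 𝓘(ℝ, ℝ) ∞
      fun p : ℝ × ℝ × X => p.1 := contMDiff_fst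
    have c3 : ContMDiff (𝓘(ℝ, ℝ).prod (𝓘(ℝ, ℝ).prod 𝓘(ℝ, Cn n))) 𝓘(ℝ, ℝ) ∞
      fun p : ℝ × ℝ × X => χ p.2.1 := hχ.contMDiff.comp (contMDiff_fst.comp contMDiff_snd)
    have c4 : ContMDiff (𝓘(ℝ, ℝ).prod (𝓘(ℝ, ℝ).prod 𝓘(ℝ, Cn n))) 𝓘(ℝ, ℝ) ∞
      fun p : ℝ × ℝ × X => u p.2.2 := hu.comp (contMDiff_snd.comp contMDiff_snd)
    exact c1.add (c2.mul (c3.mul c4)).contMDiffOn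
  · exact (hφ.2 t ht).1.add (contMDiff_const.mul (contMDiff_const.mul hu))
  · funext x
    simp
  · funext x
    simp [h0]
  · funext x
    simp [h1]

/-- For an extremal, the Euler–Lagrange expression is orthogonal at each time to all functions on
`X`: the variations `φ_t + s χ(t) u` and the fundamental lemma in time. -/
theorem spInt_euler_eq_zero (κ : KaehlerForm n X) {φ : ℝ → X → ℝ} (hφ : κ.IsPath φ)
    (hext : ∀ ε > 0, ∀ Φ : ℝ → ℝ → X → ℝ, κ.IsVariation φ ε Φ →
      HasDerivAt (fun s => κ.LH (Φ s)) 0 0) {u : X → ℝ}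
    (hu : ContMDiff 𝓘(ℝ, Cn n) 𝓘(ℝ, ℝ) ∞ u) {t : ℝ} (ht : t ∈ Set.Icc (0 : ℝ) 1) :
    κ.vol⁻¹ * spInt (fun i y => u ((chartAt (Cn n) i).symm y) * κ.euler φ i t y) = 0 := by
  have cu : ContST (n := n) fun i (_ : ℝ) y => u ((chartAt (Cn n) i).symm y) := fun i =>
    (chartSmooth_of_contMDiff hu _ (chart_mem_atlas _ i)).continuousOn.comp continuousOn_snd
      fun _ hp => hp.2
  have cG := (cu.mul (κ.contST_euler hφ.pathSmooth)).continuousOn_spInt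
  refine eq_zero_of_intervalIntegral_mul_eq_zero
    (G := fun t => κ.vol⁻¹ * spInt fun i y => u ((chartAt (Cn n) i).symm y) * κ.euler φ i t y)
    (continuousOn_const.mul cG) (fun χ hχ h0 h1 => ?_) t ht
  obtain ⟨ε, hε, hΦ⟩ := isVariation_add hφ hχ h0 h1 hu
  set Φ : ℝ → ℝ → X → ℝ := fun s t x => φ t x + s * (χ t * u x) with hΦ_def
  have hΦ0 : Φ 0 = φ := by
    funext t x
    simp [hΦ_def]
  have hz : (0 : ℝ) ∈ Set.Ioo (-ε) ε := ⟨by linarith, hε⟩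
  obtain ⟨C, hC⟩ := exists_LH_expansion κ hε hΦ.familySmooth
    (fun s hs => (hΦ.left s hs).trans (hΦ.left 0 hz).symm)
    (fun s hs => (hΦ.right s hs).trans (hΦ.right 0 hz).symm)
  have key : HasDerivAt (fun s => κ.LH (Φ s)) (∫ t in (0 : ℝ)..1, χ t * (κ.vol⁻¹ *
      spInt fun i y => u ((chartAt (Cn n) i).symm y) * κ.euler φ i t y)) 0 := by
    refine hasDerivAt_zero_of_sq_bound (half_pos hε) (C := C) fun s hs => ?_
    have h2 := hC s hs
    rw [hΦ0] at h2 ⊢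
    convert h2 using 3
    rw [stInt, ← intervalIntegral.integral_const_mul, ← intervalIntegral.integral_const_mul]
    congr 1
    funext t
    rw [mul_left_comm (χ t), mul_left_comm s, ← mul_assoc s, ← spInt_const_mul]
    congr 2
    funext i y
    simp only [val, hΦ_def]
    ring
  exact key.unique (hext ε hε Φ hΦ)

end

end KaehlerPotentials

end

open KaehlerPotentials in
theorem mainTheorem1 (n : ℕ) (X : Type*) [TopologicalSpace X] [ChartedSpace (Cn n) X]
    [IsManifold 𝓘(ℂ, Cn n) ω X] [T2Space X] [CompactSpace X]
    (κ : KaehlerForm n X) (φ₀ φ₁ : X → ℝ) (φ : ℝ → X → ℝ)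
    (hφ : κ.IsPath φ) (h₀ : φ 0 = φ₀) (h₁ : φ 1 = φ₁) :
    κ.IsMagneticGeodesic φ₀ φ₁ φ ↔
      ∀ t ∈ Set.Icc (0 : ℝ) 1,
        (fun x => dot (dot φ) t x • κ.MA (φ t) x) =
          (n / κ.vol) •
            (wedgePowOne (wedgeOne (d (dot φ t)) (dc (dot φ t))) (κ.add (φ t))
              - (2 : ℝ) • wedgePowOne (ddc (dot (dot φ) t)) (κ.add (dot φ t))
              - ((n : ℝ) - 1) •
                  wedgePowTwo (ddc (dot φ t)) (ddc (dot (dot φ) t)) (κ.add (dot φ t))) := by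
  have hP := hφ.pathSmooth
  have key : (∀ t ∈ Set.Icc (0 : ℝ) 1, eulerForm κ (φ t) (dot φ t) (dot (dot φ) t) = 0) ↔
      κ.IsMagneticGeodesic φ₀ φ₁ φ := by
    refine ⟨fun h => ⟨hφ, h₀, h₁, fun ε hε Φ hΦ =>
      hasDerivAt_LH_of_euler_eq_zero κ hε hΦ fun i t ht y hy => ?_⟩, fun h t ht => ?_⟩
    · rw [← topCoeff_eulerForm_path κ hP ht i hy, h t ht]
      rfl
    · refine eq_zero_of_integral_smul_eq_zero (contTop_eulerForm κ (hP.chartSmooth ht)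
        (hP.dot.chartSmooth ht) (hP.dot.dot.chartSmooth ht)) fun u hu => ?_
      rw [integral_eq_spInt, ← spInt_euler_eq_zero κ hφ h.extremal hu ht, ← spInt_const_mul]
      refine spInt_congr fun i y hy => ?_
      rw [topCoeff_smul, topCoeff_eulerForm_path κ hP ht i hy, mul_left_comm]
  rw [← key]
  refine forall₂_congr fun t _ => ?_
  rw [eulerForm, sub_eq_zero, eq_comm]
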